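/- Let $\mathscr{F}$ be a foliation by curves of degree $d\ge 2$ on $\mathbb{P}^3=\mathbb{P}^3_{\mathbb{C}}$, that is, a nontrivial section $\phi\in H^0(T\mathbb{P}^3(d-1))$ such that the cokernel of the induced map $\mathcal{O}_{\mathbb{P}^3}(1-d)\to T\mathbb{P}^3$ is torsion free. Let $N^*_{\mathscr{F}}$, the conormal sheaf, be the kernel of the dual map $\phi^\vee:\Omega^1_{\mathbb{P}^3}\to\mathcal{O}_{\mathbb{P}^3}(d-1)$, and let the singular scheme $\operatorname{Sing}(\mathscr{F})$ be the closed subscheme of $\mathbb{P}^3$ whose ideal sheaf, twisted by $\mathcal{O}_{\mathbb{P}^3}(d-1)$, is the image of $\phi^\vee$. Let $Z=\operatorname{Sing}_1(\mathscr{F})$ be its pure one-dimensional part: $\mathcal{O}_Z$ is the quotient of $\mathcal{O}_{\operatorname{Sing}(\mathscr{F})}$ by its largest subsheaf with support of codimension greater than $2$ in $\mathbb{P}^3$. Assume that $N^*_{\mathscr{F}}$ is locally free, and write $h^2(N^*_{\mathscr{F}}(1-d))=\dim_{\mathbb{C}}H^2(\mathbb{P}^3,N^*_{\mathscr{F}}(1-d))$.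 1. If $h^2(N^*_{\mathscr{F}}(1-d))=0$, then $Z$ is connected (and non-empty). 2. If $Z$ is reduced, then $h^2(N^*_{\mathscr{F}}(1-d))$ is finite and $Z$ has exactly $h^2(N^*_{\mathscr{F}}(1-d))+1$ connected components. -/

import Mathlib

open scoped TensorProduct KaehlerDifferential

noncomputable section

namespace FoliationP3

/-! ### Projective space and the sheaves `𝒪(n)` -/

/-- The homogeneous coordinate ring `ℂ[x₀, x₁, x₂, x₃]`. -/
abbrev S : Type := MvPolynomial (Fin 4) ℂ

/-- Its grading by degree. -/
abbrev deg : ℕ → Submodule ℂ S := MvPolynomial.homogeneousSubmodule (Fin 4) ℂ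

instance instGraded : GradedAlgebra deg := MvPolynomial.gradedAlgebra

/-- The points of the scheme `ℙ³ = Proj ℂ[x₀, x₁, x₂, x₃]`, with the Zariski topology. -/
abbrev P3 : Type := ProjectiveSpectrum deg

/-- The field of fractions of the homogeneous coordinate ring. -/
def K : Type := FractionRing S

instance : Field K := inferInstanceAs (Field (FractionRing S))

instance : Algebra S K := inferInstanceAs (Algebra S (FractionRing S))

instance : IsFractionRing S K := inferInstanceAs (IsFractionRing S (FractionRing S))

instance : Algebra ℂ K := inferInstanceAs (Algebra ℂ (FractionRing S))

instance : IsScalarTower ℂ S K := inferInstanceAs (IsScalarTower ℂ S (FractionRing S))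

/-- `s` is a fraction of homogeneous polynomials, of degree `n`, with denominator in `M`. -/
def IsFrac (M : Submonoid S) (n : ℤ) (s : K) : Prop :=
  ∃ (i j : ℕ) (a b : S), a ∈ deg i ∧ b ∈ deg j ∧ (i : ℤ) = j + n ∧ b ∈ M ∧
    s = algebraMap S K a / algebraMap S K b

/-- The polynomials that do not belong to the homogeneous prime of the point `x`. -/
abbrev notIn (x : P3) : Submonoid S := x.asHomogeneousIdeal.toIdeal.primeCompl

/-- `s` is a rational section of `𝒪(n)` which is regular at all points of `U`. -/
def IsSection (n : ℤ) (U : TopologicalSpace.Opens P3) (s : K) : Prop :=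
  IsFrac (nonZeroDivisors S) n s ∧ ∀ x ∈ U, IsFrac (notIn x) n s

lemma notIn_le (x : P3) : notIn x ≤ nonZeroDivisors S := by
  intro b hb
  refine mem_nonZeroDivisors_of_ne_zero ?_
  rintro rfl
  exact hb (Ideal.zero_mem _)

lemma IsFrac.add {M : Submonoid S} (hM : M ≤ nonZeroDivisors S) {n : ℤ} {s t : K}
    (hs : IsFrac M n s) (ht : IsFrac M n t) : IsFrac M n (s + t) := by
  obtain ⟨i, j, a, b, ha, hb, hij, hbM, rfl⟩ := hs
  obtain ⟨i', j', a', b', ha', hb', hij', hbM', rfl⟩ := ht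
  have h0 : algebraMap S K b ≠ 0 := by
    simpa using nonZeroDivisors.ne_zero (hM hbM)
  have h0' : algebraMap S K b' ≠ 0 := by
    simpa using nonZeroDivisors.ne_zero (hM hbM')
  refine ⟨i + j', j + j', a * b' + b * a', b * b', ?_, ?_, ?_, M.mul_mem hbM hbM', ?_⟩
  · refine Submodule.add_mem _ (SetLike.mul_mem_graded ha hb') ?_
    have h : i + j' = j + i' := by omega
    rw [h]
    exact SetLike.mul_mem_graded hb ha'
  · exact SetLike.mul_mem_graded hb hb'
  · push_cast; omega
  · rw [div_add_div _ _ h0 h0']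
    simp only [map_add, map_mul]

lemma IsFrac.mul {M : Submonoid S} {m n : ℤ} {s t : K}
    (hs : IsFrac M m s) (ht : IsFrac M n t) : IsFrac M (m + n) (s * t) := by
  obtain ⟨i, j, a, b, ha, hb, hij, hbM, rfl⟩ := hs
  obtain ⟨i', j', a', b', ha', hb', hij', hbM', rfl⟩ := ht
  refine ⟨i + i', j + j', a * a', b * b', SetLike.mul_mem_graded ha ha',
    SetLike.mul_mem_graded hb hb', by push_cast; omega, M.mul_mem hbM hbM', ?_⟩
  rw [div_mul_div_comm, map_mul, map_mul]

lemma IsFrac.const (M : Submonoid S) (c : ℂ) : IsFrac M 0 (algebraMap ℂ K c) := by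
  refine ⟨0, 0, MvPolynomial.C c, 1, MvPolynomial.isHomogeneous_C _ _,
    MvPolynomial.isHomogeneous_one _ _, by simp, M.one_mem, ?_⟩
  rw [map_one, div_one, IsScalarTower.algebraMap_apply ℂ S K]
  rfl

lemma IsFrac.zero_of {M : Submonoid S} {m : ℕ} (hm : 0 < m) {f : S} (hf : f ∈ deg m)
    (hfM : f ∈ M) (n : ℤ) : IsFrac M n 0 := by
  have h1 : n.natAbs ≤ n.natAbs * m := Nat.le_mul_of_pos_right _ hm
  refine ⟨(n.natAbs * m + n).toNat, n.natAbs * m, 0, f ^ n.natAbs, Submodule.zero_mem _, ?_, ?_,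
    M.pow_mem hfM _, by simp⟩
  · simpa using SetLike.pow_mem_graded n.natAbs hf
  · have h2 : (n.natAbs : ℤ) ≤ ((n.natAbs * m : ℕ) : ℤ) := by exact_mod_cast h1
    push_cast at h2 ⊢
    have h3 : -(n.natAbs : ℤ) ≤ n := by omega
    push_cast at h3
    rw [Int.toNat_of_nonneg (by linarith)]

lemma IsFrac.zero_at (x : P3) (n : ℤ) : IsFrac (notIn x) n 0 := by
  classical
  obtain ⟨f, hf, hfx⟩ := SetLike.not_le_iff_exists.1 x.not_irrelevant_le
  have h : ∃ m, GradedRing.proj deg m f ∉ x.asHomogeneousIdeal.toIdeal := by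
    by_contra hcon
    push Not at hcon
    refine hfx ?_
    have h2 := DirectSum.sum_support_decompose deg f
    rw [← h2]
    exact Ideal.sum_mem _ fun m _ => hcon m
  obtain ⟨m, hm⟩ := h
  refine IsFrac.zero_of (m := m) ?_ (f := GradedRing.proj deg m f) ?_ hm n
  · rcases Nat.eq_zero_or_pos m with rfl | h
    · exfalso
      apply hm
      rw [HomogeneousIdeal.mem_irrelevant_iff] at hf
      rw [hf]
      exact Ideal.zero_mem _
    · exact h
  · exact SetLike.coe_mem _

lemma IsFrac.zero (n : ℤ) : IsFrac (nonZeroDivisors S) n 0 :=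
  IsFrac.zero_of (m := 1) one_pos (f := MvPolynomial.X 0) (MvPolynomial.isHomogeneous_X _ _)
    (mem_nonZeroDivisors_of_ne_zero (MvPolynomial.X_ne_zero _)) n

lemma IsSection.add {n : ℤ} {U : TopologicalSpace.Opens P3} {s t : K}
    (hs : IsSection n U s) (ht : IsSection n U t) : IsSection n U (s + t) :=
  ⟨hs.1.add le_rfl ht.1, fun x hx => (hs.2 x hx).add (notIn_le x) (ht.2 x hx)⟩

lemma IsSection.mul {m n : ℤ} {U : TopologicalSpace.Opens P3} {s t : K}
    (hs : IsSection m U s) (ht : IsSection n U t) : IsSection (m + n) U (s * t) :=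
  ⟨hs.1.mul ht.1, fun x hx => (hs.2 x hx).mul (ht.2 x hx)⟩

lemma IsSection.mono {n : ℤ} {U V : TopologicalSpace.Opens P3} (h : V ≤ U) {s : K}
    (hs : IsSection n U s) : IsSection n V s :=
  ⟨hs.1, fun x hx => hs.2 x (h hx)⟩

/-- The ring of regular functions on the open set `U ⊆ ℙ³`, inside the field of fractions: the
fractions of homogeneous polynomials of the same degree that are regular at every point of `U`. -/
def regularSubalgebra (U : TopologicalSpace.Opens P3) : Subalgebra ℂ K where
  carrier := {s | IsSection 0 U s}
  add_mem' := IsSection.add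
  mul_mem' hs ht := by simpa using IsSection.mul hs ht
  algebraMap_mem' c := ⟨IsFrac.const _ c, fun _ _ => IsFrac.const _ c⟩

/-- The ring `𝒪(U)` of regular functions on the open set `U ⊆ ℙ³`. -/
def Reg (U : TopologicalSpace.Opens P3) : Type := regularSubalgebra U

instance (U : TopologicalSpace.Opens P3) : CommRing (Reg U) :=
  inferInstanceAs (CommRing (regularSubalgebra U))

instance (U : TopologicalSpace.Opens P3) : Algebra ℂ (Reg U) :=
  inferInstanceAs (Algebra ℂ (regularSubalgebra U))

instance (U : TopologicalSpace.Opens P3) : Algebra (Reg U) K :=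
  inferInstanceAs (Algebra (regularSubalgebra U) K)

instance (U : TopologicalSpace.Opens P3) : IsScalarTower ℂ (Reg U) K :=
  inferInstanceAs (IsScalarTower ℂ (regularSubalgebra U) K)

/-- The sections of the twisting sheaf `𝒪(n)` over `U`: the fractions of homogeneous polynomials,
of degree `n`, that are regular at every point of `U`. -/
def twistSubmodule (n : ℤ) (U : TopologicalSpace.Opens P3) : Submodule (Reg U) K where
  carrier := {s | IsSection n U s}
  add_mem' := IsSection.add
  zero_mem' := ⟨IsFrac.zero n, fun x _ => IsFrac.zero_at x n⟩
  smul_mem' r s hs := by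
    have h := IsSection.mul r.2 hs
    rwa [zero_add] at h

/-- The `𝒪(U)`-module `𝒪(n)(U)` of sections of the twisting sheaf `𝒪(n)` over `U`. -/
def Twist (n : ℤ) (U : TopologicalSpace.Opens P3) : Type := twistSubmodule n U

instance (n : ℤ) (U : TopologicalSpace.Opens P3) : AddCommGroup (Twist n U) :=
  inferInstanceAs (AddCommGroup (twistSubmodule n U))

instance (n : ℤ) (U : TopologicalSpace.Opens P3) : Module (Reg U) (Twist n U) :=
  inferInstanceAs (Module (Reg U) (twistSubmodule n U))

instance (n : ℤ) (U : TopologicalSpace.Opens P3) : Module ℂ (Twist n U) :=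
  inferInstanceAs (Module ℂ (twistSubmodule n U))

instance (n : ℤ) (U : TopologicalSpace.Opens P3) : IsScalarTower ℂ (Reg U) (Twist n U) :=
  inferInstanceAs (IsScalarTower ℂ (Reg U) (twistSubmodule n U))

/-- The open set where all the coordinates `xᵢ`, `i ∈ σ`, are nonzero. It is affine for `σ ≠ ∅`. -/
def stdOpen (σ : Finset (Fin 4)) : TopologicalSpace.Opens P3 :=
  ProjectiveSpectrum.basicOpen deg (∏ i ∈ σ, MvPolynomial.X i)

lemma stdOpen_anti {σ τ : Finset (Fin 4)} (h : σ ⊆ τ) : stdOpen τ ≤ stdOpen σ := by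
  intro x hx hmem
  refine hx ?_
  obtain ⟨c, hc⟩ := Finset.prod_dvd_prod_of_subset σ τ (fun i => (MvPolynomial.X i : S)) h
  rw [hc]
  exact Ideal.mul_mem_right _ _ hmem

/-- The standard affine chart `xᵢ ≠ 0`. -/
abbrev chart (i : Fin 4) : TopologicalSpace.Opens P3 := stdOpen {i}

/-- The restriction `𝒪(U) → 𝒪(V)`, an inclusion. -/
def resReg {U V : TopologicalSpace.Opens P3} (h : V ≤ U) : Reg U →ₐ[ℂ] Reg V :=
  Subalgebra.inclusion (S := regularSubalgebra U) (T := regularSubalgebra V)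
    fun _ hs => IsSection.mono h hs

/-- The restriction `𝒪(n)(U) → 𝒪(n)(V)`, an inclusion. -/
def resTwist (n : ℤ) {U V : TopologicalSpace.Opens P3} (h : V ≤ U) (s : Twist n U) : Twist n V :=
  ⟨s.1, IsSection.mono h s.2⟩

/-! ### Twisted vector fields and foliations by curves -/

/-- A global section of `Tℙ³(n)`, that is a `ℂ`-linear derivation of sheaves `𝒪 → 𝒪(n)`. -/
structure TwistedField (n : ℤ) where
  der : ∀ U : TopologicalSpace.Opens P3, Derivation ℂ (Reg U) (Twist n U)
  compat : ∀ {U V : TopologicalSpace.Opens P3} (h : V ≤ U) (f : Reg U),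
    der V (resReg h f) = resTwist n h (der U f)

/-- Multiplication of `s ∈ 𝒪(-n)(U)` with `t ∈ 𝒪(n)(U)`. -/
def pair (n : ℤ) (U : TopologicalSpace.Opens P3) : Twist (-n) U →ₗ[Reg U]
    Twist n U →ₗ[Reg U] Reg U :=
  LinearMap.mk₂ (Reg U)
    (fun s t => ⟨s.1 * t.1, by
      have h := IsSection.mul s.2 t.2
      rwa [neg_add_cancel] at h⟩)
    (fun _ _ _ => Subtype.ext (add_mul _ _ _))
    (fun _ _ _ => Subtype.ext (mul_assoc _ _ _))
    (fun _ _ _ => Subtype.ext (mul_add _ _ _))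
    (fun _ _ _ => Subtype.ext (mul_left_comm _ _ _))

namespace TwistedField

variable {n : ℤ} (φ : TwistedField n)

/-- The map `𝒪(-n)(U) → Tℙ³(U)`, `s ↦ s φ`, induced by a section `φ` of `Tℙ³(n)`; here `Tℙ³(U)` is
the module of `ℂ`-linear derivations of `𝒪(U)`, for `U` affine. -/
def tangentMap (U : TopologicalSpace.Opens P3) :
    Twist (-n) U →ₗ[Reg U] Derivation ℂ (Reg U) (Reg U) where
  toFun s := (pair n U s).compDer (φ.der U)
  map_add' s t := by ext f; simp
  map_smul' r s := by ext f; simp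

/-- The sections over the affine open set `U` of the cokernel of `𝒪(-n) → Tℙ³`. -/
def Normal (U : TopologicalSpace.Opens P3) : Type :=
  Derivation ℂ (Reg U) (Reg U) ⧸ LinearMap.range (φ.tangentMap U)

instance (U : TopologicalSpace.Opens P3) : AddCommGroup (φ.Normal U) :=
  Submodule.Quotient.addCommGroup (LinearMap.range (φ.tangentMap U))

instance (U : TopologicalSpace.Opens P3) : Module (Reg U) (φ.Normal U) :=
  Submodule.Quotient.module (LinearMap.range (φ.tangentMap U))

end TwistedField

/-- A foliation by curves of degree `d` on `ℙ³`: a nontrivial section `φ` of `Tℙ³(d - 1)` such that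
the cokernel of the induced map `𝒪(1 - d) → Tℙ³` is torsion free. -/
structure Foliation (d : ℕ) extends TwistedField ((d : ℤ) - 1) where
  nontrivial : ∃ U, der U ≠ 0
  torsionFree : ∀ i : Fin 4, Module.IsTorsionFree (Reg (chart i))
    (toTwistedField.Normal (chart i))

/-! ### The conormal sheaf -/

/-- Restriction of Kähler differentials, `f dg ↦ f|_V d(g|_V)`. For `U` affine, the sections over
`U` of the cotangent sheaf `Ω¹` of `ℙ³` are the Kähler differentials of `𝒪(U)` over `ℂ`. -/
def resKaehler {U V : TopologicalSpace.Opens P3} (h : V ≤ U) :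
    Ω[Reg U⁄ℂ] →+ Ω[Reg V⁄ℂ] :=
  letI : Algebra (Reg U) (Reg V) := (resReg h).toRingHom.toAlgebra
  haveI : IsScalarTower ℂ (Reg U) (Reg V) :=
    IsScalarTower.of_algebraMap_eq fun _ => rfl
  (KaehlerDifferential.map ℂ ℂ (Reg U) (Reg V)).toAddMonoidHom

lemma resKaehler_smul {U V : TopologicalSpace.Opens P3} (h : V ≤ U) (r : Reg U)
    (ω : Ω[Reg U⁄ℂ]) : resKaehler h (r • ω) = resReg h r • resKaehler h ω := by
  let : Algebra (Reg U) (Reg V) := (resReg h).toRingHom.toAlgebra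
  have : IsScalarTower ℂ (Reg U) (Reg V) :=
    IsScalarTower.of_algebraMap_eq fun _ => rfl
  refine (map_smul (KaehlerDifferential.map ℂ ℂ (Reg U) (Reg V)) r ω).trans ?_
  exact (algebraMap_smul (Reg V) r _).symm

lemma resKaehler_D {U V : TopologicalSpace.Opens P3} (h : V ≤ U) (f : Reg U) :
    resKaehler h (KaehlerDifferential.D ℂ (Reg U) f) =
      KaehlerDifferential.D ℂ (Reg V) (resReg h f) := by
  let : Algebra (Reg U) (Reg V) := (resReg h).toRingHom.toAlgebra
  have : IsScalarTower ℂ (Reg U) (Reg V) :=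
    IsScalarTower.of_algebraMap_eq fun _ => rfl
  exact KaehlerDifferential.map_D ℂ ℂ (Reg U) (Reg V) f

namespace TwistedField

variable {n : ℤ} (φ : TwistedField n)

/-- The dual map `φ^∨ : Ω¹(U) → 𝒪(n)(U)`, `df ↦ φ(f)`. -/
abbrev dual (U : TopologicalSpace.Opens P3) : Ω[Reg U⁄ℂ] →ₗ[Reg U] Twist n U :=
  (φ.der U).liftKaehlerDifferential

/-- The conormal sheaf `N^*`, the kernel of `φ^∨ : Ω¹ → 𝒪(n)`, over the affine open set `U`. -/
abbrev conormal (U : TopologicalSpace.Opens P3) : Submodule (Reg U) Ω[Reg U⁄ℂ] :=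
  LinearMap.ker (φ.dual U)

lemma dual_res {U V : TopologicalSpace.Opens P3} (h : V ≤ U) (ω : Ω[Reg U⁄ℂ]) :
    φ.dual V (resKaehler h ω) = resTwist n h (φ.dual U ω) := by
  have hω : ω ∈ Submodule.span (Reg U) (Set.range (KaehlerDifferential.D ℂ (Reg U))) := by
    rw [KaehlerDifferential.span_range_derivation]; trivial
  induction hω using Submodule.span_induction with
  | mem x hx =>
    obtain ⟨f, rfl⟩ := hx
    rw [resKaehler_D, Derivation.liftKaehlerDifferential_comp_D,
      Derivation.liftKaehlerDifferential_comp_D]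
    exact φ.compat h f
  | zero => simp only [map_zero]; rfl
  | add x y _ _ hx hy => simp only [map_add, hx, hy]; rfl
  | smul r x _ hx => rw [resKaehler_smul, map_smul, map_smul, hx]; rfl

/-- Restriction of sections of the conormal sheaf. -/
def resConormal {U V : TopologicalSpace.Opens P3} (h : V ≤ U) :
    φ.conormal U →+ φ.conormal V where
  toFun ω := ⟨resKaehler h ω.1, by
    rw [LinearMap.mem_ker, dual_res, LinearMap.mem_ker.1 ω.2]; rfl⟩
  map_zero' := Subtype.ext (map_zero _)
  map_add' x y := Subtype.ext (map_add _ _ _)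

/-- The sections of the twist `N^*(k) = N^* ⊗ 𝒪(k)` of the conormal sheaf over the affine open
set `U`. -/
abbrev ConormalTwist (k : ℤ) (U : TopologicalSpace.Opens P3) : Type :=
  φ.conormal U ⊗[Reg U] Twist k U

/-- Restriction `N^*(k)(U) → N^*(k)(V)`, `ω ⊗ s ↦ ω|_V ⊗ s|_V`, as an additive map. -/
def resConormalTwistAdd (k : ℤ) {U V : TopologicalSpace.Opens P3} (h : V ≤ U) :
    φ.ConormalTwist k U →+ φ.ConormalTwist k V :=
  TensorProduct.liftAddHom
    { toFun := fun ω =>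
        { toFun := fun s => φ.resConormal h ω ⊗ₜ[Reg V] resTwist k h s
          map_zero' := TensorProduct.tmul_zero _ _
          map_add' := fun s t => TensorProduct.tmul_add _ (resTwist k h s) (resTwist k h t) }
      map_zero' := AddMonoidHom.ext fun s => by
        change φ.resConormal h 0 ⊗ₜ[Reg V] resTwist k h s = 0
        rw [map_zero, TensorProduct.zero_tmul]
      map_add' := fun ω η => AddMonoidHom.ext fun s => by
        change φ.resConormal h (ω + η) ⊗ₜ[Reg V] resTwist k h s =
          φ.resConormal h ω ⊗ₜ[Reg V] resTwist k h s + φ.resConormal h η ⊗ₜ[Reg V] resTwist k h s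
        rw [map_add, TensorProduct.add_tmul] }
    (fun r ω s => by
      have h1 : φ.resConormal h (r • ω) = resReg h r • φ.resConormal h ω :=
        Subtype.ext (resKaehler_smul h r ω.1)
      have h2 : resTwist k h (r • s) = resReg h r • resTwist k h s := rfl
      change φ.resConormal h (r • ω) ⊗ₜ[Reg V] resTwist k h s =
        φ.resConormal h ω ⊗ₜ[Reg V] resTwist k h (r • s)
      rw [h1, h2, TensorProduct.smul_tmul])

/-- Restriction `N^*(k)(U) → N^*(k)(V)`, `ω ⊗ s ↦ ω|_V ⊗ s|_V`. -/
def resConormalTwist (k : ℤ) {U V : TopologicalSpace.Opens P3} (h : V ≤ U) :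
    φ.ConormalTwist k U →ₗ[ℂ] φ.ConormalTwist k V where
  toFun := φ.resConormalTwistAdd k h
  map_add' := map_add _
  map_smul' c x := by
    induction x using TensorProduct.induction_on with
    | zero => simp
    | add x y hx hy => simp only [smul_add, map_add, hx, hy]
    | tmul ω s =>
      rw [← TensorProduct.tmul_smul]
      change φ.resConormal h ω ⊗ₜ[Reg V] resTwist k h (c • s) =
        c • (φ.resConormal h ω ⊗ₜ[Reg V] resTwist k h s)
      rw [← TensorProduct.tmul_smul]
      rfl

/-- The conormal sheaf is locally free: every point of every standard affine chart has a basic open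
neighbourhood `f ≠ 0` over which the sheaf is free. -/
def ConormalLocallyFree : Prop :=
  ∀ (i : Fin 4) (p : PrimeSpectrum (Reg (chart i))), ∃ f ∉ p.asIdeal,
    Module.Free (Localization.Away f) (LocalizedModule.Away f (φ.conormal (chart i)))

end TwistedField

/-! ### Cohomology, by the alternating Čech complex of the standard affine cover -/

section Cech

variable (F : Finset (Fin 4) → Type) [∀ σ, AddCommGroup (F σ)] [∀ σ, Module ℂ (F σ)]
  (res : ∀ {σ τ : Finset (Fin 4)}, σ ⊆ τ → F σ →ₗ[ℂ] F τ)

/-- Čech cochains of degree `q` with values in `F`, where `F σ` stands for the sections over the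
intersection `stdOpen σ` of the standard charts `xᵢ ≠ 0`, `i ∈ σ`. -/
abbrev Cochain (q : ℕ) : Type := ∀ σ : {σ : Finset (Fin 4) // σ.card = q + 1}, F σ

/-- The Čech differential `(δ s)_τ = ∑_k (-1)^k s_{τ ∖ {i_k}}|_{U_τ}`, `τ = {i_0 < i_1 < ⋯}`. -/
def cechDiff (q : ℕ) : Cochain F q →ₗ[ℂ] Cochain F (q + 1) :=
  LinearMap.pi fun τ => ∑ i : {i // i ∈ τ.1}, (-1 : ℂ) ^ (τ.1.filter (· < i.1)).card •
    (res (Finset.erase_subset i.1 τ.1)).comp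
      (LinearMap.proj (⟨τ.1.erase i.1, by
        rw [Finset.card_erase_of_mem i.2, τ.2, Nat.add_sub_cancel]⟩ :
          {σ : Finset (Fin 4) // σ.card = q + 1}))

/-- The second Čech cohomology group. -/
abbrev CechH2 : Type :=
  LinearMap.ker (cechDiff F res 2) ⧸
    (LinearMap.range (cechDiff F res 1)).submoduleOf (LinearMap.ker (cechDiff F res 2))

end Cech

namespace TwistedField

variable {n : ℤ} (φ : TwistedField n)

/-- The dimension `h²(N^*(k))` of the cohomology group `H²(ℙ³, N^*(k))`. -/
def h2Conormal (k : ℤ) : Cardinal :=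
  Module.rank ℂ (CechH2 (fun σ => φ.ConormalTwist k (stdOpen σ))
    (fun h => φ.resConormalTwist k (stdOpen_anti h)))

/-! ### The singular scheme and its one-dimensional part -/

/-- The ideal of the singular scheme over the affine open set `U`: the image of the map
`Ω¹ ⊗ 𝒪(-n) → 𝒪` induced by `φ^∨ : Ω¹ → 𝒪(n)`. -/
def singIdeal (U : TopologicalSpace.Opens P3) : Ideal (Reg U) :=
  Ideal.span {a | ∃ (ω : Ω[Reg U⁄ℂ]) (s : Twist (-n) U), a = pair n U s (φ.dual U ω)}

/-- The ideal over the affine open set `U` of the pure one-dimensional part of the singular scheme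
`Z`: it consists of the functions whose class in `𝒪_Z` has support of codimension greater than two
in `ℙ³`. (The support of the class of `a` consists of the primes that contain all `r` with
`r a = 0` in `𝒪_Z`.) Hence `𝒪_Z` modulo its largest subsheaf with support of codimension greater
than two is the structure sheaf of the closed subscheme with this ideal. -/
def curveIdeal (U : TopologicalSpace.Opens P3) : Ideal (Reg U) where
  carrier := {a | ∀ p : Ideal (Reg U), p.IsPrime →
    (∀ r, r * a ∈ φ.singIdeal U → r ∈ p) → 2 < p.height}
  zero_mem' := fun p hp h => by
    refine absurd (h 1 (by simp)) ?_
    exact (Ideal.ne_top_iff_one p).1 hp.ne_top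
  add_mem' := fun {a b} ha hb p hp h => by
    by_contra hcon
    have h1 : ∃ r, r * a ∈ φ.singIdeal U ∧ r ∉ p := by
      by_contra h1; push Not at h1; exact hcon (ha p hp h1)
    have h2 : ∃ r, r * b ∈ φ.singIdeal U ∧ r ∉ p := by
      by_contra h2; push Not at h2; exact hcon (hb p hp h2)
    obtain ⟨r, hr, hrp⟩ := h1
    obtain ⟨t, ht, htp⟩ := h2
    have h3 : r * t * (a + b) ∈ φ.singIdeal U := by
      have h4 : r * t * (a + b) = t * (r * a) + r * (t * b) := by ring
      rw [h4]
      exact Ideal.add_mem _ (Ideal.mul_mem_left _ _ hr) (Ideal.mul_mem_left _ _ ht)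
    exact (hp.mem_or_mem (h _ h3)).elim hrp htp
  smul_mem' := fun c a ha p hp h => ha p hp fun r hr => h r (by
    have h1 : r * (c • a) = c * (r * a) := by rw [smul_eq_mul]; ring
    rw [h1]
    exact Ideal.mul_mem_left _ _ hr)

/-- The regular function `a` vanishes at the point `x`: it is a quotient of two homogeneous
polynomials of the same degree, the numerator vanishing at `x`, the denominator not. -/
def _root_.FoliationP3.VanishesAt (a : K) (x : P3) : Prop :=
  ∃ (i : ℕ) (f g : S), f ∈ deg i ∧ g ∈ deg i ∧ f ∈ x.asHomogeneousIdeal ∧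
    g ∉ x.asHomogeneousIdeal ∧ a = algebraMap S K f / algebraMap S K g

/-- The set of points of `sing₁`, the one-dimensional part of the singular scheme, as a subspace
of `ℙ³`. -/
def singCurve : Set P3 :=
  {x | ∃ i, x ∈ chart i ∧ ∀ a ∈ φ.curveIdeal (chart i), VanishesAt (algebraMap _ K a) x}

/-- `sing₁` is a reduced scheme. -/
def SingCurveReduced : Prop :=
  ∀ i : Fin 4, IsReduced (Reg (chart i) ⧸ φ.curveIdeal (chart i))

end TwistedField

end FoliationP3

end

/-!
Since `N^*` is the kernel of the surjection `Ω¹ → I(d - 1)`, `I` the ideal of the singular scheme,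
`0 → N^*(1 - d) → Ω¹(1 - d) → 𝒪 → 𝒪_Sing → 0` is exact. As `H¹(Ω¹(1 - d)) = H²(Ω¹(1 - d)) = 0`
for `d ≥ 2` and `H¹(𝒪) = 0`, the space `H²(N^*(1 - d))` is `H⁰(𝒪_Sing)` modulo the constants
(`nonempty_cechH2_equiv`). So the theorem is about the global functions on the singular scheme.

If `N^*` is locally free, then `sing₁` is the whole singular scheme
(`TwistedField.curveIdeal_eq_singIdeal`): a function killed modulo `I` by an ideal of height three is
killed by a regular sequence of length three, and the Koszul relations, which are trivial in the flat
module `N^*`, show that it belongs to `I`. In homogeneous coordinates a section of `Tℙ³(d - 1)` is a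
vector `P` of forms of degree `d` (`TwistedField.exists_formOf`), up to multiples of `x`, and the
singular scheme is defined by the `2 × 2` minors of the matrix with rows `x` and `P`
(`TwistedField.singCurve_eq`). It is not empty (`not_forall_mem_radical_minors`): otherwise the
fibre over the origin of the finite map `P - x` of affine four-space would be the reduced origin, so
the map would be birational; but the degrees of the polynomials in the components of `P - x` are all
multiples of `d`.

A global function on the singular scheme takes constant values (`exists_value`), because a field
element which maps the finite-dimensional space of forms of some degree into itself is an eigenvalue.
These values are locally constant, and all locally constant functions occur, because a decomposition
into two disjoint closed subsets comes from an idempotent (`exists_separating`). So global functions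
exist which are not constant if `sing₁` is disconnected; and in the reduced case, where a function
with values zero is zero (`TwistedField.mem_singSpace_of_vanAt`), the global functions are exactly
the functions on the finite set of connected components.

All the sheaves involved are subsheaves of constant sheaves on `ℙ³`: their sections are vectors of
rational functions, and the Čech complexes consist of subspaces of a fixed space. The cohomology of
`𝒪(n)` is computed from the `ℤ⁴`-grading by Laurent monomials (`cechExact_twistSpace`), that of
`Ω¹` from the Euler sequence (`cechExact_eulerSpace_one`, `cechExact_eulerSpace_two`).
-/

noncomputable section

namespace FoliationP3

open MvPolynomial

/-! ### Laurent monomials and the sections of `𝒪(n)` over the standard open sets -/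

/-- The homogeneous coordinate `xᵢ` as an element of the field of fractions. -/
def coord (i : Fin 4) : K := algebraMap S K (X i)

/-- The Laurent monomial `∏ xᵢ ^ aᵢ`. -/
def laurent (a : Fin 4 → ℤ) : K := ∏ i, coord i ^ a i

lemma algebraMap_S_injective : Function.Injective (algebraMap S K) :=
  IsFractionRing.injective S K

lemma coord_ne_zero (i : Fin 4) : coord i ≠ 0 := by
  unfold coord
  rw [Ne, map_eq_zero_iff _ algebraMap_S_injective]
  exact X_ne_zero i

lemma laurent_add (a b : Fin 4 → ℤ) : laurent (a + b) = laurent a * laurent b := by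
  unfold laurent
  rw [← Finset.prod_mul_distrib]
  exact Finset.prod_congr rfl fun i _ => zpow_add₀ (coord_ne_zero i) _ _

lemma laurent_zero : laurent 0 = 1 := by simp [laurent]

lemma laurent_ne_zero (a : Fin 4 → ℤ) : laurent a ≠ 0 :=
  Finset.prod_ne_zero_iff.2 fun i _ => zpow_ne_zero _ (coord_ne_zero i)

lemma laurent_single (i : Fin 4) (m : ℤ) : laurent (Pi.single i m) = coord i ^ m := by
  unfold laurent
  rw [Finset.prod_eq_single i]
  · simp
  · intro j _ hj
    simp [Pi.single_eq_of_ne hj]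
  · simp

lemma algebraMap_monomial (α : Fin 4 →₀ ℕ) (c : ℂ) :
    algebraMap S K (monomial α c) = c • laurent (fun i => (α i : ℤ)) := by
  rw [monomial_eq, map_mul, Algebra.smul_def, IsScalarTower.algebraMap_apply ℂ S K]
  congr 1
  rw [Finsupp.prod_fintype _ _ (fun i => pow_zero _), map_prod]
  exact Finset.prod_congr rfl fun i _ => by rw [map_pow, zpow_natCast]; rfl

lemma laurent_linearIndependent : LinearIndependent ℂ laurent := by
  rw [linearIndependent_iff']
  intro s g hg a ha
  -- A power of `x₀ x₁ x₂ x₃` turns all the Laurent monomials of `s` into monomials.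
  obtain ⟨N, hN⟩ : ∃ N : ℕ, ∀ b ∈ s, ∀ i, 0 ≤ b i + N := by
    refine ⟨∑ b ∈ s, ∑ i, (b i).natAbs, fun b hb i => ?_⟩
    have h1 : (b i).natAbs ≤ ∑ i, (b i).natAbs :=
      Finset.single_le_sum (f := fun i => (b i).natAbs) (fun _ _ => Nat.zero_le _)
        (Finset.mem_univ i)
    have h2 : ∑ i, (b i).natAbs ≤ ∑ b ∈ s, ∑ i, (b i).natAbs :=
      Finset.single_le_sum (f := fun b : Fin 4 → ℤ => ∑ i, (b i).natAbs)
        (fun _ _ => Nat.zero_le _) hb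
    omega
  let e : (Fin 4 → ℤ) → (Fin 4 →₀ ℕ) := fun b =>
    Finsupp.equivFunOnFinite.symm fun i => (b i + N).toNat
  have he : ∀ b ∈ s, laurent b * laurent (fun _ => (N : ℤ)) = laurent (fun i => (e b i : ℤ)) := by
    intro b hb
    rw [← laurent_add]
    congr 1
    funext i
    simp [e, Int.toNat_of_nonneg (hN b hb i)]
  have h1 : algebraMap S K (∑ b ∈ s, monomial (e b) (g b)) = 0 := by
    rw [map_sum]
    calc ∑ b ∈ s, algebraMap S K (monomial (e b) (g b))
        = (∑ b ∈ s, g b • laurent b) * laurent (fun _ => (N : ℤ)) := by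
          rw [Finset.sum_mul]
          refine Finset.sum_congr rfl fun b hb => ?_
          rw [algebraMap_monomial, smul_mul_assoc, he b hb]
      _ = 0 := by rw [hg, zero_mul]
  rw [map_eq_zero_iff _ algebraMap_S_injective] at h1
  have h2 := congrArg (coeff (e a)) h1
  rw [coeff_sum, Finset.sum_eq_single a] at h2
  · simpa using h2
  · intro b hb hba
    rw [coeff_monomial, if_neg]
    intro hab
    apply hba
    funext i
    have h3 := DFunLike.congr_fun hab i
    have h4 := hN b hb i
    have h5 := hN a ha i
    simp only [e, Finsupp.equivFunOnFinite_symm_apply_apply] at h3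
    omega
  · exact fun h => absurd ha h

/-- The exponents of the Laurent monomials of degree `n` which are regular where `xᵢ ≠ 0` for all
`i ∈ σ`. -/
def expSet (n : ℤ) (σ : Finset (Fin 4)) : Set (Fin 4 → ℤ) :=
  {a | ∑ i, a i = n ∧ ∀ i ∉ σ, 0 ≤ a i}

/-- The sections of `𝒪(n)` over `stdOpen σ`, as a complex vector space. -/
def twistSpace (n : ℤ) (σ : Finset (Fin 4)) : Submodule ℂ K where
  carrier := {s | IsSection n (stdOpen σ) s}
  add_mem' := IsSection.add
  zero_mem' := ⟨IsFrac.zero n, fun x _ => IsFrac.zero_at x n⟩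
  smul_mem' c s hs := by
    have h : IsSection 0 (stdOpen σ) (algebraMap ℂ K c) :=
      ⟨IsFrac.const _ c, fun _ _ => IsFrac.const _ c⟩
    have h2 := IsSection.mul h hs
    rwa [zero_add, ← Algebra.smul_def] at h2

lemma twistSpace_mono {n : ℤ} {σ τ : Finset (Fin 4)} (h : σ ⊆ τ) :
    twistSpace n σ ≤ twistSpace n τ := fun _ hs => IsSection.mono (stdOpen_anti h) hs

lemma mul_mem_twistSpace {m n : ℤ} {σ : Finset (Fin 4)} {s t : K} (hs : s ∈ twistSpace m σ)
    (ht : t ∈ twistSpace n σ) : s * t ∈ twistSpace (m + n) σ := IsSection.mul hs ht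

lemma mem_stdOpen {σ : Finset (Fin 4)} {x : P3} :
    x ∈ stdOpen σ ↔ ∀ i ∈ σ, (X i : S) ∉ x.asHomogeneousIdeal := by
  have : x ∈ stdOpen σ ↔ ∏ i ∈ σ, (X i : S) ∉ x.asHomogeneousIdeal := Iff.rfl
  rw [this]
  have h := x.isPrime.prod_mem_iff (s := σ) (x := fun i => (X i : S))
  change ¬ (∏ i ∈ σ, (X i : S)) ∈ x.asHomogeneousIdeal.toIdeal ↔ _
  rw [h]
  push Not
  rfl

lemma mem_chart {i : Fin 4} {x : P3} : x ∈ chart i ↔ (X i : S) ∉ x.asHomogeneousIdeal := by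
  rw [mem_stdOpen]; simp

lemma prod_X_pow_mem_deg (σ : Finset (Fin 4)) (m : Fin 4 → ℕ) :
    ∏ i ∈ σ, (X i : S) ^ m i ∈ deg (∑ i ∈ σ, m i) := by
  have h := IsHomogeneous.prod σ (fun i => (X i : S) ^ m i) m fun i _ => by
    simpa using (isHomogeneous_X ℂ i).pow (m i)
  exact h

lemma isFrac_laurent {M : Submonoid S} (a : Fin 4 → ℤ)
    (h : ∀ i, a i < 0 → (X i : S) ∈ M) : IsFrac M (∑ i, a i) (laurent a) := by
  refine ⟨∑ i, (a i).toNat, ∑ i, (-a i).toNat, ∏ i, X i ^ (a i).toNat, ∏ i, X i ^ (-a i).toNat,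
    prod_X_pow_mem_deg _ _, prod_X_pow_mem_deg _ _, ?_, ?_, ?_⟩
  · push_cast
    rw [← Finset.sum_add_distrib]
    exact Finset.sum_congr rfl fun i _ => by omega
  · refine Submonoid.prod_mem _ fun i _ => ?_
    rcases lt_or_ge (a i) 0 with h1 | h1
    · exact Submonoid.pow_mem _ (h i h1) _
    · rw [Int.toNat_of_nonpos (by omega), pow_zero]
      exact M.one_mem
  · rw [map_prod, map_prod, ← Finset.prod_div_distrib]
    refine Finset.prod_congr rfl fun i _ => ?_
    rw [map_pow, map_pow, ← zpow_natCast, ← zpow_natCast]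
    change coord i ^ a i = coord i ^ _ / coord i ^ _
    rw [← zpow_sub₀ (coord_ne_zero i)]
    congr 1
    omega

lemma laurent_mem_twistSpace {n : ℤ} {σ : Finset (Fin 4)} {a : Fin 4 → ℤ} (ha : a ∈ expSet n σ) :
    laurent a ∈ twistSpace n σ := by
  obtain ⟨rfl, ha⟩ := ha
  refine ⟨isFrac_laurent a fun i _ => mem_nonZeroDivisors_of_ne_zero (X_ne_zero i), fun x hx =>
    isFrac_laurent a fun i hi => ?_⟩
  have : i ∈ σ := by
    by_contra h
    have := ha i h
    omega
  exact mem_stdOpen.1 hx i this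

/-- The homogeneous polynomials of degree `m` which multiply `s` into the polynomials generate a
homogeneous ideal; no point of `stdOpen σ` contains it, so it contains a power of `∏ i ∈ σ, xᵢ`. -/
lemma IsSection.exists_pow {n : ℤ} {σ : Finset (Fin 4)} (hσ : σ.Nonempty) {s : K}
    (hs : IsSection n (stdOpen σ) s) :
    ∃ (m : ℕ) (a : S), s * algebraMap S K ((∏ i ∈ σ, X i) ^ m) = algebraMap S K a := by
  classical
  -- the ideal of denominators of `s`
  let D : Ideal S :=
    { carrier := {b | ∃ a, s * algebraMap S K b = algebraMap S K a}
      add_mem' := by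
        rintro b b' ⟨a, ha⟩ ⟨a', ha'⟩
        exact ⟨a + a', by rw [map_add, map_add, mul_add, ha, ha']⟩
      zero_mem' := ⟨0, by simp⟩
      smul_mem' := by
        rintro c b ⟨a, ha⟩
        exact ⟨c * a, by rw [smul_eq_mul, map_mul, map_mul, ← ha]; ring⟩ }
  let T : Set S := {b | b ∈ D ∧ ∃ m, b ∈ deg m}
  have hT : (Ideal.span T).IsHomogeneous deg :=
    Ideal.homogeneous_span deg T fun b hb => hb.2
  have hTD : Ideal.span T ≤ D := Ideal.span_le.2 fun b hb => hb.1
  suffices h : (∏ i ∈ σ, (X i : S)) ∈ (Ideal.span T).radical by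
    obtain ⟨m, hm⟩ := h
    obtain ⟨a, ha⟩ := hTD hm
    exact ⟨m, a, ha⟩
  rw [hT.radical_eq, Submodule.mem_sInf]
  rintro P ⟨hPh, hTP, hP⟩
  by_contra hcon
  have hX : ∀ i ∈ σ, (X i : S) ∉ P := by
    intro i hi hXi
    exact hcon (Ideal.mem_of_dvd P (Finset.dvd_prod_of_mem _ hi) hXi)
  obtain ⟨i0, hi0⟩ := hσ
  let x : P3 := ⟨⟨P, hPh⟩, hP, fun hle => hX i0 hi0 (hle (by
    rw [HomogeneousIdeal.mem_irrelevant_iff]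
    exact DirectSum.decompose_of_mem_ne deg (i := 1) (isHomogeneous_X ℂ i0) one_ne_zero))⟩
  have hx : x ∈ stdOpen σ := mem_stdOpen.2 hX
  obtain ⟨i, j, a, b, -, hb, -, hbM, rfl⟩ := hs.2 x hx
  have hb0 : algebraMap S K b ≠ 0 := by
    simpa using nonZeroDivisors.ne_zero (notIn_le x hbM)
  refine hbM (hTP (Ideal.subset_span ⟨⟨a, ?_⟩, j, hb⟩))
  field_simp

/-- A homogeneous fraction that is a polynomial is a homogeneous polynomial of the same degree. -/
lemma IsFrac.mem_deg {n : ℤ} {a : S} (h : IsFrac (nonZeroDivisors S) n (algebraMap S K a))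
    (ha : a ≠ 0) : ∃ m : ℕ, (m : ℤ) = n ∧ a ∈ deg m := by
  obtain ⟨i, j, c, b, hc, hb, hij, hbM, h⟩ := h
  have hb0 : b ≠ 0 := nonZeroDivisors.ne_zero hbM
  have hbK : algebraMap S K b ≠ 0 := by
    rwa [Ne, map_eq_zero_iff _ algebraMap_S_injective]
  rw [eq_div_iff hbK, ← map_mul] at h
  have h1 : a * b = c := algebraMap_S_injective h
  have h2 : (a * b).IsHomogeneous i := by rw [h1]; exact hc
  have h3 : a * b ≠ 0 := mul_ne_zero ha hb0
  -- compare the components of `a` with those of the homogeneous product `a * b`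
  have h4 : ∀ m, m + j ≠ i → homogeneousComponent m a = 0 := by
    intro m hm
    by_contra hne
    have h5 : homogeneousComponent (m + j) (a * b) = homogeneousComponent m a * b := by
      have h6 := DirectSum.coe_decompose_mul_add_of_right_mem deg (i := m) (a := a) hb
      rw [← MvPolynomial.decomposition.decompose'_apply, ← MvPolynomial.decomposition.decompose'_apply]
      exact h6
    rw [homogeneousComponent_of_mem h2, if_neg hm] at h5
    exact mul_ne_zero hne hb0 h5.symm
  have h5 : ∃ m, homogeneousComponent m a ≠ 0 := by
    by_contra hcon
    push Not at hcon
    apply ha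
    rw [← sum_homogeneousComponent a]
    exact Finset.sum_eq_zero fun m _ => hcon m
  obtain ⟨m, hm⟩ := h5
  have h6 : m + j = i := by
    by_contra hne
    exact hm (h4 m hne)
  refine ⟨m, by omega, ?_⟩
  have h7 : a = homogeneousComponent m a := by
    conv_lhs => rw [← sum_homogeneousComponent a]
    refine (Finset.sum_eq_single m (fun m' _ hne => h4 m' (by omega)) fun hnot => ?_)
    rw [Finset.mem_range] at hnot
    exact homogeneousComponent_eq_zero _ _ (by omega)
  rw [h7]
  exact homogeneousComponent_mem m a

/-- Sections of `𝒪(n)` over `stdOpen σ` are the quotients of homogeneous polynomials by powers of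
`∏ i ∈ σ, xᵢ`. -/
lemma exists_of_mem_twistSpace {n : ℤ} {σ : Finset (Fin 4)} (hσ : σ.Nonempty) {s : K}
    (hs : s ∈ twistSpace n σ) : ∃ (m j : ℕ) (a : S), a ∈ deg j ∧ (j : ℤ) = n + m * σ.card ∧
      s * algebraMap S K ((∏ i ∈ σ, X i) ^ m) = algebraMap S K a := by
  obtain ⟨m, a, ha⟩ := IsSection.exists_pow hσ hs
  have hden : (∏ i ∈ σ, (X i : S)) ^ m ∈ deg (m * σ.card) := by
    have := prod_X_pow_mem_deg σ (fun _ => m)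
    rw [Finset.prod_pow] at this
    simpa [mul_comm] using this
  by_cases h0 : a = 0
  · -- the zero section, with a large denominator
    have hs0 : s = 0 := by
      rw [h0, map_zero, mul_eq_zero, map_eq_zero_iff _ algebraMap_S_injective] at ha
      exact ha.resolve_right (pow_ne_zero _ (Finset.prod_ne_zero_iff.2 fun i _ => X_ne_zero i))
    refine ⟨n.natAbs, (n + n.natAbs * σ.card).toNat, 0, Submodule.zero_mem _, ?_, by simp [hs0]⟩
    have h1 : 1 ≤ σ.card := hσ.card_pos
    have h2 : (n.natAbs : ℤ) ≤ n.natAbs * σ.card := by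
      exact_mod_cast Nat.le_mul_of_pos_right _ h1
    rw [Int.toNat_of_nonneg (by omega)]
  · have h1 : IsFrac (nonZeroDivisors S) ((m * σ.card : ℕ) : ℤ)
        (algebraMap S K ((∏ i ∈ σ, X i) ^ m)) :=
      ⟨m * σ.card, 0, _, 1, hden, isHomogeneous_one _ _, by simp, Submonoid.one_mem _, by simp⟩
    have h2 := hs.1.mul h1
    rw [ha] at h2
    obtain ⟨j, hj, haj⟩ := h2.mem_deg h0
    exact ⟨m, j, a, haj, by rw [hj]; push_cast; ring, ha⟩

lemma algebraMap_prod_X_pow (σ : Finset (Fin 4)) (m : ℕ) :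
    algebraMap S K ((∏ i ∈ σ, X i) ^ m) = laurent (fun i => if i ∈ σ then (m : ℤ) else 0) := by
  rw [← Finset.prod_pow, map_prod, laurent, ← Finset.prod_subset (Finset.subset_univ σ)]
  · refine Finset.prod_congr rfl fun i hi => ?_
    rw [if_pos hi, map_pow, zpow_natCast]; rfl
  · intro i _ hi
    rw [if_neg hi, zpow_zero]

/-- The sections of `𝒪(n)` over `stdOpen σ` are spanned by Laurent monomials. -/
lemma twistSpace_eq_span {n : ℤ} {σ : Finset (Fin 4)} (hσ : σ.Nonempty) :
    twistSpace n σ = Submodule.span ℂ (laurent '' expSet n σ) := by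
  refine le_antisymm (fun s hs => ?_) (Submodule.span_le.2 ?_)
  · obtain ⟨m, j, a, ha, hj, h⟩ := exists_of_mem_twistSpace hσ hs
    rw [algebraMap_prod_X_pow] at h
    have h1 : s = ∑ α ∈ a.support, a.coeff α •
        laurent (fun i => (α i : ℤ) - if i ∈ σ then (m : ℤ) else 0) := by
      refine mul_right_cancel₀ (laurent_ne_zero _) (h.trans ?_)
      conv_lhs => rw [MvPolynomial.as_sum a, map_sum]
      rw [Finset.sum_mul]
      refine Finset.sum_congr rfl fun α _ => ?_
      rw [algebraMap_monomial, smul_mul_assoc, ← laurent_add]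
      congr 2
      funext i
      simp
    rw [h1]
    refine Submodule.sum_mem _ fun α hα => Submodule.smul_mem _ _ (Submodule.subset_span ⟨_, ?_, rfl⟩)
    refine ⟨?_, fun i hi => by simp [hi]⟩
    have h2 : α.degree = j := by
      by_contra hne
      exact MvPolynomial.mem_support_iff.1 hα (IsHomogeneous.coeff_eq_zero ha hne)
    rw [Finset.sum_sub_distrib, ← Nat.cast_sum, ← Finsupp.degree_eq_sum, h2, hj]
    simp [mul_comm]
  · rintro _ ⟨a, ha, rfl⟩
    exact laurent_mem_twistSpace ha

/-! ### Čech cochains with values in subspaces of a vector space -/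

/-- The sign with which `τ.erase i` enters the Čech differential at `τ`. -/
def cechSign (τ : Finset (Fin 4)) (i : Fin 4) : ℂ := (-1) ^ (τ.filter (· < i)).card

lemma cechSign_mul_self (τ : Finset (Fin 4)) (i : Fin 4) : cechSign τ i * cechSign τ i = 1 := by
  rw [cechSign, ← pow_add, ← two_mul, pow_mul]; simp

lemma cechSign_erase {τ : Finset (Fin 4)} {i j : Fin 4} (hi : i ∈ τ) (hj : j ∈ τ) (hij : i ≠ j) :
    cechSign τ i * cechSign (τ.erase i) j = -(cechSign τ j * cechSign (τ.erase j) i) := by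
  wlog h : i < j generalizing i j
  · rw [this hj hi hij.symm (lt_of_le_of_ne (not_lt.1 h) hij.symm), neg_neg]
  have h1 : (τ.erase j).filter (· < i) = τ.filter (· < i) := by
    ext k; simp only [Finset.mem_filter, Finset.mem_erase]
    exact ⟨fun hk => ⟨hk.1.2, hk.2⟩, fun hk => ⟨⟨(hk.2.trans h).ne, hk.1⟩, hk.2⟩⟩
  have h2 : (τ.erase i).filter (· < j) = (τ.filter (· < j)).erase i := by
    ext k; simp only [Finset.mem_filter, Finset.mem_erase]; tauto
  have h3 : (τ.filter (· < j)).card = ((τ.filter (· < j)).erase i).card + 1 :=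
    (Finset.card_erase_add_one (Finset.mem_filter.2 ⟨hi, h⟩)).symm
  simp only [cechSign, h1, h2, h3, pow_succ]
  ring

section

variable {M M' : Type*} [AddCommGroup M] [Module ℂ M] [AddCommGroup M'] [Module ℂ M']

/-- The Čech differential on families indexed by all the sets of indices. A family has its values
in a fixed vector space, which contains all the spaces of sections; in degree `q` only the index
sets with `q + 1` elements matter. -/
def cechD : (Finset (Fin 4) → M) →ₗ[ℂ] (Finset (Fin 4) → M) where
  toFun f τ := ∑ i ∈ τ, cechSign τ i • f (τ.erase i)
  map_add' f g := by
    funext τ; simp [smul_add, Finset.sum_add_distrib]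
  map_smul' c f := by
    funext τ; simp [Finset.smul_sum, smul_comm c]

lemma cechD_apply (f : Finset (Fin 4) → M) (τ : Finset (Fin 4)) :
    cechD f τ = ∑ i ∈ τ, cechSign τ i • f (τ.erase i) := rfl

lemma cechD_comp (L : M →ₗ[ℂ] M') (f : Finset (Fin 4) → M) (τ : Finset (Fin 4)) :
    cechD (fun σ => L (f σ)) τ = L (cechD f τ) := by
  simp [cechD_apply]

lemma cechD_cechD (f : Finset (Fin 4) → M) : cechD (cechD f) = 0 := by
  funext τ
  simp only [cechD_apply, Finset.smul_sum, smul_smul, Pi.zero_apply]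
  rw [Finset.sum_sigma']
  refine Finset.sum_involution (fun p _ => ⟨p.2, p.1⟩) ?_ ?_ ?_ ?_
  · rintro ⟨i, j⟩ h
    simp only [Finset.mem_sigma, Finset.mem_erase] at h
    simp only
    rw [cechSign_erase h.1 h.2.2 (Ne.symm h.2.1), Finset.erase_right_comm, neg_smul, neg_add_cancel]
  · rintro ⟨i, j⟩ h _ heq
    simp only [Finset.mem_sigma, Finset.mem_erase] at h
    exact h.2.1 (congrArg Sigma.fst heq)
  · rintro ⟨i, j⟩ h
    simp only [Finset.mem_sigma, Finset.mem_erase] at h ⊢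
    exact ⟨h.2.2, Ne.symm h.2.1, h.1⟩
  · intro _ _; rfl

/-- `f` is a Čech cochain, on index sets of cardinality `n`, with values in the spaces `X σ`. -/
def IsCochain (X : Finset (Fin 4) → Submodule ℂ M) (n : ℕ) (f : Finset (Fin 4) → M) : Prop :=
  ∀ σ : Finset (Fin 4), σ.card = n → f σ ∈ X σ

/-- The Čech complex of the spaces `X σ` is exact at the cochains on index sets of cardinality
`n + 1`. -/
def CechExact (X : Finset (Fin 4) → Submodule ℂ M) (n : ℕ) : Prop :=
  ∀ f, IsCochain X (n + 1) f → (∀ τ : Finset (Fin 4), τ.card = n + 2 → cechD f τ = 0) →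
    ∃ g, IsCochain X n g ∧ ∀ σ : Finset (Fin 4), σ.card = n + 1 → cechD g σ = f σ

lemma cechD_congr {f g : Finset (Fin 4) → M} {n : ℕ}
    (h : ∀ σ : Finset (Fin 4), σ.card = n → f σ = g σ) {τ : Finset (Fin 4)}
    (hτ : τ.card = n + 1) : cechD f τ = cechD g τ := by
  rw [cechD_apply, cechD_apply]
  refine Finset.sum_congr rfl fun i hi => ?_
  rw [h _ (by rw [Finset.card_erase_of_mem hi, hτ, Nat.add_sub_cancel])]

lemma IsCochain.cechD {X : Finset (Fin 4) → Submodule ℂ M}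
    (hX : ∀ σ τ : Finset (Fin 4), σ.Nonempty → σ ⊆ τ → X σ ≤ X τ) {n : ℕ} (hn : n ≠ 0)
    {f : Finset (Fin 4) → M} (hf : IsCochain X n f) : IsCochain X (n + 1) (cechD f) := by
  intro τ hτ
  refine Submodule.sum_mem _ fun i hi => Submodule.smul_mem _ _ ?_
  have h : (τ.erase i).card = n := by rw [Finset.card_erase_of_mem hi, hτ, Nat.add_sub_cancel]
  exact hX _ _ (Finset.card_pos.1 (by omega)) (Finset.erase_subset i τ) (hf _ h)

lemma CechExact.of_map {X : Finset (Fin 4) → Submodule ℂ M} {n : ℕ} (h : CechExact X n)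
    (L : M →ₗ[ℂ] M') (hL : Function.Injective L) {Y : Finset (Fin 4) → Submodule ℂ M'}
    (hn : n ≠ 0) (hY : ∀ σ : Finset (Fin 4), σ.Nonempty → Y σ = (X σ).map L) :
    CechExact Y n := by
  classical
  intro f hf hcl
  have h1 : ∀ σ : Finset (Fin 4), ∃ m, σ.card = n + 1 → m ∈ X σ ∧ L m = f σ := by
    intro σ
    by_cases hσ : σ.card = n + 1
    · have h2 := hf σ hσ
      rw [hY σ (Finset.card_pos.1 (by omega))] at h2
      obtain ⟨m, hm, hmf⟩ := h2
      exact ⟨m, fun _ => ⟨hm, hmf⟩⟩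
    · exact ⟨0, fun h => absurd h hσ⟩
  choose f' hf' using h1
  obtain ⟨g, hg, hgf⟩ := h f' (fun σ hσ => (hf' σ hσ).1) fun τ hτ => by
    apply hL
    rw [map_zero, ← cechD_comp, ← hcl τ hτ]
    exact cechD_congr (fun σ hσ => (hf' σ hσ).2) hτ
  refine ⟨fun σ => L (g σ), fun σ hσ => ?_, fun σ hσ => ?_⟩
  · rw [hY σ (Finset.card_pos.1 (by omega))]
    exact ⟨_, hg σ hσ, rfl⟩
  · rw [cechD_comp, hgf σ hσ, (hf' σ hσ).2]

lemma CechExact.pi {X : Finset (Fin 4) → Submodule ℂ M} {n : ℕ} (h : CechExact X n)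
    (ι : Type*) : CechExact (fun σ => Submodule.pi (Set.univ : Set ι) fun _ => X σ) n := by
  intro f hf hcl
  have h1 : ∀ j : ι, ∃ g, IsCochain X n g ∧
      ∀ σ : Finset (Fin 4), σ.card = n + 1 → FoliationP3.cechD g σ = f σ j := fun j =>
    h (fun σ => f σ j) (fun σ hσ => hf σ hσ j trivial) fun τ hτ => by
      have h2 := cechD_comp (LinearMap.proj (R := ℂ) (φ := fun _ : ι => M) j) f τ
      rw [hcl τ hτ, map_zero] at h2
      exact h2
  choose g hg hgf using h1
  refine ⟨fun σ j => g j σ, fun σ hσ j _ => hg j σ hσ, fun σ hσ => funext fun j => ?_⟩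
  rw [← hgf j σ hσ]
  exact (cechD_comp (LinearMap.proj (R := ℂ) (φ := fun _ : ι => M) j) (fun σ j => g j σ) σ).symm

end

/-! ### Vanishing of the cohomology of `𝒪(n)` -/

open Classical in
/-- Some index `i` with `0 ≤ aᵢ`, if there is one. -/
def nonnegIndex (a : Fin 4 → ℤ) : Fin 4 := if h : ∃ i, 0 ≤ a i then h.choose else 0

lemma nonnegIndex_spec {a : Fin 4 → ℤ} {i : Fin 4} (h : 0 ≤ a i) : 0 ≤ a (nonnegIndex a) := by
  have h' : ∃ i, 0 ≤ a i := ⟨i, h⟩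
  rw [nonnegIndex, dif_pos h']
  exact h'.choose_spec

/-- The coefficient of each Laurent monomial `a` is treated separately: if `i` is an index with
`0 ≤ aᵢ`, then adding `i` to the index sets is a contracting homotopy. -/
lemma cechExact_supported (k : ℤ) {n : ℕ} (hn : n ≤ 2) :
    CechExact (fun σ => Finsupp.supported ℂ ℂ (expSet k σ)) n := by
  classical
  intro f hf hcl
  let g : Finset (Fin 4) → (Fin 4 → ℤ) →₀ ℂ := fun σ =>
    ∑ i ∈ Finset.univ \ σ, cechSign (insert i σ) i •
      (f (insert i σ)).filter fun a => nonnegIndex a = i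
  have hg : ∀ σ a, g σ a = if nonnegIndex a ∈ σ then 0 else
      cechSign (insert (nonnegIndex a) σ) (nonnegIndex a) * f (insert (nonnegIndex a) σ) a := by
    intro σ a
    simp only [g, Finsupp.finsetSum_apply, Finsupp.smul_apply, Finsupp.filter_apply, smul_eq_mul,
      mul_ite, mul_zero]
    rw [Finset.sum_ite_eq]
    simp only [Finset.mem_sdiff, Finset.mem_univ, true_and, ite_not]
  refine ⟨g, fun σ hσ => ?_, fun τ hτ => ?_⟩
  · rw [Finsupp.mem_supported']
    intro a ha
    rw [hg]
    split_ifs with hi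
    · rfl
    · by_contra hne
      have h1 : f (insert (nonnegIndex a) σ) a ≠ 0 := right_ne_zero_of_mul hne
      have hcard : (insert (nonnegIndex a) σ).card = n + 1 := by
        rw [Finset.card_insert_of_notMem hi, hσ]
      have h2 : a ∈ expSet k (insert (nonnegIndex a) σ) := by
        by_contra h3
        exact h1 ((Finsupp.mem_supported' ℂ _).1 (hf _ hcard) a h3)
      -- as `n + 1 < 4`, some exponent of `a` is nonnegative
      obtain ⟨j, hj⟩ : ∃ j, j ∉ insert (nonnegIndex a) σ := by
        by_contra hcon
        push Not at hcon
        have := Finset.card_le_card (fun j _ => hcon j : Finset.univ ⊆ insert (nonnegIndex a) σ)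
        rw [hcard] at this
        simp at this
        omega
      have h4 := nonnegIndex_spec (h2.2 j hj)
      refine ha ⟨h2.1, fun l hl => ?_⟩
      by_cases hli : l = nonnegIndex a
      · rw [hli]; exact h4
      · exact h2.2 l (by simp [hli, hl])
  · ext a
    set i := nonnegIndex a with hi
    have hD : ∀ (f : Finset (Fin 4) → (Fin 4 → ℤ) →₀ ℂ) (τ : Finset (Fin 4)),
        cechD f τ a = ∑ j ∈ τ, cechSign τ j * f (τ.erase j) a := by
      intro f τ
      rw [cechD_apply, Finsupp.finsetSum_apply]
      rfl
    rw [hD]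
    by_cases hiτ : i ∈ τ
    · rw [Finset.sum_eq_single_of_mem i hiτ]
      · rw [hg, if_neg (by rw [← hi]; simp), ← hi, Finset.insert_erase hiτ, ← mul_assoc, cechSign_mul_self,
          one_mul]
      · intro j _ hj
        rw [hg, if_pos (by rw [← hi]; exact Finset.mem_erase.2 ⟨hj.symm, hiτ⟩), mul_zero]
    · have h1 := congrArg (fun s => s a) (hcl (insert i τ) (by
        rw [Finset.card_insert_of_notMem hiτ, hτ]))
      simp only [Finsupp.coe_zero, Pi.zero_apply] at h1
      rw [hD, Finset.sum_insert hiτ, Finset.erase_insert hiτ] at h1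
      have h2 : ∀ j ∈ τ, cechSign τ j * g (τ.erase j) a =
          -(cechSign (insert i τ) i) *
            (cechSign (insert i τ) j * f ((insert i τ).erase j) a) := by
        intro j hj
        have hij : i ≠ j := fun h => hiτ (h ▸ hj)
        have h3 : insert i (τ.erase j) = (insert i τ).erase j :=
          (Finset.erase_insert_of_ne hij).symm
        rw [hg, if_neg (by rw [← hi]; exact fun h => hiτ (Finset.mem_of_mem_erase h)), ← hi, h3]
        have h4 := cechSign_erase (Finset.mem_insert_self i τ) (Finset.mem_insert_of_mem hj) hij
        rw [Finset.erase_insert hiτ] at h4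
        have h5 := cechSign_mul_self (insert i τ) i
        have h6 := cechSign_mul_self ((insert i τ).erase j) i
        linear_combination (f ((insert i τ).erase j) a) * (cechSign (insert i τ) i *
          cechSign ((insert i τ).erase j) i * h4
          - cechSign τ j * cechSign ((insert i τ).erase j) i * h5
          - cechSign (insert i τ) i * cechSign (insert i τ) j * h6)
      rw [Finset.sum_congr rfl h2, ← Finset.mul_sum]
      have h5 := cechSign_mul_self (insert i τ) i
      linear_combination -(cechSign (insert i τ) i) * h1 + f τ a * h5

lemma linearCombination_laurent_injective :
    Function.Injective (Finsupp.linearCombination ℂ laurent) := laurent_linearIndependent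

lemma twistSpace_eq_map {n : ℤ} {σ : Finset (Fin 4)} (hσ : σ.Nonempty) :
    twistSpace n σ =
      (Finsupp.supported ℂ ℂ (expSet n σ)).map (Finsupp.linearCombination ℂ laurent) := by
  rw [twistSpace_eq_span hσ, Finsupp.span_image_eq_map_linearCombination]

/-- `H¹(𝒪(k)) = H²(𝒪(k)) = 0` on `ℙ³`. -/
lemma cechExact_twistSpace (k : ℤ) {n : ℕ} (hn : n ≠ 0) (hn2 : n ≤ 2) :
    CechExact (twistSpace k) n :=
  (cechExact_supported k hn2).of_map _ linearCombination_laurent_injective hn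
    fun _ hσ => twistSpace_eq_map hσ

/-- A section of `𝒪(n)` over all the charts is a combination of Laurent monomials of degree `n`
without negative exponents. -/
lemma exists_finsupp_of_mem_twistSpace {n : ℤ} {s : K} (h : ∀ i, s ∈ twistSpace n {i}) :
    ∃ f ∈ Finsupp.supported ℂ ℂ (expSet n ∅), s = Finsupp.linearCombination ℂ laurent f := by
  have h1 : ∀ i, ∃ f ∈ Finsupp.supported ℂ ℂ (expSet n {i}),
      Finsupp.linearCombination ℂ laurent f = s := by
    intro i
    have h2 := h i
    rwa [twistSpace_eq_map (Finset.singleton_nonempty i)] at h2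
  choose f hf hfs using h1
  have h2 : ∀ i, f i = f 0 := fun i =>
    linearCombination_laurent_injective ((hfs i).trans (hfs 0).symm)
  refine ⟨f 0, fun a ha => ?_, (hfs 0).symm⟩
  have h3 : ∀ i, a ∈ expSet n {i} := fun i => hf i (by rw [h2 i]; exact ha)
  refine ⟨(h3 0).1, fun i _ => ?_⟩
  by_cases hi : i = 0
  · exact (h3 1).2 i (by rw [hi]; decide)
  · exact (h3 0).2 i (by simpa using hi)

lemma eq_zero_of_mem_twistSpace {n : ℤ} (hn : n < 0) {s : K} (h : ∀ i, s ∈ twistSpace n {i}) :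
    s = 0 := by
  obtain ⟨f, hf, rfl⟩ := exists_finsupp_of_mem_twistSpace h
  have h0 : f = 0 := by
    ext a
    refine (Finsupp.mem_supported' ℂ _).1 hf a fun ha => ?_
    have h1 := Finset.sum_nonneg fun i (_ : i ∈ Finset.univ) => ha.2 i (Finset.notMem_empty i)
    rw [ha.1] at h1
    omega
  rw [h0, map_zero]

lemma exists_homogeneous_of_mem_twistSpace {m : ℕ} {s : K}
    (h : ∀ i, s ∈ twistSpace (m : ℤ) {i}) : ∃ p ∈ deg m, s = algebraMap S K p := by
  obtain ⟨f, hf, rfl⟩ := exists_finsupp_of_mem_twistSpace h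
  let e : (Fin 4 → ℤ) → (Fin 4 →₀ ℕ) := fun a => Finsupp.equivFunOnFinite.symm fun i => (a i).toNat
  have he : ∀ a ∈ f.support, ∀ i, (e a i : ℤ) = a i := fun a ha i => by
    simp [e, Int.toNat_of_nonneg ((hf ha).2 i (Finset.notMem_empty i))]
  refine ⟨∑ a ∈ f.support, monomial (e a) (f a), Submodule.sum_mem _ fun a ha => ?_, ?_⟩
  · refine isHomogeneous_monomial _ ?_
    have h1 := (hf ha).1
    rw [← Finset.sum_congr rfl fun i _ => he a ha i] at h1
    rw [Finsupp.degree_eq_sum]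
    exact_mod_cast h1
  · rw [Finsupp.linearCombination_apply, Finsupp.sum, map_sum]
    refine Finset.sum_congr rfl fun a ha => ?_
    rw [algebraMap_monomial, funext (he a ha)]

lemma exists_const_of_mem_twistSpace {s : K} (h : ∀ i, s ∈ twistSpace 0 {i}) :
    ∃ c : ℂ, s = algebraMap ℂ K c := by
  obtain ⟨p, hp, rfl⟩ := exists_homogeneous_of_mem_twistSpace (m := 0) h
  refine ⟨coeff 0 p, ?_⟩
  rw [IsScalarTower.algebraMap_apply ℂ S K]
  congr 1
  exact totalDegree_eq_zero_iff_eq_C.1 ((totalDegree_zero_iff_isHomogeneous _).2 hp)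

section

variable {M : Type*} [AddCommGroup M] [Module ℂ M]

lemma cechD_pair (f : Finset (Fin 4) → M) {i j : Fin 4} (h : i < j) :
    cechD f {i, j} = f {j} - f {i} := by
  have h1 : ({i, j} : Finset (Fin 4)).erase i = {j} := by
    ext k; simp only [Finset.mem_erase, Finset.mem_insert, Finset.mem_singleton]; grind
  have h2 : ({i, j} : Finset (Fin 4)).erase j = {i} := by
    ext k; simp only [Finset.mem_erase, Finset.mem_insert, Finset.mem_singleton]; grind
  have h3 : ({i, j} : Finset (Fin 4)).filter (· < i) = ∅ := by
    ext k; simp only [Finset.mem_filter, Finset.mem_insert, Finset.mem_singleton]; grind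
  have h4 : ({i, j} : Finset (Fin 4)).filter (· < j) = {i} := by
    ext k; simp only [Finset.mem_filter, Finset.mem_insert, Finset.mem_singleton]; grind
  rw [cechD_apply, Finset.sum_pair h.ne, h1, h2, cechSign, cechSign, h3, h4]
  simp [sub_eq_add_neg]

lemma cechD_triple (f : Finset (Fin 4) → M) {i j k : Fin 4} (h : i < j) (h' : j < k) :
    cechD f {i, j, k} = f {j, k} - f {i, k} + f {i, j} := by
  have h1 : ({i, j, k} : Finset (Fin 4)).erase i = {j, k} := by
    ext l; simp only [Finset.mem_erase, Finset.mem_insert, Finset.mem_singleton]; grind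
  have h2 : ({i, j, k} : Finset (Fin 4)).erase j = {i, k} := by
    ext l; simp only [Finset.mem_erase, Finset.mem_insert, Finset.mem_singleton]; grind
  have h3 : ({i, j, k} : Finset (Fin 4)).erase k = {i, j} := by
    ext l; simp only [Finset.mem_erase, Finset.mem_insert, Finset.mem_singleton]; grind
  have h4 : ({i, j, k} : Finset (Fin 4)).filter (· < i) = ∅ := by
    ext l; simp only [Finset.mem_filter, Finset.mem_insert, Finset.mem_singleton]; grind
  have h5 : ({i, j, k} : Finset (Fin 4)).filter (· < j) = {i} := by
    ext l; simp only [Finset.mem_filter, Finset.mem_insert, Finset.mem_singleton]; grind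
  have h6 : ({i, j, k} : Finset (Fin 4)).filter (· < k) = {i, j} := by
    ext l; simp only [Finset.mem_filter, Finset.mem_insert, Finset.mem_singleton]; grind
  rw [cechD_apply, Finset.sum_insert (by simp only [Finset.mem_insert, Finset.mem_singleton]; grind),
    Finset.sum_pair h'.ne, h1, h2, h3, cechSign, cechSign, cechSign, h4, h5, h6,
    Finset.card_pair h.ne]
  simp
  abel

end

lemma exists_lt_of_card_eq_two :
    ∀ σ : Finset (Fin 4), σ.card = 2 → ∃ i j, i < j ∧ σ = {i, j} := by decide

lemma exists_lt_of_card_eq_three :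
    ∀ σ : Finset (Fin 4), σ.card = 3 → ∃ i j k, i < j ∧ j < k ∧ σ = {i, j, k} := by decide

/-- `H¹(𝒪(k)) = 0`, for cocycles given on all ordered pairs of charts. -/
lemma exists_eq_sub_of_cocycle {k : ℤ} (h : Fin 4 → Fin 4 → K)
    (hmem : ∀ i j, h i j ∈ twistSpace k {i, j}) (hc : ∀ i j l, h i j + h j l = h i l) :
    ∃ t : Fin 4 → K, (∀ i, t i ∈ twistSpace k {i}) ∧ ∀ i j, h i j = t j - t i := by
  let f : Finset (Fin 4) → K := fun σ =>
    if hσ : σ.Nonempty then h (σ.min' hσ) (σ.max' hσ) else 0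
  have hf : ∀ i j, i < j → f {i, j} = h i j := by
    intro i j hij
    have hne : ({i, j} : Finset (Fin 4)).Nonempty := ⟨i, by simp⟩
    have h1 : ({i, j} : Finset (Fin 4)).min' hne = i := by
      refine le_antisymm (Finset.min'_le _ _ (by simp)) (Finset.le_min' _ _ _ fun k hk => ?_)
      simp only [Finset.mem_insert, Finset.mem_singleton] at hk
      rcases hk with rfl | rfl
      exacts [le_rfl, hij.le]
    have h2 : ({i, j} : Finset (Fin 4)).max' hne = j := by
      refine le_antisymm (Finset.max'_le _ _ _ fun k hk => ?_) (Finset.le_max' _ _ (by simp))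
      simp only [Finset.mem_insert, Finset.mem_singleton] at hk
      rcases hk with rfl | rfl
      exacts [hij.le, le_rfl]
    simp only [f]
    rw [dif_pos hne, h1, h2]
  obtain ⟨g, hg, hgf⟩ := cechExact_twistSpace k one_ne_zero one_le_two f
    (fun σ hσ => by
      obtain ⟨i, j, hij, rfl⟩ := exists_lt_of_card_eq_two σ hσ
      rw [hf i j hij]
      exact hmem i j)
    (fun τ hτ => by
      obtain ⟨i, j, l, hij, hjl, rfl⟩ := exists_lt_of_card_eq_three τ hτ
      rw [cechD_triple f hij hjl, hf _ _ hij, hf _ _ hjl, hf _ _ (hij.trans hjl), ← hc i j l]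
      ring)
  have h1 : ∀ i j, i < j → h i j = g {j} - g {i} := by
    intro i j hij
    rw [← cechD_pair g hij, hgf _ (Finset.card_pair hij.ne), hf i j hij]
  refine ⟨fun i => g {i}, fun i => hg _ (Finset.card_singleton i), fun i j => ?_⟩
  have h0 : ∀ i, h i i = 0 := fun i => by simpa using hc i i i
  rcases lt_trichotomy i j with hij | rfl | hij
  · exact h1 i j hij
  · rw [h0, sub_self]
  · have h2 := hc i j i
    rw [h0, h1 j i hij] at h2
    linear_combination h2

/-! ### Partial derivatives of rational functions -/

instance : Algebra.FormallyEtale S K := Algebra.FormallyEtale.of_isLocalization (nonZeroDivisors S)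

/-- The partial derivative `∂/∂xⱼ` on the field of fractions; it exists and is unique because the
localization `S → K` is formally étale. -/
def pd (j : Fin 4) : Derivation ℂ K K :=
  (((((Algebra.linearMap S K).compDer (pderiv j)).liftKaehlerDifferential).liftBaseChange K).comp
    (KaehlerDifferential.tensorKaehlerEquivOfFormallyEtale ℂ S K).symm.toLinearMap).compDer
    (KaehlerDifferential.D ℂ K)

lemma pd_algebraMap (j : Fin 4) (p : S) :
    pd j (algebraMap S K p) = algebraMap S K (pderiv j p) := by
  change ((((Algebra.linearMap S K).compDer (pderiv j)).liftKaehlerDifferential).liftBaseChange K)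
    ((KaehlerDifferential.tensorKaehlerEquivOfFormallyEtale ℂ S K).symm
      (KaehlerDifferential.D ℂ K (algebraMap S K p))) = _
  rw [KaehlerDifferential.tensorKaehlerEquivOfFormallyEtale_symm_D_algebraMap,
    LinearMap.liftBaseChange_tmul, Derivation.liftKaehlerDifferential_comp_D, one_smul]
  rfl

lemma pd_coord (i j : Fin 4) : pd j (coord i) = if i = j then 1 else 0 := by
  rw [coord, pd_algebraMap, pderiv_X]
  rcases eq_or_ne i j with rfl | h
  · simp
  · simp [h]

lemma pd_laurent (j : Fin 4) (a : Fin 4 → ℤ) :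
    pd j (laurent a) = a j • laurent (a - Pi.single j 1) := by
  have h1 : ∀ s : Finset (Fin 4), j ∉ s → pd j (∏ i ∈ s, coord i ^ a i) = 0 := by
    intro s
    induction s using Finset.induction_on with
    | empty => intro _; simp
    | insert i s his ih =>
      intro hj
      rw [Finset.mem_insert, not_or] at hj
      rw [Finset.prod_insert his, Derivation.leibniz, ih hj.2, Derivation.leibniz_zpow, pd_coord,
        if_neg (Ne.symm hj.1)]
      simp
  have h2 : ∀ b : Fin 4 → ℤ, laurent b = coord j ^ b j * ∏ i ∈ Finset.univ.erase j, coord i ^ b i :=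
    fun b => (Finset.mul_prod_erase _ _ (Finset.mem_univ j)).symm
  have h3 : ∏ i ∈ Finset.univ.erase j, coord i ^ (a - Pi.single j 1 : Fin 4 → ℤ) i =
      ∏ i ∈ Finset.univ.erase j, coord i ^ a i := by
    refine Finset.prod_congr rfl fun i hi => ?_
    rw [Pi.sub_apply, Pi.single_eq_of_ne (Finset.ne_of_mem_erase hi), sub_zero]
  rw [h2 a, h2 (a - Pi.single j 1), h3, Derivation.leibniz, h1 _ (Finset.notMem_erase _ _),
    Derivation.leibniz_zpow, pd_coord, if_pos rfl, Pi.sub_apply, Pi.single_eq_same]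
  simp only [smul_eq_mul, mul_zero, zero_add, mul_one, zsmul_eq_mul]
  ring

lemma pd_mem_twistSpace {n : ℤ} {σ : Finset (Fin 4)} (hσ : σ.Nonempty) {s : K}
    (hs : s ∈ twistSpace n σ) (j : Fin 4) : pd j s ∈ twistSpace (n - 1) σ := by
  rw [twistSpace_eq_span hσ] at hs
  induction hs using Submodule.span_induction with
  | zero => rw [map_zero]; exact Submodule.zero_mem _
  | add x y _ _ hx hy => rw [map_add]; exact Submodule.add_mem _ hx hy
  | smul c x _ hx => rw [Derivation.map_smul]; exact Submodule.smul_mem _ _ hx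
  | mem x hx =>
    obtain ⟨a, ha, rfl⟩ := hx
    rw [pd_laurent]
    by_cases h0 : a j = 0
    · rw [h0, zero_smul]; exact Submodule.zero_mem _
    · refine zsmul_mem (laurent_mem_twistSpace ⟨?_, fun i hi => ?_⟩) _
      · simp [Finset.sum_sub_distrib, ha.1]
      · have h1 := ha.2 i hi
        rcases eq_or_ne i j with rfl | hij
        · simp only [Pi.sub_apply, Pi.single_eq_same]; omega
        · simpa [Pi.single_eq_of_ne hij] using h1

/-- Euler's relation. -/
lemma sum_coord_mul_pd {n : ℤ} {σ : Finset (Fin 4)} (hσ : σ.Nonempty) {s : K}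
    (hs : s ∈ twistSpace n σ) : ∑ j, coord j * pd j s = n • s := by
  rw [twistSpace_eq_span hσ] at hs
  induction hs using Submodule.span_induction with
  | zero => simp
  | add x y _ _ hx hy => simp only [map_add, mul_add, Finset.sum_add_distrib, hx, hy, smul_add]
  | smul c x _ hx =>
    simp only [Derivation.map_smul, mul_smul_comm, ← Finset.smul_sum, hx]
    rw [smul_comm]
  | mem x hx =>
    obtain ⟨a, ha, rfl⟩ := hx
    rw [← ha.1, Finset.sum_smul]
    refine Finset.sum_congr rfl fun j _ => ?_
    rw [pd_laurent, mul_smul_comm, ← zpow_one (coord j), ← laurent_single, ← laurent_add,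
      add_sub_cancel]

/-! ### The Euler sequence -/

section Reg

variable {σ : Finset (Fin 4)} {i : Fin 4}

lemma Reg.ext {U : TopologicalSpace.Opens P3} {f g : Reg U}
    (h : algebraMap (Reg U) K f = algebraMap (Reg U) K g) : f = g := Subtype.ext h

/-- An element of `twistSpace 0 σ` as a regular function. -/
def toReg (f : K) (hf : f ∈ twistSpace 0 σ) : Reg (stdOpen σ) := ⟨f, hf⟩

@[simp] lemma algebraMap_toReg (f : K) (hf : f ∈ twistSpace 0 σ) :
    algebraMap (Reg (stdOpen σ)) K (toReg f hf) = f := rfl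

lemma algebraMap_mem_twistSpace (f : Reg (stdOpen σ)) :
    algebraMap (Reg (stdOpen σ)) K f ∈ twistSpace 0 σ := f.2

lemma coord_zpow_mem (hi : i ∈ σ) (n : ℤ) : coord i ^ n ∈ twistSpace n σ := by
  rw [← laurent_single]
  refine laurent_mem_twistSpace ⟨by simp, fun j hj => ?_⟩
  rw [Pi.single_eq_of_ne (by rintro rfl; exact hj hi)]

lemma coord_mem (i : Fin 4) (σ : Finset (Fin 4)) : coord i ∈ twistSpace 1 σ := by
  rw [← zpow_one (coord i), ← laurent_single]
  refine laurent_mem_twistSpace ⟨by simp, fun j _ => ?_⟩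
  rcases eq_or_ne j i with rfl | h
  · simp
  · simp [Pi.single_eq_of_ne h]

lemma coord_div_mem (hi : i ∈ σ) (j : Fin 4) : coord j / coord i ∈ twistSpace 0 σ := by
  have h := mul_mem_twistSpace (coord_mem j σ) (coord_zpow_mem hi (-1))
  rwa [add_neg_cancel, zpow_neg_one, ← div_eq_mul_inv] at h

/-- The function `xⱼ / xᵢ` on an open set where `xᵢ ≠ 0`. -/
def ratio (hi : i ∈ σ) (j : Fin 4) : Reg (stdOpen σ) := toReg (coord j / coord i) (coord_div_mem hi j)

lemma ratio_self (hi : i ∈ σ) : ratio hi i = 1 := Reg.ext (div_self (coord_ne_zero i))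

/-- The regular functions on `stdOpen σ` are generated by the `xⱼ / xᵢ` and, for `j ∈ σ`, the
`xᵢ / xⱼ`. -/
lemma adjoin_ratio (hi : i ∈ σ) : Algebra.adjoin ℂ
    (Set.range (ratio hi) ∪ {r | ∃ (j : Fin 4) (hj : j ∈ σ), r = ratio hj i}) =
      (⊤ : Subalgebra ℂ (Reg (stdOpen σ))) := by
  rw [eq_top_iff]
  rintro r -
  set B := Algebra.adjoin ℂ
    (Set.range (ratio hi) ∪ {r | ∃ (j : Fin 4) (hj : j ∈ σ), r = ratio hj i}) with hB
  suffices h : ∀ s ∈ twistSpace 0 σ, s ∈ B.map (IsScalarTower.toAlgHom ℂ (Reg (stdOpen σ)) K) by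
    obtain ⟨r', hr', h'⟩ := h _ (algebraMap_mem_twistSpace r)
    rwa [← Reg.ext h']
  intro s hs
  rw [twistSpace_eq_span ⟨i, hi⟩] at hs
  refine (Submodule.span_le (p := Subalgebra.toSubmodule
    (B.map (IsScalarTower.toAlgHom ℂ (Reg (stdOpen σ)) K)))).2 ?_ hs
  rintro _ ⟨a, ha, rfl⟩
  have h1 : laurent a = ∏ j, (coord j / coord i) ^ a j := by
    simp only [div_zpow, Finset.prod_div_distrib]
    have h2 : ∏ j, coord i ^ a j = 1 := by
      have h3 : ∀ s : Finset (Fin 4), ∏ j ∈ s, coord i ^ a j = coord i ^ ∑ j ∈ s, a j := by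
        intro s
        induction s using Finset.induction_on with
        | empty => simp
        | insert k s hk ih =>
          rw [Finset.prod_insert hk, Finset.sum_insert hk, ih, zpow_add₀ (coord_ne_zero i)]
      rw [h3, ha.1, zpow_zero]
    rw [h2, div_one]
    rfl
  rw [h1]
  refine Subalgebra.prod_mem _ fun j _ => ?_
  rcases le_or_gt 0 (a j) with hj | hj
  · obtain ⟨m, hm⟩ := Int.eq_ofNat_of_zero_le hj
    rw [hm, zpow_natCast]
    exact Subalgebra.pow_mem _ (Subalgebra.mem_map.2
      ⟨ratio hi j, Algebra.subset_adjoin (Or.inl ⟨j, rfl⟩), rfl⟩) _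
  · have hjσ : j ∈ σ := by
      by_contra h
      have := ha.2 j h
      omega
    obtain ⟨m, hm⟩ := Int.eq_ofNat_of_zero_le (neg_nonneg.2 hj.le)
    rw [← neg_neg (a j), hm, zpow_neg, ← inv_zpow, inv_div, zpow_natCast]
    exact Subalgebra.pow_mem _ (Subalgebra.mem_map.2
      ⟨ratio hjσ i, Algebra.subset_adjoin (Or.inr ⟨j, hjσ, rfl⟩), rfl⟩) _

/-- A derivation of `𝒪(stdOpen σ)` is determined by its values on the functions `xⱼ / xᵢ`. -/
lemma derivation_reg_ext {N : Type*} [AddCommGroup N] [Module ℂ N] [Module (Reg (stdOpen σ)) N]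
    (hi : i ∈ σ) {D₁ D₂ : Derivation ℂ (Reg (stdOpen σ)) N}
    (h : ∀ j, D₁ (ratio hi j) = D₂ (ratio hi j)) : D₁ = D₂ := by
  refine Derivation.ext_of_adjoin_eq_top _ (adjoin_ratio hi) ?_
  rintro r (⟨j, rfl⟩ | ⟨j, hj, rfl⟩)
  · exact h j
  · have h1 : ratio hj i * ratio hi j = 1 := Reg.ext (by
      rw [map_mul, map_one]
      change coord i / coord j * (coord j / coord i) = 1
      rw [div_mul_div_cancel₀ (coord_ne_zero j), div_self (coord_ne_zero i)])
    rw [D₁.leibniz_of_mul_eq_one h1, D₂.leibniz_of_mul_eq_one h1, h]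

/-- The gradient `f ↦ (∂f/∂xⱼ)ⱼ` of regular functions. -/
def gradDer (U : TopologicalSpace.Opens P3) : Derivation ℂ (Reg U) (Fin 4 → K) :=
  Derivation.mk'
    { toFun := fun f j => pd j (algebraMap (Reg U) K f)
      map_add' := fun f g => funext fun j => by simp
      map_smul' := fun c f => funext fun j => by
        rw [Algebra.smul_def, map_mul, ← IsScalarTower.algebraMap_apply, ← Algebra.smul_def,
          Derivation.map_smul]
        rfl }
    fun f g => funext fun j => by
      change pd j (algebraMap (Reg U) K (f * g)) = _
      rw [map_mul, Derivation.leibniz]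
      simp [Algebra.smul_def]

lemma gradDer_apply (U : TopologicalSpace.Opens P3) (f : Reg U) (j : Fin 4) :
    gradDer U f j = pd j (algebraMap (Reg U) K f) := rfl

/-- The embedding of the Kähler differentials of `𝒪(U)` into vectors of rational functions, which
sends `df` to the gradient of `f`. -/
def grad (U : TopologicalSpace.Opens P3) : Ω[Reg U⁄ℂ] →ₗ[Reg U] (Fin 4 → K) :=
  (gradDer U).liftKaehlerDifferential

lemma grad_D (U : TopologicalSpace.Opens P3) (f : Reg U) (j : Fin 4) :
    grad U (KaehlerDifferential.D ℂ (Reg U) f) j = pd j (algebraMap (Reg U) K f) := by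
  rw [grad, Derivation.liftKaehlerDifferential_comp_D, gradDer_apply]

lemma kaehler_induction {U : TopologicalSpace.Opens P3} {p : Ω[Reg U⁄ℂ] → Prop}
    (hD : ∀ f, p (KaehlerDifferential.D ℂ (Reg U) f)) (h0 : p 0)
    (hadd : ∀ ω η, p ω → p η → p (ω + η)) (hsmul : ∀ (r : Reg U) ω, p ω → p (r • ω))
    (ω : Ω[Reg U⁄ℂ]) : p ω := by
  have hω : ω ∈ Submodule.span (Reg U) (Set.range (KaehlerDifferential.D ℂ (Reg U))) := by
    rw [KaehlerDifferential.span_range_derivation]; trivial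
  induction hω using Submodule.span_induction with
  | mem x hx => obtain ⟨f, rfl⟩ := hx; exact hD f
  | zero => exact h0
  | add x y _ _ hx hy => exact hadd x y hx hy
  | smul r x _ hx => exact hsmul r x hx

lemma grad_resKaehler {U V : TopologicalSpace.Opens P3} (h : V ≤ U) (ω : Ω[Reg U⁄ℂ]) :
    grad V (resKaehler h ω) = grad U ω := by
  induction ω using kaehler_induction with
  | hD f =>
    funext j
    rw [resKaehler_D, grad_D, grad_D]
    rfl
  | h0 => simp
  | hadd ω η h1 h2 => simp [h1, h2]
  | hsmul r ω h1 =>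
    rw [resKaehler_smul, map_smul, map_smul, h1]
    rfl

/-- The vectors of sections of `𝒪(n)` over `stdOpen σ` orthogonal to the vector of coordinates. By
the Euler sequence, they are the sections of `Ω¹(n + 1)`. -/
def eulerSpace (n : ℤ) (σ : Finset (Fin 4)) : Submodule ℂ (Fin 4 → K) where
  carrier := {g | (∀ j, g j ∈ twistSpace n σ) ∧ ∑ j, coord j * g j = 0}
  add_mem' := by
    rintro g g' ⟨h1, h2⟩ ⟨h1', h2'⟩
    refine ⟨fun j => Submodule.add_mem _ (h1 j) (h1' j), ?_⟩
    simp [mul_add, Finset.sum_add_distrib, h2, h2']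
  zero_mem' := ⟨fun j => Submodule.zero_mem _, by simp⟩
  smul_mem' := by
    rintro c g ⟨h1, h2⟩
    refine ⟨fun j => Submodule.smul_mem _ _ (h1 j), ?_⟩
    simp only [Pi.smul_apply, mul_smul_comm, ← Finset.smul_sum, h2, smul_zero]

lemma pd_ratio (hi : i ∈ σ) (j k : Fin 4) : pd k (algebraMap _ K (ratio hi j)) =
    (if j = k then 1 / coord i else 0) - if i = k then coord j / coord i ^ 2 else 0 := by
  change pd k (coord j / coord i) = _
  have h := coord_ne_zero i
  rw [Derivation.leibniz_div, pd_coord, pd_coord]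
  simp only [smul_eq_mul]
  split_ifs <;> field_simp <;> simp

/-- Every differential on `stdOpen σ` is the combination of the `d(xⱼ / xᵢ)` whose coefficients are
`xᵢ` times the components of its gradient. -/
lemma exists_eq_sum_ratio (hi : i ∈ σ) (ω : Ω[Reg (stdOpen σ)⁄ℂ]) :
    ∃ c : Fin 4 → Reg (stdOpen σ), (∀ j, algebraMap _ K (c j) = coord i * grad _ ω j) ∧
      ω = ∑ j, c j • KaehlerDifferential.D ℂ (Reg (stdOpen σ)) (ratio hi j) := by
  have hmem : ∀ (f : Reg (stdOpen σ)) (j : Fin 4),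
      coord i * pd j (algebraMap _ K f) ∈ twistSpace 0 σ := by
    intro f j
    have h := mul_mem_twistSpace (coord_mem i σ)
      (pd_mem_twistSpace ⟨i, hi⟩ (algebraMap_mem_twistSpace f) j)
    rwa [zero_sub, add_neg_cancel] at h
  let D₂ : Derivation ℂ (Reg (stdOpen σ)) Ω[Reg (stdOpen σ)⁄ℂ] :=
    Derivation.mk'
      { toFun := fun f => ∑ j, toReg _ (hmem f j) •
          KaehlerDifferential.D ℂ (Reg (stdOpen σ)) (ratio hi j)
        map_add' := fun f g => by
          rw [← Finset.sum_add_distrib]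
          refine Finset.sum_congr rfl fun j _ => ?_
          rw [← add_smul]
          congr 1
          exact Reg.ext (by simp [mul_add])
        map_smul' := fun c f => by
          rw [RingHom.id_apply, Finset.smul_sum]
          refine Finset.sum_congr rfl fun j _ => ?_
          rw [← smul_assoc]
          congr 1
          refine Reg.ext ?_
          simp only [algebraMap_toReg, Algebra.smul_def, map_mul, ← IsScalarTower.algebraMap_apply]
          rw [← Algebra.smul_def, Derivation.map_smul, Algebra.smul_def]
          ring }
      fun f g => by
        change ∑ j, toReg _ (hmem (f * g) j) •
            KaehlerDifferential.D ℂ (Reg (stdOpen σ)) (ratio hi j) =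
          f • (∑ j, toReg _ (hmem g j) • KaehlerDifferential.D ℂ (Reg (stdOpen σ)) (ratio hi j)) +
          g • (∑ j, toReg _ (hmem f j) • KaehlerDifferential.D ℂ (Reg (stdOpen σ)) (ratio hi j))
        rw [Finset.smul_sum, Finset.smul_sum, ← Finset.sum_add_distrib]
        refine Finset.sum_congr rfl fun j _ => ?_
        rw [smul_smul, smul_smul, ← add_smul]
        congr 1
        refine Reg.ext ?_
        simp only [algebraMap_toReg, map_mul, map_add, Derivation.leibniz, smul_eq_mul]
        ring
  have hD₂ : ∀ f, D₂ f = ∑ j, toReg _ (hmem f j) •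
      KaehlerDifferential.D ℂ (Reg (stdOpen σ)) (ratio hi j) := fun _ => rfl
  have hD : KaehlerDifferential.D ℂ (Reg (stdOpen σ)) = D₂ := by
    refine derivation_reg_ext hi fun k => ?_
    rw [hD₂]
    rw [Finset.sum_eq_single k]
    · by_cases hki : k = i
      · subst hki
        rw [ratio_self, Derivation.map_one_eq_zero, smul_zero]
      · have h1 : toReg _ (hmem (ratio hi k) k) = 1 := Reg.ext (by
          rw [algebraMap_toReg, pd_ratio, if_pos rfl, if_neg (Ne.symm hki), sub_zero, map_one,
            mul_one_div_cancel (coord_ne_zero i)])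
        rw [h1, one_smul]
    · intro j _ hjk
      by_cases hji : j = i
      · subst hji
        rw [ratio_self, Derivation.map_one_eq_zero, smul_zero]
      · have h1 : toReg _ (hmem (ratio hi k) j) = 0 := Reg.ext (by
          rw [algebraMap_toReg, pd_ratio, if_neg (Ne.symm hjk), if_neg (Ne.symm hji), sub_zero,
            mul_zero, map_zero])
        rw [h1, zero_smul]
    · exact fun h => absurd (Finset.mem_univ k) h
  induction ω using kaehler_induction with
  | hD f =>
    refine ⟨fun j => toReg _ (hmem f j), fun j => ?_, ?_⟩
    · rw [algebraMap_toReg, grad_D]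
    · rw [← hD₂, ← hD]
  | h0 => exact ⟨0, by simp, by simp⟩
  | hadd ω η h1 h2 =>
    obtain ⟨c, hc, hω⟩ := h1
    obtain ⟨c', hc', hη⟩ := h2
    refine ⟨c + c', fun j => by simp [hc, hc', mul_add], ?_⟩
    rw [hω, hη, ← Finset.sum_add_distrib]
    exact Finset.sum_congr rfl fun j _ => (add_smul _ _ _).symm
  | hsmul r ω h1 =>
    obtain ⟨c, hc, hω⟩ := h1
    refine ⟨r • c, fun j => ?_, ?_⟩
    · rw [map_smul, Pi.smul_apply, Pi.smul_apply, smul_eq_mul, map_mul, hc, Algebra.smul_def]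
      ring
    · conv_lhs => rw [hω, Finset.smul_sum]
      exact Finset.sum_congr rfl fun j _ => by rw [smul_smul]; rfl

lemma grad_injective (hσ : σ.Nonempty) : Function.Injective (grad (stdOpen σ)) := by
  obtain ⟨i, hi⟩ := hσ
  rw [injective_iff_map_eq_zero]
  intro ω hω
  obtain ⟨c, hc, h⟩ := exists_eq_sum_ratio hi ω
  rw [h]
  refine Finset.sum_eq_zero fun j _ => ?_
  have h0 : c j = 0 := Reg.ext (by rw [hc, hω, Pi.zero_apply, mul_zero, map_zero])
  rw [h0, zero_smul]

lemma grad_sum_ratio (hi : i ∈ σ) (c : Fin 4 → Reg (stdOpen σ)) (k : Fin 4) :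
    grad _ (∑ j, c j • KaehlerDifferential.D ℂ (Reg (stdOpen σ)) (ratio hi j)) k =
      algebraMap _ K (c k) / coord i - if i = k then
        (∑ j, coord j * algebraMap _ K (c j)) / coord i ^ 2 else 0 := by
  have h : ∀ j, grad _ (c j • KaehlerDifferential.D ℂ (Reg (stdOpen σ)) (ratio hi j)) k =
      algebraMap _ K (c j) * ((if j = k then 1 / coord i else 0) -
        if i = k then coord j / coord i ^ 2 else 0) := fun j => by
    rw [map_smul, Pi.smul_apply, grad_D, pd_ratio, Algebra.smul_def]
  simp only [map_sum, Finset.sum_apply, h]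
  simp only [mul_sub, Finset.sum_sub_distrib, mul_ite, mul_zero, Finset.sum_ite_eq',
    Finset.mem_univ, if_true]
  congr 1
  · ring
  · split_ifs
    · rw [Finset.sum_div]
      exact Finset.sum_congr rfl fun j _ => by ring
    · simp

lemma grad_mem_eulerSpace (hσ : σ.Nonempty) (ω : Ω[Reg (stdOpen σ)⁄ℂ]) :
    grad _ ω ∈ eulerSpace (-1) σ := by
  induction ω using kaehler_induction with
  | hD f =>
    refine ⟨fun j => ?_, ?_⟩
    · rw [grad_D, ← zero_sub]
      exact pd_mem_twistSpace hσ (algebraMap_mem_twistSpace f) j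
    · simp only [grad_D]
      rw [sum_coord_mul_pd hσ (algebraMap_mem_twistSpace f), zero_smul]
  | h0 => rw [map_zero]; exact Submodule.zero_mem _
  | hadd ω η h1 h2 => rw [map_add]; exact Submodule.add_mem _ h1 h2
  | hsmul r ω h1 =>
    rw [map_smul]
    refine ⟨fun j => ?_, ?_⟩
    · have h := mul_mem_twistSpace (algebraMap_mem_twistSpace r) (h1.1 j)
      rwa [zero_add, ← Algebra.smul_def] at h
    · simp only [Pi.smul_apply, mul_smul_comm, ← Finset.smul_sum, h1.2, smul_zero]

lemma exists_grad_eq (hσ : σ.Nonempty) {g : Fin 4 → K} (hg : g ∈ eulerSpace (-1) σ) :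
    ∃ ω : Ω[Reg (stdOpen σ)⁄ℂ], grad _ ω = g := by
  obtain ⟨i, hi⟩ := hσ
  have hmem : ∀ j, coord i * g j ∈ twistSpace 0 σ := fun j => by
    have h := mul_mem_twistSpace (coord_mem i σ) (hg.1 j)
    rwa [add_neg_cancel] at h
  refine ⟨∑ j, toReg _ (hmem j) • KaehlerDifferential.D ℂ (Reg (stdOpen σ)) (ratio hi j),
    funext fun k => ?_⟩
  rw [grad_sum_ratio]
  simp only [algebraMap_toReg]
  have h : ∑ j, coord j * (coord i * g j) = 0 := by
    simp only [mul_left_comm _ (coord i), ← Finset.mul_sum, hg.2, mul_zero]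
  rw [h, zero_div, ite_self, sub_zero, mul_div_cancel_left₀ _ (coord_ne_zero i)]

end Reg

/-! ### Twisted vector fields in homogeneous coordinates -/

/-- The linear form `g ↦ ∑ Pⱼ gⱼ` on vectors of rational functions. -/
def formOf (P : Fin 4 → S) : (Fin 4 → K) →ₗ[K] K :=
  ∑ j, algebraMap S K (P j) • LinearMap.proj j

lemma formOf_apply (P : Fin 4 → S) (g : Fin 4 → K) :
    formOf P g = ∑ j, algebraMap S K (P j) * g j := by
  simp [formOf, Algebra.smul_def]

/-- The inclusion of the sections of `𝒪(n)` in the field of fractions. -/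
def twistVal (n : ℤ) (U : TopologicalSpace.Opens P3) : Twist n U →ₗ[Reg U] K :=
  (twistSubmodule n U).subtype

lemma twistVal_injective (n : ℤ) (U : TopologicalSpace.Opens P3) :
    Function.Injective (twistVal n U) := Subtype.val_injective

lemma twistVal_mem {n : ℤ} {σ : Finset (Fin 4)} (s : Twist n (stdOpen σ)) :
    twistVal n _ s ∈ twistSpace n σ := s.2

lemma twistVal_resTwist {n : ℤ} {U V : TopologicalSpace.Opens P3} (h : V ≤ U) (s : Twist n U) :
    twistVal n V (resTwist n h s) = twistVal n U s := rfl

/-- A section of `Tℙ³(d - 1)` is induced by a homogeneous vector field `∑ Pⱼ ∂/∂xⱼ` of degree `d`.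
In the chart `xᵢ ≠ 0` one may take `Pⱼ = xᵢ φ(xⱼ / xᵢ)`; on the overlaps these choices differ by
multiples of the radial field, which form a cocycle with values in `𝒪(d - 1)`. -/
lemma TwistedField.exists_formOf {d : ℕ} (φ : TwistedField ((d : ℤ) - 1)) :
    ∃ P : Fin 4 → S, (∀ j, P j ∈ deg d) ∧ ∀ σ : Finset (Fin 4), σ.Nonempty →
      ∀ ω : Ω[Reg (stdOpen σ)⁄ℂ],
        twistVal _ _ (φ.dual (stdOpen σ) ω) = formOf P (grad (stdOpen σ) ω) := by
  let t : Fin 4 → Fin 4 → K := fun i j =>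
    twistVal _ _ (φ.der (chart i) (ratio (Finset.mem_singleton_self i) j))
  have ht : ∀ {σ : Finset (Fin 4)} {i : Fin 4} (hi : i ∈ σ) (j : Fin 4),
      twistVal _ _ (φ.der (stdOpen σ) (ratio hi j)) = t i j := fun {σ i} hi j => by
    have h := φ.compat (stdOpen_anti (Finset.singleton_subset_iff.2 hi))
      (ratio (Finset.mem_singleton_self i) j)
    exact (congrArg (twistVal _ _) h).trans rfl
  have htmem : ∀ i j, t i j ∈ twistSpace ((d : ℤ) - 1) {i} := fun i j => twistVal_mem _
  have htself : ∀ i, t i i = 0 := fun i => by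
    simp only [t]
    rw [ratio_self, Derivation.map_one_eq_zero, map_zero]
  have htrans : ∀ i k j, t k j = coord j / coord i * t k i + coord i / coord k * t i j := by
    intro i k j
    have hi : i ∈ ({i, k} : Finset (Fin 4)) := by simp
    have hk : k ∈ ({i, k} : Finset (Fin 4)) := by simp
    have h1 : ratio hk j = ratio hi j * ratio hk i := Reg.ext (by
      rw [map_mul]
      change coord j / coord k = coord j / coord i * (coord i / coord k)
      rw [div_mul_div_cancel₀ (coord_ne_zero i)])
    rw [← ht hk j, h1, Derivation.leibniz, map_add, map_smul, map_smul, ht, ht]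
    rfl
  obtain ⟨s, hs, hst⟩ := exists_eq_sub_of_cocycle (k := (d : ℤ) - 1)
    (fun i k => coord k / coord i * t k i)
    (fun i k => by
      have h := mul_mem_twistSpace (coord_div_mem (Finset.mem_insert_self i {k}) k)
        (twistSpace_mono (by simp : ({k} : Finset (Fin 4)) ⊆ {i, k}) (htmem k i))
      rwa [zero_add] at h)
    (fun i k l => by
      have h := htrans k l i
      have h1 := coord_ne_zero i
      have h2 := coord_ne_zero k
      have h3 := coord_ne_zero l
      rw [h]
      field_simp
      ring)
  have hglue : ∀ i k j, coord k * t k j - s k * coord j = coord i * t i j - s i * coord j := by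
    intro i k j
    have h1 := hst i k
    have h2 := htrans i k j
    have h3 := coord_ne_zero i
    have h4 := coord_ne_zero k
    rw [h2]
    have h5 : s k = s i + coord k / coord i * t k i := by rw [h1]; ring
    rw [h5]
    field_simp
    ring
  have hmem : ∀ i j, coord i * t i j - s i * coord j ∈ twistSpace (d : ℤ) {i} := by
    intro i j
    have h1 := mul_mem_twistSpace (coord_mem i {i}) (htmem i j)
    have h2 := mul_mem_twistSpace (hs i) (coord_mem j {i})
    rw [add_sub_cancel] at h1
    rw [sub_add_cancel] at h2
    exact Submodule.sub_mem _ h1 h2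
  have hP : ∀ j, ∃ p ∈ deg d, coord 0 * t 0 j - s 0 * coord j = algebraMap S K p := fun j =>
    exists_homogeneous_of_mem_twistSpace fun i => by rw [hglue i 0 j]; exact hmem i j
  choose P hPdeg hP using hP
  refine ⟨P, hPdeg, fun σ hσ => ?_⟩
  obtain ⟨i, hi⟩ := hσ
  have hder : (twistVal _ _).compDer (φ.der (stdOpen σ)) =
      ((formOf P).restrictScalars (Reg (stdOpen σ))).compDer (gradDer (stdOpen σ)) := by
    refine derivation_reg_ext hi fun j => ?_
    change twistVal _ _ (φ.der (stdOpen σ) (ratio hi j)) = formOf P (gradDer _ (ratio hi j))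
    rw [ht, formOf_apply]
    simp only [gradDer_apply, pd_ratio, mul_sub, Finset.sum_sub_distrib, mul_ite, mul_zero,
      Finset.sum_ite_eq, Finset.mem_univ, if_true]
    rw [← hP, ← hP, hglue i 0, hglue i 0, htself]
    have := coord_ne_zero i
    field_simp
    ring
  intro ω
  induction ω using kaehler_induction with
  | hD f =>
    rw [Derivation.liftKaehlerDifferential_comp_D]
    have h := Derivation.congr_fun hder f
    refine h.trans (congrArg (formOf P) (funext fun j => ?_))
    rw [grad_D]; rfl
  | h0 => simp
  | hadd ω η h1 h2 => simp only [map_add, h1, h2]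
  | hsmul r ω h1 =>
    rw [map_smul, map_smul, map_smul, h1]
    exact (((formOf P).restrictScalars (Reg (stdOpen σ))).map_smul r _).symm

/-! ### The conormal sheaf and the singular ideal in homogeneous coordinates -/

lemma smul_mem_eulerSpace {m n : ℤ} {σ : Finset (Fin 4)} {s : K} {g : Fin 4 → K}
    (hs : s ∈ twistSpace m σ) (hg : g ∈ eulerSpace n σ) : s • g ∈ eulerSpace (m + n) σ := by
  refine ⟨fun j => mul_mem_twistSpace hs (hg.1 j), ?_⟩
  simp only [Pi.smul_apply, smul_eq_mul, mul_left_comm _ s, ← Finset.mul_sum, hg.2, mul_zero]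

lemma eulerSpace_mono {n : ℤ} {σ τ : Finset (Fin 4)} (h : σ ⊆ τ) :
    eulerSpace n σ ≤ eulerSpace n τ := fun _ hg => ⟨fun j => twistSpace_mono h (hg.1 j), hg.2⟩

/-- The vectors of `eulerSpace n σ` orthogonal to the vector field `P`. They are the sections over
`stdOpen σ` of the twist by `n + 1` of the conormal sheaf. -/
def conormalSpace (P : Fin 4 → S) (n : ℤ) (σ : Finset (Fin 4)) : Submodule ℂ (Fin 4 → K) :=
  eulerSpace n σ ⊓ LinearMap.ker ((formOf P).restrictScalars ℂ)

lemma mem_conormalSpace {P : Fin 4 → S} {n : ℤ} {σ : Finset (Fin 4)} {g : Fin 4 → K} :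
    g ∈ conormalSpace P n σ ↔ g ∈ eulerSpace n σ ∧ formOf P g = 0 := Iff.rfl

lemma twistVal_smul_smul {k : ℤ} {U : TopologicalSpace.Opens P3} (r : Reg U) (s : Twist k U)
    (g : Fin 4 → K) : twistVal k U (r • s) • g = r • twistVal k U s • g := by
  rw [map_smul, smul_assoc]

lemma twistVal_smul_comm {k : ℤ} {U : TopologicalSpace.Opens P3} (r : Reg U) (s : Twist k U)
    (g : Fin 4 → K) : twistVal k U s • r • g = r • twistVal k U s • g := by
  funext j
  rw [Pi.smul_apply, Pi.smul_apply, Pi.smul_apply, Pi.smul_apply, smul_comm]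

namespace TwistedField

/-- The map `ω ⊗ s ↦ s ∇ω` from the sections of the twisted conormal sheaf to vectors of rational
functions. -/
def conormalVal {n : ℤ} (φ : TwistedField n) (k : ℤ) (U : TopologicalSpace.Opens P3) :
    φ.ConormalTwist k U →ₗ[Reg U] (Fin 4 → K) :=
  TensorProduct.lift (LinearMap.mk₂ (Reg U) (fun ω s => twistVal k U s • grad U ω.1)
    (fun ω η s => by simp) (fun r ω s => by simp [twistVal_smul_comm])
    (fun ω s t => by simp [add_smul]) (fun r ω s => by rw [twistVal_smul_smul]))

variable {n : ℤ} (φ : TwistedField n) (k : ℤ)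

lemma conormalVal_tmul {U : TopologicalSpace.Opens P3} (ω : φ.conormal U) (s : Twist k U) :
    φ.conormalVal k U (ω ⊗ₜ s) = twistVal k U s • grad U ω.1 := rfl

lemma conormalVal_res {U V : TopologicalSpace.Opens P3} (h : V ≤ U) (x : φ.ConormalTwist k U) :
    φ.conormalVal k V (φ.resConormalTwist k h x) = φ.conormalVal k U x := by
  induction x using TensorProduct.induction_on with
  | zero => simp
  | add x y hx hy => simp only [map_add, hx, hy]
  | tmul ω s =>
    change φ.conormalVal k V (φ.resConormal h ω ⊗ₜ[Reg V] resTwist k h s) = _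
    rw [conormalVal_tmul, conormalVal_tmul, twistVal_resTwist]
    congr 1
    exact grad_resKaehler h ω.1

/-- A section of `𝒪(k)` over `stdOpen σ`, as an element of the frozen type of sections. -/
def _root_.FoliationP3.toTwist {k : ℤ} {σ : Finset (Fin 4)} (s : K) (hs : s ∈ twistSpace k σ) :
    Twist k (stdOpen σ) := ⟨s, hs⟩

lemma _root_.FoliationP3.twistVal_toTwist {k : ℤ} {σ : Finset (Fin 4)} (s : K)
    (hs : s ∈ twistSpace k σ) : twistVal k (stdOpen σ) (toTwist s hs) = s := rfl

variable {P : Fin 4 → S} {φ} {σ : Finset (Fin 4)}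

/-- As `𝒪(k)` is trivial on `stdOpen σ`, all the sections of the twisted conormal sheaf are pure
tensors. -/
lemma exists_eq_tmul {i : Fin 4} (hi : i ∈ σ) (x : φ.ConormalTwist k (stdOpen σ)) :
    ∃ ω : φ.conormal (stdOpen σ), x = ω ⊗ₜ toTwist (coord i ^ k) (coord_zpow_mem hi k) := by
  induction x using TensorProduct.induction_on with
  | zero => exact ⟨0, by simp⟩
  | add x y hx hy =>
    obtain ⟨ω, rfl⟩ := hx
    obtain ⟨η, rfl⟩ := hy
    exact ⟨ω + η, (TensorProduct.add_tmul _ _ _).symm⟩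
  | tmul ω s =>
    have h := mul_mem_twistSpace (twistVal_mem s) (coord_zpow_mem hi (-k))
    rw [add_neg_cancel] at h
    refine ⟨toReg _ h • ω, ?_⟩
    rw [TensorProduct.smul_tmul]
    congr 1
    apply twistVal_injective
    rw [map_smul, twistVal_toTwist, Algebra.smul_def, algebraMap_toReg, mul_assoc,
      ← zpow_add₀ (coord_ne_zero i), neg_add_cancel, zpow_zero, mul_one]

lemma conormalVal_injective (hσ : σ.Nonempty) :
    Function.Injective (φ.conormalVal k (stdOpen σ)) := by
  obtain ⟨i, hi⟩ := hσ
  rw [injective_iff_map_eq_zero]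
  intro x hx
  obtain ⟨ω, rfl⟩ := exists_eq_tmul k hi x
  rw [conormalVal_tmul, twistVal_toTwist,
    smul_eq_zero_iff_right (zpow_ne_zero _ (coord_ne_zero i))] at hx
  have h : ω = 0 := Subtype.ext (grad_injective ⟨i, hi⟩ (hx.trans (map_zero _).symm))
  rw [h, TensorProduct.zero_tmul]

variable (hP : ∀ σ : Finset (Fin 4), σ.Nonempty → ∀ ω : Ω[Reg (stdOpen σ)⁄ℂ],
  twistVal _ _ (φ.dual (stdOpen σ) ω) = formOf P (grad (stdOpen σ) ω))

include hP

lemma conormalVal_mem (hσ : σ.Nonempty) (x : φ.ConormalTwist k (stdOpen σ)) :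
    φ.conormalVal k (stdOpen σ) x ∈ conormalSpace P (k - 1) σ := by
  obtain ⟨i, hi⟩ := hσ
  obtain ⟨ω, rfl⟩ := exists_eq_tmul k hi x
  rw [conormalVal_tmul, twistVal_toTwist, mem_conormalSpace]
  refine ⟨smul_mem_eulerSpace (coord_zpow_mem hi k) (grad_mem_eulerSpace ⟨i, hi⟩ _), ?_⟩
  rw [map_smul, ← hP σ ⟨i, hi⟩, LinearMap.mem_ker.1 ω.2, map_zero, smul_zero]

lemma exists_conormalVal_eq (hσ : σ.Nonempty) {g : Fin 4 → K}
    (hg : g ∈ conormalSpace P (k - 1) σ) : ∃ x, φ.conormalVal k (stdOpen σ) x = g := by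
  have hσ' := hσ
  obtain ⟨i, hi⟩ := hσ
  rw [mem_conormalSpace] at hg
  have h := smul_mem_eulerSpace (coord_zpow_mem hi (-k)) hg.1
  rw [neg_add_eq_sub, sub_sub_cancel_left] at h
  obtain ⟨ω, hω⟩ := exists_grad_eq hσ' h
  have hker : φ.dual (stdOpen σ) ω = 0 := by
    apply twistVal_injective
    rw [hP σ hσ', hω, map_smul, hg.2, smul_zero, map_zero]
  refine ⟨⟨ω, hker⟩ ⊗ₜ toTwist (coord i ^ k) (coord_zpow_mem hi k), ?_⟩
  rw [conormalVal_tmul, twistVal_toTwist]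
  change coord i ^ k • grad _ ω = g
  rw [hω, smul_smul, ← zpow_add₀ (coord_ne_zero i), add_neg_cancel, zpow_zero, one_smul]

end TwistedField

/-- The ideal of the singular scheme over the chart `xᵢ ≠ 0`, in homogeneous coordinates. -/
lemma TwistedField.mem_singIdeal {d : ℕ} {φ : TwistedField ((d : ℤ) - 1)} {P : Fin 4 → S}
    (hP : ∀ σ : Finset (Fin 4), σ.Nonempty → ∀ ω : Ω[Reg (stdOpen σ)⁄ℂ],
      twistVal _ _ (φ.dual (stdOpen σ) ω) = formOf P (grad (stdOpen σ) ω))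
    {i : Fin 4} {a : Reg (chart i)} : a ∈ φ.singIdeal (chart i) ↔
      ∃ g ∈ eulerSpace (-d) {i}, algebraMap _ K a = formOf P g := by
  constructor
  · intro ha
    induction ha using Submodule.span_induction with
    | zero => exact ⟨0, Submodule.zero_mem _, by simp⟩
    | add a b _ _ ha hb =>
      obtain ⟨g, hg, hga⟩ := ha
      obtain ⟨g', hg', hgb⟩ := hb
      exact ⟨g + g', Submodule.add_mem _ hg hg', by rw [map_add, map_add, hga, hgb]⟩
    | smul r a _ ha =>
      obtain ⟨g, hg, hga⟩ := ha
      have h := smul_mem_eulerSpace (algebraMap_mem_twistSpace r) hg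
      rw [zero_add] at h
      exact ⟨_, h, by rw [smul_eq_mul, map_mul, map_smul, hga, smul_eq_mul]⟩
    | mem a ha =>
      obtain ⟨ω, s, rfl⟩ := ha
      have h := smul_mem_eulerSpace (twistVal_mem s)
        (grad_mem_eulerSpace (Finset.singleton_nonempty i) ω)
      have hd : -((d : ℤ) - 1) + -1 = -d := by ring
      refine ⟨_, hd ▸ h, ?_⟩
      rw [map_smul, ← hP {i} (Finset.singleton_nonempty i)]
      rfl
  · rintro ⟨g, hg, hga⟩
    have hi := Finset.mem_singleton_self i
    have h := smul_mem_eulerSpace (coord_zpow_mem hi ((d : ℤ) - 1)) hg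
    rw [sub_add_eq_add_sub, add_neg_cancel, zero_sub] at h
    obtain ⟨ω, hω⟩ := exists_grad_eq (Finset.singleton_nonempty i) h
    refine Submodule.subset_span ⟨ω, toTwist _ (coord_zpow_mem hi (-((d : ℤ) - 1))), Reg.ext ?_⟩
    change algebraMap _ K a = coord i ^ (-((d : ℤ) - 1)) * twistVal _ _ (φ.dual (chart i) ω)
    rw [hP {i} (Finset.singleton_nonempty i), hω, map_smul, smul_eq_mul, ← mul_assoc,
      ← zpow_add₀ (coord_ne_zero i), neg_add_cancel, zpow_zero, one_mul, hga]

/-! ### Regular elements of polynomial rings -/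

/-- `s` is a nonzerodivisor modulo the ideal `I`. -/
def RegularMod {A : Type*} [CommRing A] (I : Ideal A) (s : A) : Prop := ∀ a, s * a ∈ I → a ∈ I

section

variable {A B : Type*} [CommRing A] [CommRing B]

lemma RegularMod.of_monic (I : Ideal A) {p : Polynomial A} (hp : p.Monic) :
    RegularMod (I.map Polynomial.C) p := by
  intro a ha
  rw [Ideal.mem_map_C_iff] at ha ⊢
  have h1 : (p * a).map (Ideal.Quotient.mk I) = 0 := by
    ext n
    rw [Polynomial.coeff_map, Polynomial.coeff_zero]
    exact Ideal.Quotient.eq_zero_iff_mem.2 (ha n)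
  rw [Polynomial.map_mul, (hp.map _).mul_right_eq_zero_iff] at h1
  intro n
  rw [← Ideal.Quotient.eq_zero_iff_mem, ← Polynomial.coeff_map, h1, Polynomial.coeff_zero]

lemma RegularMod.C {I : Ideal A} {s : A} (hs : RegularMod I s) :
    RegularMod (I.map Polynomial.C) (Polynomial.C s) := by
  intro a ha
  rw [Ideal.mem_map_C_iff] at ha ⊢
  exact fun n => hs _ (by simpa using ha n)

lemma RegularMod.of_equiv (e : A ≃+* B) {I : Ideal A} {s : A}
    (h : RegularMod (I.map e) (e s)) : RegularMod I s := by
  intro a ha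
  have h1 := h (e a) (by rw [← map_mul]; exact Ideal.mem_map_of_mem e ha)
  rw [Ideal.mem_map_of_equiv] at h1
  obtain ⟨b, hb, hba⟩ := h1
  rwa [← e.injective hba]

end

section

variable {m : ℕ}

lemma finSuccEquiv_aeval_X_zero (q : Polynomial ℂ) :
    finSuccEquiv ℂ m (Polynomial.aeval (X 0) q) = q.map (algebraMap ℂ (MvPolynomial (Fin m) ℂ)) := by
  rw [← Polynomial.aeval_algHom_apply, finSuccEquiv_X_zero, Polynomial.aeval_X_left_eq_map]

lemma finSuccEquiv_aeval_X_succ (j : Fin m) (q : Polynomial ℂ) :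
    finSuccEquiv ℂ m (Polynomial.aeval (X j.succ) q) =
      Polynomial.C (Polynomial.aeval (X j) q : MvPolynomial (Fin m) ℂ) := by
  rw [← Polynomial.aeval_algHom_apply, finSuccEquiv_X_succ]
  exact Polynomial.aeval_algHom_apply Polynomial.CAlgHom _ _

lemma regularMod_aeval_X_zero (I : Ideal (MvPolynomial (Fin m) ℂ)) {q : Polynomial ℂ}
    (hq : q.Monic) {J : Ideal (MvPolynomial (Fin (m + 1)) ℂ)}
    (hJ : J.map (finSuccEquiv ℂ m).toRingEquiv = I.map Polynomial.C) :
    RegularMod J (Polynomial.aeval (X 0) q) := by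
  refine RegularMod.of_equiv (finSuccEquiv ℂ m).toRingEquiv ?_
  rw [hJ]
  have h : (finSuccEquiv ℂ m).toRingEquiv (Polynomial.aeval (X 0) q) =
      q.map (algebraMap ℂ (MvPolynomial (Fin m) ℂ)) := finSuccEquiv_aeval_X_zero q
  rw [h]
  exact RegularMod.of_monic I (hq.map _)

end

/-- The values of monic polynomials in one variable at the three coordinates form a regular
sequence. -/
lemma regular_aeval_X {q₀ q₁ q₂ : Polynomial ℂ} (h₀ : q₀.Monic) (h₁ : q₁.Monic) :
    RegularMod (Ideal.span {(Polynomial.aeval (X 2) q₂ : MvPolynomial (Fin 3) ℂ)})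
      (Polynomial.aeval (X 1) q₁) ∧
    RegularMod (Ideal.span {(Polynomial.aeval (X 2) q₂ : MvPolynomial (Fin 3) ℂ),
      Polynomial.aeval (X 1) q₁}) (Polynomial.aeval (X 0) q₀) := by
  have e1 : finSuccEquiv ℂ 2 (Polynomial.aeval (X 1) q₁) =
      Polynomial.C (Polynomial.aeval (X 0) q₁ : MvPolynomial (Fin 2) ℂ) :=
    finSuccEquiv_aeval_X_succ 0 q₁
  have e2 : finSuccEquiv ℂ 2 (Polynomial.aeval (X 2) q₂) =
      Polynomial.C (Polynomial.aeval (X 1) q₂ : MvPolynomial (Fin 2) ℂ) :=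
    finSuccEquiv_aeval_X_succ 1 q₂
  have e3 : finSuccEquiv ℂ 1 (Polynomial.aeval (X 1) q₂) =
      Polynomial.C (Polynomial.aeval (X 0) q₂ : MvPolynomial (Fin 1) ℂ) :=
    finSuccEquiv_aeval_X_succ 0 q₂
  constructor
  · refine RegularMod.of_equiv (finSuccEquiv ℂ 2).toRingEquiv ?_
    have h1 : RegularMod (Ideal.span {(Polynomial.aeval (X 1) q₂ : MvPolynomial (Fin 2) ℂ)})
        (Polynomial.aeval (X 0) q₁) := by
      refine regularMod_aeval_X_zero
        (Ideal.span {(Polynomial.aeval (X 0) q₂ : MvPolynomial (Fin 1) ℂ)}) h₁ ?_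
      rw [Ideal.map_span, Ideal.map_span, Set.image_singleton, Set.image_singleton]
      congr 2
    have h2 := h1.C
    rw [Ideal.map_span, Set.image_singleton] at h2 ⊢
    change RegularMod (Ideal.span {finSuccEquiv ℂ 2 _}) (finSuccEquiv ℂ 2 _)
    rwa [e1, e2]
  · refine regularMod_aeval_X_zero
      (Ideal.span {(Polynomial.aeval (X 1) q₂ : MvPolynomial (Fin 2) ℂ),
        Polynomial.aeval (X 0) q₁}) h₀ ?_
    rw [Ideal.map_span, Ideal.map_span, Set.image_pair, Set.image_pair]
    change Ideal.span {finSuccEquiv ℂ 2 _, finSuccEquiv ℂ 2 _} = _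
    rw [e1, e2]

/-- An ideal of `ℂ[y₀, y₁, y₂]` all of whose prime overideals have height greater than two has a
finite-dimensional quotient, hence contains a monic polynomial in each of the variables. -/
lemma exists_regular_of_height {J : Ideal (MvPolynomial (Fin 3) ℂ)}
    (hJ : ∀ p : Ideal (MvPolynomial (Fin 3) ℂ), p.IsPrime → J ≤ p → 2 < p.height) :
    ∃ r ∈ J, ∃ s ∈ J, ∃ t ∈ J, r ≠ 0 ∧ RegularMod (Ideal.span {r}) s ∧
      RegularMod (Ideal.span {r, s}) t := by
  have hdim : ringKrullDim (MvPolynomial (Fin 3) ℂ) = 3 := by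
    rw [MvPolynomial.ringKrullDim_of_isNoetherianRing, ringKrullDim_eq_zero_of_field]
    simp
  have hmax : ∀ p : Ideal (MvPolynomial (Fin 3) ℂ), p.IsPrime → J ≤ p → p.IsMaximal := by
    intro p hp hJp
    have : FiniteRingKrullDim (MvPolynomial (Fin 3) ℂ) :=
      finiteRingKrullDim_iff_ne_bot_and_top.2 (by rw [hdim]; exact ⟨by decide, by decide⟩)
    refine Ideal.isMaximal_of_height_eq_ringKrullDim (le_antisymm
      Ideal.height_le_ringKrullDim_of_isPrime ?_)
    rw [hdim]
    have h3 : (3 : ℕ∞) ≤ p.height := by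
      have h := Order.add_one_le_of_lt (hJ p hp hJp)
      exact le_trans (by norm_num) h
    exact WithBot.coe_le_coe.2 h3
  have hartin : IsArtinianRing (MvPolynomial (Fin 3) ℂ ⧸ J) := by
    rw [isArtinianRing_iff_isNoetherianRing_krullDimLE_zero]
    refine ⟨inferInstance, Ring.KrullDimLE.mk₀ fun q hq => ?_⟩
    have h1 := hmax (q.comap (Ideal.Quotient.mk J)) inferInstance (by
      intro a ha
      rw [Ideal.mem_comap, Ideal.Quotient.eq_zero_iff_mem.2 ha]
      exact q.zero_mem)
    have h2 := Ideal.map_eq_top_or_isMaximal_of_surjective (Ideal.Quotient.mk J)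
      Ideal.Quotient.mk_surjective h1
    rw [Ideal.map_comap_of_surjective _ Ideal.Quotient.mk_surjective] at h2
    exact h2.resolve_left hq.ne_top
  have hfin : Module.Finite ℂ (MvPolynomial (Fin 3) ℂ ⧸ J) :=
    Module.finite_of_isArtinianRing ℂ _
  have hq : ∀ j, ∃ q : Polynomial ℂ, q.Monic ∧
      (Polynomial.aeval (X j) q : MvPolynomial (Fin 3) ℂ) ∈ J := by
    intro j
    obtain ⟨q, hq, hq0⟩ := Algebra.IsIntegral.isIntegral (R := ℂ)
      (Ideal.Quotient.mk J (X j : MvPolynomial (Fin 3) ℂ))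
    refine ⟨q, hq, ?_⟩
    rw [← Ideal.Quotient.eq_zero_iff_mem, ← hq0]
    exact (Polynomial.aeval_algHom_apply (Ideal.Quotient.mkₐ ℂ J) (X j) q).symm
  choose q hq hqJ using hq
  obtain ⟨h1, h2⟩ := regular_aeval_X (q₂ := q 2) (hq 0) (hq 1)
  refine ⟨_, hqJ 2, _, hqJ 1, _, hqJ 0, ?_, h1, h2⟩
  have h := MvPolynomial.algebraicIndependent_X (Fin 3) ℂ
  have h3 := h.transcendental 2
  exact fun h0 => h3 ⟨q 2, (hq 2).ne_zero, h0⟩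

/-! ### The depth of the cokernel of a map with flat kernel -/

/-- Let `φ : Ω → T` have a flat kernel. An element of `T` that is multiplied into the image by the
members of a regular sequence `r, s, t` belongs to the image: the Koszul relation between the
preimages of `r m` and `s m` lies in the kernel, where it is trivial. -/
lemma mem_range_of_regular {A Ω T : Type*} [CommRing A] [AddCommGroup Ω] [Module A Ω]
    [AddCommGroup T] [Module A T] (φ : Ω →ₗ[A] T) [Module.Flat A (LinearMap.ker φ)] {r s t : A}
    (hrT : ∀ m : T, r • m = 0 → m = 0)
    (hsΩ : ∀ ω ω' : Ω, s • ω = r • ω' → ∃ ω'', ω = r • ω'')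
    (ht : RegularMod (Ideal.span {r, s}) t) {m : T} (hr : r • m ∈ LinearMap.range φ)
    (hs : s • m ∈ LinearMap.range φ) (ht' : t • m ∈ LinearMap.range φ) :
    m ∈ LinearMap.range φ := by
  obtain ⟨ωr, hωr⟩ := hr
  obtain ⟨ωs, hωs⟩ := hs
  obtain ⟨ωt, hωt⟩ := ht'
  let ν : LinearMap.ker φ := ⟨s • ωr - r • ωs, by
    rw [LinearMap.mem_ker, map_sub, map_smul, map_smul, hωr, hωs, smul_comm, sub_self]⟩
  let ν₁ : LinearMap.ker φ := ⟨t • ωr - r • ωt, by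
    rw [LinearMap.mem_ker, map_sub, map_smul, map_smul, hωr, hωt, smul_comm, sub_self]⟩
  let ν₂ : LinearMap.ker φ := ⟨t • ωs - s • ωt, by
    rw [LinearMap.mem_ker, map_sub, map_smul, map_smul, hωs, hωt, smul_comm, sub_self]⟩
  have hrel : ∑ k : Fin 3, ![t, -s, r] k • ![ν, ν₁, ν₂] k = 0 := by
    rw [Fin.sum_univ_three]
    refine Subtype.ext ?_
    change t • (s • ωr - r • ωs) + -s • (t • ωr - r • ωt) + r • (t • ωs - s • ωt) = 0
    module
  obtain ⟨κ, c, y, hy, hc⟩ := Module.Flat.isTrivialRelation_of_sum_smul_eq_zero hrel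
  have hc0 : ∀ k, c 0 k ∈ Ideal.span {r, s} := by
    intro k
    apply ht
    have h := hc k
    rw [Fin.sum_univ_three] at h
    simp only [Matrix.cons_val_zero, Matrix.cons_val_one, Matrix.cons_val] at h
    exact Ideal.mem_span_pair.2 ⟨-c 2 k, c 1 k, by linear_combination -h⟩
  choose a b hab using fun k => Ideal.mem_span_pair.1 (hc0 k)
  -- the Koszul relation is `s n₁ - r n₂` with `n₁`, `n₂` in the kernel
  have hν : s • ωr - r • ωs = r • (∑ k, a k • (y k : Ω)) + s • ∑ k, b k • (y k : Ω) := by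
    have h := congrArg (Subtype.val) (hy 0)
    simp only [Matrix.cons_val_zero, Submodule.coe_sum, Submodule.coe_smul] at h
    change s • ωr - r • ωs = _ at h
    rw [h, Finset.smul_sum, Finset.smul_sum, ← Finset.sum_add_distrib]
    refine Finset.sum_congr rfl fun k _ => ?_
    rw [← hab k]
    module
  obtain ⟨ω, hω⟩ := hsΩ (ωr - ∑ k, b k • (y k : Ω)) (ωs + ∑ k, a k • (y k : Ω)) (by
    rw [smul_sub, smul_add]
    rw [sub_eq_iff_eq_add] at hν ⊢
    rw [hν]
    abel)
  refine ⟨ω, sub_eq_zero.1 (hrT _ ?_)⟩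
  have hy0 : φ (∑ k, b k • (y k : Ω)) = 0 := by
    rw [map_sum]
    exact Finset.sum_eq_zero fun k _ => by rw [map_smul, LinearMap.mem_ker.1 (y k).2, smul_zero]
  rw [smul_sub, ← map_smul, ← hω, map_sub, hy0, sub_zero, hωr, sub_self]

/-- A module which is free on a neighbourhood of every prime is flat. -/
lemma flat_of_locally_free {A N : Type*} [CommRing A] [AddCommGroup N] [Module A N]
    (h : ∀ p : PrimeSpectrum A, ∃ f ∉ p.asIdeal,
      Module.Free (Localization.Away f) (LocalizedModule.Away f N)) : Module.Flat A N := by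
  let s : Set A := {f | Module.Free (Localization.Away f) (LocalizedModule.Away f N)}
  refine Module.flat_of_localized_span (M := N) A s ?_ fun f => ?_
  · by_contra hne
    obtain ⟨p, hp, hle⟩ := Ideal.exists_le_maximal _ hne
    obtain ⟨f, hf, hfree⟩ := h ⟨p, hp.isPrime⟩
    exact hf (hle (Ideal.subset_span hfree))
  · have : Module.Free (Localization.Away f.1) (LocalizedModule.Away f.1 N) := f.2
    have : Module.Flat A (Localization.Away f.1) := IsLocalization.flat _ (Submonoid.powers f.1)
    exact Module.Flat.trans A (Localization.Away f.1) _

/-! ### The charts are affine spaces, and the singular scheme is a curve -/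

section

variable (i : Fin 4)

/-- The affine coordinates on the chart `xᵢ ≠ 0`, as a map from a polynomial ring. -/
def chartHom : MvPolynomial (Fin 3) ℂ →ₐ[ℂ] Reg (chart i) :=
  aeval fun k => ratio (Finset.mem_singleton_self i) (i.succAbove k)

lemma chartHom_surjective : Function.Surjective (chartHom i) := by
  rw [← AlgHom.range_eq_top, eq_top_iff, ← adjoin_ratio (Finset.mem_singleton_self i)]
  have h : ∀ j, ratio (Finset.mem_singleton_self i) j ∈ (chartHom i).range := by
    intro j
    rcases eq_or_ne j i with rfl | hj
    · rw [ratio_self]; exact Subalgebra.one_mem _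
    · obtain ⟨k, rfl⟩ := Fin.exists_succAbove_eq hj
      exact ⟨X k, aeval_X _ k⟩
  refine Algebra.adjoin_le ?_
  rintro r (⟨j, rfl⟩ | ⟨j, hj, rfl⟩)
  · exact h j
  · obtain rfl := Finset.mem_singleton.1 hj
    exact h j

/-- The exponents of the homogenization, of degree zero, of a monomial. -/
def homogExp (α : Fin 3 →₀ ℕ) : Fin 4 → ℤ :=
  ∑ k, (α k : ℤ) • (Pi.single (i.succAbove k) 1 - Pi.single i 1 : Fin 4 → ℤ)

lemma homogExp_succAbove (α : Fin 3 →₀ ℕ) (k : Fin 3) : homogExp i α (i.succAbove k) = α k := by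
  simp only [homogExp, Finset.sum_apply, Pi.smul_apply, Pi.sub_apply]
  rw [Finset.sum_eq_single k]
  · simp [Fin.succAbove_ne]
  · intro l _ hl
    rw [Pi.single_eq_of_ne (fun h => hl (Fin.succAbove_right_injective h).symm),
      Pi.single_eq_of_ne (Fin.succAbove_ne i k), sub_zero, smul_zero]
  · simp

lemma homogExp_injective : Function.Injective (homogExp i) := by
  intro α β h
  ext k
  have h1 := homogExp_succAbove i α k
  rw [h, homogExp_succAbove] at h1
  exact_mod_cast h1.symm

lemma laurent_homogExp (α : Fin 3 →₀ ℕ) :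
    laurent (homogExp i α) = algebraMap _ K (chartHom i (monomial α 1)) := by
  have hzs : ∀ (a : Fin 4 → ℤ) (m : ℕ), laurent ((m : ℤ) • a) = laurent a ^ m := by
    intro a m
    induction m with
    | zero => simp [laurent_zero]
    | succ m ih => rw [Nat.cast_succ, add_smul, one_smul, laurent_add, ih, pow_succ]
  have hsum : ∀ (s : Finset (Fin 3)) (a : Fin 3 → Fin 4 → ℤ),
      laurent (∑ k ∈ s, a k) = ∏ k ∈ s, laurent (a k) := by
    intro s a
    induction s using Finset.induction_on with
    | empty => simp [laurent_zero]
    | insert k s hk ih => rw [Finset.sum_insert hk, Finset.prod_insert hk, laurent_add, ih]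
  rw [homogExp, hsum, chartHom, aeval_monomial, map_one, one_mul,
    Finsupp.prod_fintype _ _ (fun k => pow_zero _), map_prod]
  refine Finset.prod_congr rfl fun k _ => ?_
  rw [hzs, map_pow]
  congr 1
  rw [sub_eq_add_neg, laurent_add, ← Pi.single_neg, laurent_single, laurent_single, zpow_one,
    zpow_neg_one, ← div_eq_mul_inv]
  rfl

lemma chartHom_injective : Function.Injective (chartHom i) := by
  rw [injective_iff_map_eq_zero]
  intro p hp
  have h1 : ∑ α ∈ p.support, p.coeff α • laurent (homogExp i α) = 0 := by
    have h2 := congrArg (algebraMap (Reg (chart i)) K) hp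
    rw [map_zero, MvPolynomial.as_sum p, map_sum, map_sum] at h2
    rw [← h2]
    refine Finset.sum_congr rfl fun α _ => ?_
    have h3 : monomial α (p.coeff α) = p.coeff α • monomial α (1 : ℂ) := by
      rw [smul_monomial, smul_eq_mul, mul_one]
    rw [laurent_homogExp, h3, map_smul, Algebra.smul_def, Algebra.smul_def, map_mul,
      ← IsScalarTower.algebraMap_apply]
  have h4 := linearIndependent_iff'.1
    (laurent_linearIndependent.comp (homogExp i) (homogExp_injective i)) p.support p.coeff h1
  ext α
  by_cases hα : α ∈ p.support
  · rw [h4 α hα, coeff_zero]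
  · rw [notMem_support_iff.1 hα, coeff_zero]

/-- The chart `xᵢ ≠ 0` is the affine space of dimension three. -/
def chartEquiv : MvPolynomial (Fin 3) ℂ ≃ₐ[ℂ] Reg (chart i) :=
  AlgEquiv.ofBijective (chartHom i) ⟨chartHom_injective i, chartHom_surjective i⟩

variable {i}

/-- `exists_regular_of_height` on a chart. -/
lemma exists_regular_chart {J : Ideal (Reg (chart i))}
    (hJ : ∀ p : Ideal (Reg (chart i)), p.IsPrime → J ≤ p → 2 < p.height) :
    ∃ r ∈ J, ∃ s ∈ J, ∃ t ∈ J, r ≠ 0 ∧ RegularMod (Ideal.span {r}) s ∧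
      RegularMod (Ideal.span {r, s}) t := by
  let e := (chartEquiv i).toRingEquiv
  obtain ⟨r, hr, s, hs, t, ht, hr0, h1, h2⟩ := exists_regular_of_height (J := J.comap e) (by
    intro p hp hle
    rw [← e.symm.height_comap]
    refine hJ _ (Ideal.comap_isPrime _ _) fun a ha => hle ?_
    rw [Ideal.mem_comap, e.apply_symm_apply]
    exact ha)
  refine ⟨e r, hr, e s, hs, e t, ht, (map_ne_zero_iff e e.injective).2 hr0, ?_, ?_⟩
  · refine RegularMod.of_equiv e.symm ?_
    rw [Ideal.map_span, Set.image_singleton, e.symm_apply_apply, e.symm_apply_apply]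
    exact h1
  · refine RegularMod.of_equiv e.symm ?_
    rw [Ideal.map_span, Set.image_pair, e.symm_apply_apply, e.symm_apply_apply, e.symm_apply_apply]
    exact h2

/-- A regular sequence of length two on the functions is regular on the differentials, as these
form a free module. -/
lemma exists_eq_smul_kaehler {r s : Reg (chart i)} (hs : RegularMod (Ideal.span {r}) s)
    {ω ω' : Ω[Reg (chart i)⁄ℂ]} (h : s • ω = r • ω') : ∃ ω'', ω = r • ω'' := by
  have hi := Finset.mem_singleton_self i
  obtain ⟨c, hc, hω⟩ := exists_eq_sum_ratio hi ω
  obtain ⟨c', hc', -⟩ := exists_eq_sum_ratio hi ω'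
  have h1 : ∀ j, c j ∈ Ideal.span {r} := by
    intro j
    apply hs
    refine Ideal.mem_span_singleton.2 ⟨c' j, Reg.ext ?_⟩
    have h2 := congrFun (congrArg (grad _) h) j
    rw [map_smul, map_smul, Pi.smul_apply, Pi.smul_apply, Algebra.smul_def, Algebra.smul_def] at h2
    rw [map_mul, map_mul, hc, hc', mul_left_comm, h2, mul_left_comm]
  choose b hb using fun j => Ideal.mem_span_singleton.1 (h1 j)
  refine ⟨∑ j, b j • KaehlerDifferential.D ℂ (Reg (chart i)) (ratio hi j), ?_⟩
  rw [hω, Finset.smul_sum]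
  exact Finset.sum_congr rfl fun j _ => by rw [hb j, smul_smul]

end

lemma TwistedField.mem_singIdeal_iff_mem_range {n : ℤ} (φ : TwistedField n) {i : Fin 4}
    {a : Reg (chart i)} : a ∈ φ.singIdeal (chart i) ↔
      a • toTwist (coord i ^ n) (coord_zpow_mem (Finset.mem_singleton_self i) n) ∈
        LinearMap.range (φ.dual (chart i)) := by
  have hi := Finset.mem_singleton_self i
  have hu : ∀ u : Twist n (chart i), ∃ b : Reg (chart i),
      u = b • toTwist (coord i ^ n) (coord_zpow_mem hi n) := by
    intro u
    have h := mul_mem_twistSpace (twistVal_mem u) (coord_zpow_mem hi (-n))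
    rw [add_neg_cancel] at h
    refine ⟨toReg _ h, twistVal_injective _ _ ?_⟩
    rw [map_smul, twistVal_toTwist, Algebra.smul_def, algebraMap_toReg, mul_assoc,
      ← zpow_add₀ (coord_ne_zero i), neg_add_cancel, zpow_zero, mul_one]
  constructor
  · intro ha
    refine Submodule.span_induction ?_ ?_ ?_ ?_ ha
    · rintro _ ⟨ω, s, rfl⟩
      have h := mul_mem_twistSpace (twistVal_mem s) (coord_zpow_mem hi n)
      rw [neg_add_cancel] at h
      refine ⟨toReg _ h • ω, twistVal_injective _ _ ?_⟩
      rw [map_smul, map_smul, map_smul, Algebra.smul_def, Algebra.smul_def, algebraMap_toReg,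
        twistVal_toTwist]
      change _ = twistVal _ _ s * twistVal _ _ (φ.dual (chart i) ω) * _
      ring
    · rw [zero_smul]; exact Submodule.zero_mem _
    · intro x y _ _ hx hy
      rw [add_smul]; exact Submodule.add_mem _ hx hy
    · intro r x _ hx
      rw [smul_eq_mul, mul_smul]; exact Submodule.smul_mem _ _ hx
  · rintro ⟨ω, hω⟩
    refine Submodule.subset_span ⟨ω, toTwist _ (coord_zpow_mem hi (-n)), Reg.ext ?_⟩
    change algebraMap _ K a = coord i ^ (-n) * twistVal _ _ (φ.dual (chart i) ω)
    rw [hω, map_smul, twistVal_toTwist, Algebra.smul_def, mul_left_comm,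
      ← zpow_add₀ (coord_ne_zero i), neg_add_cancel, zpow_zero, mul_one]

/-- If the conormal sheaf is locally free, the singular scheme has no embedded or isolated points,
so it equals its one-dimensional part. -/
theorem TwistedField.curveIdeal_eq_singIdeal {n : ℤ} (φ : TwistedField n)
    (hφ : φ.ConormalLocallyFree) (i : Fin 4) :
    φ.curveIdeal (chart i) = φ.singIdeal (chart i) := by
  refine le_antisymm (fun a ha => ?_) fun a ha p hp h => ?_
  · have hflat : Module.Flat (Reg (chart i)) (φ.conormal (chart i)) := flat_of_locally_free (hφ i)
    -- the ideal of the `r` with `r a = 0` in the structure sheaf of the singular scheme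
    let J : Ideal (Reg (chart i)) :=
      { carrier := {r | r * a ∈ φ.singIdeal (chart i)}
        add_mem' := fun {x y} hx hy => by
          change (x + y) * a ∈ φ.singIdeal (chart i)
          rw [add_mul]; exact Ideal.add_mem _ hx hy
        zero_mem' := by
          change 0 * a ∈ φ.singIdeal (chart i)
          rw [zero_mul]; exact Ideal.zero_mem _
        smul_mem' := fun c x hx => by
          change c * x * a ∈ φ.singIdeal (chart i)
          rw [mul_assoc]; exact Ideal.mul_mem_left _ _ hx }
    obtain ⟨r, hr, s, hs, t, ht, hr0, h1, h2⟩ := exists_regular_chart (J := J)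
      fun p hp hle => ha p hp fun r hr => hle hr
    rw [mem_singIdeal_iff_mem_range]
    refine mem_range_of_regular (φ.dual (chart i)) (fun m hm => ?_)
      (fun ω ω' => exists_eq_smul_kaehler h1) h2 ?_ ?_ ?_
    · apply twistVal_injective
      have h3 := congrArg (twistVal _ _) hm
      rw [map_smul, map_zero, Algebra.smul_def, mul_eq_zero] at h3
      rw [map_zero]
      exact h3.resolve_left fun h => hr0 (Reg.ext (h.trans (map_zero _).symm))
    · rw [← mul_smul]; exact (φ.mem_singIdeal_iff_mem_range).1 hr
    · rw [← mul_smul]; exact (φ.mem_singIdeal_iff_mem_range).1 hs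
    · rw [← mul_smul]; exact (φ.mem_singIdeal_iff_mem_range).1 ht
  · exact absurd (h 1 (by rwa [one_mul])) ((Ideal.ne_top_iff_one p).1 hp.ne_top)

/-! ### Homogeneous vector fields have singular points -/

/-- The polynomials of degree less than `n`. -/
def lowDeg (n : ℕ) : Submodule ℂ S where
  carrier := {f | ∀ α ∈ f.support, α.degree < n}
  add_mem' := by
    classical
    intro f g hf hg α hα
    rcases Finset.mem_union.1 (MvPolynomial.support_add hα) with h | h
    exacts [hf α h, hg α h]
  zero_mem' := by simp
  smul_mem' c f hf α hα := hf α (MvPolynomial.support_smul hα)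

lemma mem_lowDeg {n : ℕ} {f : S} : f ∈ lowDeg n ↔ ∀ α ∈ f.support, α.degree < n := Iff.rfl

lemma lowDeg_mono {m n : ℕ} (h : m ≤ n) : lowDeg m ≤ lowDeg n :=
  fun _ hf α hα => (hf α hα).trans_le h

lemma mem_lowDeg_of_mem_deg {n : ℕ} {f : S} (hf : f ∈ deg n) : f ∈ lowDeg (n + 1) := by
  intro α hα
  have h : α.degree = n := by
    by_contra hne
    exact mem_support_iff.1 hα (IsHomogeneous.coeff_eq_zero hf hne)
  omega

lemma mul_mem_lowDeg {a b : ℕ} {f g : S} (hf : f ∈ lowDeg a) (hg : g ∈ lowDeg (b + 1)) :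
    f * g ∈ lowDeg (a + b) := by
  classical
  intro α hα
  obtain ⟨β, hβ, γ, hγ, rfl⟩ := Finset.mem_add.1 (MvPolynomial.support_mul _ _ hα)
  have h1 := hf β hβ
  have h2 := hg γ hγ
  rw [map_add]
  omega

/-- The polynomial `f` has degree at most `n`, and `p` is its component of degree `n`. -/
def IsTop (n : ℕ) (f p : S) : Prop := p ∈ deg n ∧ f - p ∈ lowDeg n

lemma IsTop.mem_lowDeg {n : ℕ} {f p : S} (h : IsTop n f p) : f ∈ lowDeg (n + 1) := by
  rw [← sub_add_cancel f p]
  exact Submodule.add_mem _ (lowDeg_mono (Nat.le_succ n) h.2) (mem_lowDeg_of_mem_deg h.1)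

lemma IsTop.mul {a b : ℕ} {f g p q : S} (hf : IsTop a f p) (hg : IsTop b g q) :
    IsTop (a + b) (f * g) (p * q) := by
  refine ⟨SetLike.mul_mem_graded hf.1 hg.1, ?_⟩
  have h : f * g - p * q = (f - p) * g + (g - q) * p := by ring
  rw [h]
  refine Submodule.add_mem _ (mul_mem_lowDeg hf.2 hg.mem_lowDeg) ?_
  rw [add_comm a b]
  exact mul_mem_lowDeg hg.2 (mem_lowDeg_of_mem_deg hf.1)

lemma IsTop.one : IsTop 0 1 1 := ⟨isHomogeneous_one _ _, by simp⟩

lemma IsTop.pow {a : ℕ} {f p : S} (hf : IsTop a f p) (k : ℕ) : IsTop (a * k) (f ^ k) (p ^ k) := by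
  induction k with
  | zero => simpa using IsTop.one
  | succ k ih => rw [pow_succ, pow_succ]; exact ih.mul hf

lemma IsTop.prod {ι : Type*} (s : Finset ι) {a : ι → ℕ} {f p : ι → S}
    (h : ∀ i, IsTop (a i) (f i) (p i)) : IsTop (∑ i ∈ s, a i) (∏ i ∈ s, f i) (∏ i ∈ s, p i) := by
  classical
  induction s using Finset.induction_on with
  | empty => simpa using IsTop.one
  | insert i s hi ih =>
    rw [Finset.sum_insert hi, Finset.prod_insert hi, Finset.prod_insert hi]
    exact (h i).mul ih

lemma IsTop.totalDegree {n : ℕ} {f p : S} (h : IsTop n f p) (hp : p ≠ 0) : f.totalDegree = n := by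
  refine le_antisymm (Finset.sup_le fun α hα => ?_) ?_
  · have := h.mem_lowDeg α hα
    change α.degree ≤ n
    omega
  · obtain ⟨α, hα⟩ := ne_zero_iff.1 hp
    have hdeg : α.degree = n := by
      by_contra hne
      exact hα (IsHomogeneous.coeff_eq_zero h.1 hne)
    have hαf : α ∈ f.support := by
      rw [mem_support_iff]
      intro h0
      have h1 : α ∈ (f - p).support := by
        rw [mem_support_iff, coeff_sub, h0, zero_sub, neg_ne_zero]
        exact hα
      have := h.2 α h1
      omega
    have h2 := le_totalDegree hαf
    have h3 : (α.sum fun _ e => e) = α.degree := rfl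
    omega

section

variable {d : ℕ} {P : Fin 4 → S}

/-- If the homogeneous polynomials `Pⱼ` of degree `d` are algebraically independent and `Gⱼ` has the
leading form `Pⱼ`, then the degrees of the polynomials in the `Gⱼ` are multiples of `d`. -/
lemma dvd_totalDegree (hd : d ≠ 0) (hP : AlgebraicIndependent ℂ P) {G : Fin 4 → S}
    (hG : ∀ j, IsTop d (G j) (P j)) {f : S} (hf : f ∈ Algebra.adjoin ℂ (Set.range G)) :
    d ∣ f.totalDegree := by
  classical
  rw [Algebra.adjoin_range_eq_range_aeval] at hf
  obtain ⟨q, rfl⟩ := hf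
  rcases eq_or_ne q 0 with rfl | hq
  · simp
  set e := q.totalDegree with he
  have hmon : ∀ α : Fin 4 →₀ ℕ, IsTop (d * α.degree) (∏ j, G j ^ α j) (∏ j, P j ^ α j) := by
    intro α
    rw [Finsupp.degree_eq_sum, Finset.mul_sum]
    exact IsTop.prod _ fun j => (hG j).pow _
  have htop : IsTop (d * e) (aeval G q) (aeval P (homogeneousComponent e q)) := by
    have hcomp : aeval P (homogeneousComponent e q) =
        ∑ α ∈ q.support, if α.degree = e then q.coeff α • ∏ j, P j ^ α j else 0 := by
      rw [homogeneousComponent_apply, map_sum, Finset.sum_filter]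
      refine Finset.sum_congr rfl fun α _ => ?_
      split_ifs
      · rw [aeval_monomial, Finsupp.prod_fintype _ _ (fun _ => pow_zero _), Algebra.smul_def]
      · rfl
    have hval : aeval G q = ∑ α ∈ q.support, q.coeff α • ∏ j, G j ^ α j := by
      conv_lhs => rw [MvPolynomial.as_sum q, map_sum]
      refine Finset.sum_congr rfl fun α _ => ?_
      rw [aeval_monomial, Finsupp.prod_fintype _ _ (fun _ => pow_zero _), Algebra.smul_def]
    constructor
    · rw [hcomp]
      refine Submodule.sum_mem _ fun α _ => ?_
      split_ifs with h
      · rw [← h]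
        exact Submodule.smul_mem _ _ (hmon α).1
      · exact Submodule.zero_mem _
    · rw [hval, hcomp, ← Finset.sum_sub_distrib]
      refine Submodule.sum_mem _ fun α hα => ?_
      split_ifs with h
      · rw [← smul_sub, ← h]
        exact Submodule.smul_mem _ _ (hmon α).2
      · rw [sub_zero]
        refine Submodule.smul_mem _ _ (lowDeg_mono ?_ (hmon α).mem_lowDeg)
        have h1 : α.degree ≤ e := le_totalDegree hα
        have h2 : α.degree < e := lt_of_le_of_ne h1 h
        exact Nat.succ_le_of_lt (Nat.mul_lt_mul_of_pos_left h2 (Nat.pos_of_ne_zero hd))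
  refine ⟨e, htop.totalDegree fun h0 => ?_⟩
  have h1 : homogeneousComponent e q = 0 := hP (h0.trans (map_zero _).symm)
  -- the component of highest degree of `q` does not vanish
  obtain ⟨α, hα, hαe⟩ := Finset.exists_mem_eq_sup q.support (support_nonempty.2 hq)
    fun s => s.sum fun _ e => e
  have h2 := congrArg (coeff α) h1
  rw [coeff_homogeneousComponent, if_pos (show α.degree = e from hαe.symm), coeff_zero] at h2
  exact mem_support_iff.1 hα h2

lemma homogeneousComponent_mul_of_mem {j : ℕ} {b : S} (hb : b ∈ deg j) (n : ℕ) (a : S) :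
    homogeneousComponent n (a * b) = if j ≤ n then homogeneousComponent (n - j) a * b else 0 := by
  have h := DirectSum.coe_decompose_mul_of_right_mem deg (a := a) n hb
  rw [← MvPolynomial.decomposition.decompose'_apply, ← MvPolynomial.decomposition.decompose'_apply]
  exact h

/-- Nakayama's lemma for the cokernel of `R → A`. -/
lemma exists_smul_le_range {R A : Type*} [CommRing R] [CommRing A] [Algebra R A] [Module.Finite R A]
    (I : Ideal R) (h : ∀ a : A, ∃ r : R, a - algebraMap R A r ∈ I.map (algebraMap R A)) :
    ∃ r : R, r - 1 ∈ I ∧ ∀ a : A, ∃ p : R, algebraMap R A p = r • a := by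
  obtain ⟨r, hr1, hr⟩ := Submodule.exists_sub_one_mem_and_smul_eq_zero_of_fg_of_le_smul I
    (⊤ : Submodule R (A ⧸ LinearMap.range (Algebra.linearMap R A))) Module.Finite.fg_top (by
      rintro m -
      obtain ⟨a, rfl⟩ := Submodule.mkQ_surjective _ m
      obtain ⟨s, hs⟩ := h a
      have h1 : a - algebraMap R A s ∈ (I • ⊤ : Submodule R A) := by
        rw [Ideal.smul_top_eq_map]; exact hs
      have h2 := Submodule.mem_map_of_mem (f := (LinearMap.range (Algebra.linearMap R A)).mkQ) h1
      rw [Submodule.map_smul'', map_sub] at h2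
      have h3 : (LinearMap.range (Algebra.linearMap R A)).mkQ (algebraMap R A s) = 0 :=
        (Submodule.Quotient.mk_eq_zero _).2 ⟨s, rfl⟩
      rw [h3, sub_zero] at h2
      exact Submodule.smul_mono le_rfl le_top h2)
  refine ⟨r, hr1, fun a => ?_⟩
  exact (Submodule.Quotient.mk_eq_zero _).1 (hr (Submodule.Quotient.mk a) trivial)

lemma mem_span_X_iff {f : S} : f ∈ Ideal.span (Set.range (X : Fin 4 → S)) ↔ coeff 0 f = 0 := by
  have h := MvPolynomial.mem_pow_idealOfVars_iff' (σ := Fin 4) (R := ℂ) 1 f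
  rw [pow_one] at h
  refine h.trans ⟨fun h1 => h1 0 (by simp), fun h1 α hα => ?_⟩
  rwa [(Finsupp.degree_eq_zero_iff α).1 (Nat.lt_one_iff.1 hα)]

lemma mem_span_X_pow {n : ℕ} {f : S} (hf : f ∈ deg n) :
    f ∈ Ideal.span (Set.range (X : Fin 4 → S)) ^ n := by
  rw [Ideal.mem_span_pow_iff_exists_isHomogeneous]
  exact ⟨map C f, IsHomogeneous.map hf C, by rw [eval_map, eval₂_eta]⟩

variable (hd : 2 ≤ d) (hPd : ∀ j, P j ∈ deg d)
include hd hPd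

/-- If the `Pⱼ` have no common zero besides the origin, then the polynomial ring is finite over the
algebra generated by the `Pⱼ - c xⱼ`. -/
lemma finite_adjoin (hrad : ∀ i, (X i : S) ∈ (Ideal.span (Set.range P)).radical) (c : ℂ) :
    Module.Finite (Algebra.adjoin ℂ (Set.range fun j => P j - c • X j)) S := by
  set R := Algebra.adjoin ℂ (Set.range fun j => P j - c • (X j : S)) with hR
  obtain ⟨N, hN⟩ := Ideal.exists_pow_le_of_le_radical_of_fg
    (Ideal.span_le.2 (Set.range_subset_iff.2 hrad)) (IsNoetherian.noetherian (Ideal.span (Set.range X)))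
  let B : Set S := (fun α : Fin 4 →₀ ℕ => (monomial α (1 : ℂ) : S)) '' {α | α.degree < N}
  have hB : B.Finite :=
    Set.Finite.image _ (Finsupp.finite_of_degree_lt N)
  have key : ∀ (n : ℕ) (f : S), f ∈ deg n → f ∈ Submodule.span R B := by
    intro n
    induction n using Nat.strong_induction_on with
    | _ n ih =>
      intro f hf
      by_cases hn : n < N
      · rw [MvPolynomial.as_sum f]
        refine Submodule.sum_mem _ fun α hα => ?_
        have h1 : α.degree = n := by
          by_contra hne
          exact mem_support_iff.1 hα (IsHomogeneous.coeff_eq_zero hf hne)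
        have h2 : monomial α (f.coeff α) = algebraMap ℂ R (f.coeff α) • (monomial α (1 : ℂ) : S) := by
          rw [algebraMap_smul, smul_monomial, smul_eq_mul, mul_one]
        rw [h2]
        exact Submodule.smul_mem _ _ (Submodule.subset_span ⟨α, by simpa [h1] using hn, rfl⟩)
      · have h1 : f ∈ Ideal.span (Set.range P) :=
          hN (Ideal.pow_le_pow_right (not_lt.1 hn) (mem_span_X_pow hf))
        obtain ⟨h, hh⟩ := Ideal.mem_span_range_iff_exists_fun.1 h1
        have h2 : f = ∑ j, if d ≤ n then homogeneousComponent (n - d) (h j) * P j else 0 := by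
          conv_lhs => rw [← homogeneousComponent_eq_self hf, ← hh, map_sum]
          exact Finset.sum_congr rfl fun j _ =>
            homogeneousComponent_mul_of_mem (hPd j) n (h j)
        rw [h2]
        refine Submodule.sum_mem _ fun j _ => ?_
        split_ifs with hdn
        · have h3 : homogeneousComponent (n - d) (h j) * P j =
              (⟨P j - c • X j, Algebra.subset_adjoin ⟨j, rfl⟩⟩ : R) •
                homogeneousComponent (n - d) (h j) +
              algebraMap ℂ R c • (homogeneousComponent (n - d) (h j) * X j) := by
            rw [algebraMap_smul, Subalgebra.smul_def]
            simp only [smul_eq_mul, Algebra.smul_def]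
            ring
          rw [h3]
          refine Submodule.add_mem _ (Submodule.smul_mem _ _ (ih (n - d) (by omega) _
            (homogeneousComponent_mem _ _))) (Submodule.smul_mem _ _ (ih (n - d + 1) (by omega) _ ?_))
          exact SetLike.mul_mem_graded (homogeneousComponent_mem _ _) (isHomogeneous_X ℂ j)
        · exact Submodule.zero_mem _
  refine ⟨⟨hB.toFinset, ?_⟩⟩
  rw [Set.Finite.coe_toFinset, eq_top_iff]
  rintro f -
  rw [← sum_homogeneousComponent f]
  exact Submodule.sum_mem _ fun n _ => key n _ (homogeneousComponent_mem n f)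

/-- A homogeneous vector field of degree at least two without zeros besides the origin has a
nonzero fixed point; so the ideal of the `2 × 2` minors of `(x, P)` has a zero. Otherwise the
`Gⱼ = Pⱼ - xⱼ` would generate the ideal of the origin, and the finite map `G` would be birational,
which contradicts the fact that all the degrees of polynomials in the `Gⱼ` are divisible by `d`. -/
theorem not_forall_mem_radical_minors :
    ¬ ∀ i, (X i : S) ∈ (Ideal.span
      (Set.range fun p : Fin 4 × Fin 4 => X p.1 * P p.2 - X p.2 * P p.1)).radical := by
  intro hrad
  set G : Fin 4 → S := fun j => P j - (1 : ℂ) • X j with hG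
  have hG' : ∀ j, G j = P j - X j := fun j => by rw [hG]; simp
  have hradP : ∀ i, (X i : S) ∈ (Ideal.span (Set.range P)).radical := fun i => by
    refine Ideal.radical_mono (Ideal.span_le.2 ?_) (hrad i)
    rintro _ ⟨p, rfl⟩
    exact Ideal.sub_mem _ (Ideal.mul_mem_left _ _ (Ideal.subset_span ⟨p.2, rfl⟩))
      (Ideal.mul_mem_left _ _ (Ideal.subset_span ⟨p.1, rfl⟩))
  have hradG : ∀ i, (X i : S) ∈ (Ideal.span (Set.range G)).radical := fun i => by
    refine Ideal.radical_mono (Ideal.span_le.2 ?_) (hrad i)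
    rintro _ ⟨p, rfl⟩
    have h : X p.1 * P p.2 - X p.2 * P p.1 = X p.1 * G p.2 - X p.2 * G p.1 := by
      rw [hG', hG']; ring
    simp only [h]
    exact Ideal.sub_mem _ (Ideal.mul_mem_left _ _ (Ideal.subset_span ⟨p.2, rfl⟩))
      (Ideal.mul_mem_left _ _ (Ideal.subset_span ⟨p.1, rfl⟩))
  set 𝔪 := Ideal.span (Set.range (X : Fin 4 → S)) with h𝔪
  have hP2 : ∀ j, P j ∈ 𝔪 ^ 2 := fun j => Ideal.pow_le_pow_right hd (mem_span_X_pow (hPd j))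
  -- the `Gⱼ` generate the ideal of the origin
  have hGm : 𝔪 ≤ Ideal.span (Set.range G) := by
    obtain ⟨N, hN⟩ := Ideal.exists_pow_le_of_le_radical_of_fg
      (Ideal.span_le.2 (Set.range_subset_iff.2 hradG)) (IsNoetherian.noetherian 𝔪)
    have h1 : 𝔪 ≤ Ideal.span (Set.range G) ⊔ 𝔪 ^ 2 := by
      refine Ideal.span_le.2 ?_
      rintro _ ⟨j, rfl⟩
      have h : X j = -G j + P j := by rw [hG']; ring
      rw [h]
      exact Submodule.add_mem_sup (Ideal.neg_mem_iff _ |>.2 (Ideal.subset_span ⟨j, rfl⟩)) (hP2 j)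
    have h2 : ∀ k : ℕ, 𝔪 ≤ Ideal.span (Set.range G) ⊔ 𝔪 ^ (k + 1) := by
      intro k
      induction k with
      | zero => rw [zero_add, pow_one]; exact le_sup_right
      | succ k ih =>
        refine ih.trans (sup_le le_sup_left ?_)
        calc 𝔪 ^ (k + 1) = 𝔪 ^ k * 𝔪 := pow_succ _ _
          _ ≤ 𝔪 ^ k * (Ideal.span (Set.range G) ⊔ 𝔪 ^ 2) := Ideal.mul_mono_right h1
          _ = 𝔪 ^ k * Ideal.span (Set.range G) ⊔ 𝔪 ^ (k + 1 + 1) := by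
            rw [Ideal.mul_sup, ← pow_add]
          _ ≤ _ := sup_le_sup_right Ideal.mul_le_right _
    refine (h2 N).trans (sup_le le_rfl ((Ideal.pow_le_pow_right (Nat.le_succ N)).trans hN))
  have hind : AlgebraicIndependent ℂ P := by
    have hfin := finite_adjoin hd hPd hradP 0
    have h0 : (fun j => P j - (0 : ℂ) • (X j : S)) = P := by simp
    rw [h0] at hfin
    have halg : Algebra.IsAlgebraic (Algebra.adjoin ℂ (Set.range P)) S :=
      (Algebra.IsIntegral.of_finite _ _).isAlgebraic
    refine (Algebra.IsAlgebraic.isTranscendenceBasis_of_le_trdeg_of_finite ℂ P ?_).1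
    rw [MvPolynomial.trdeg_of_isDomain]
    simp
  set R := Algebra.adjoin ℂ (Set.range G) with hR
  have hfin : Module.Finite R S := finite_adjoin hd hPd hradP 1
  -- Nakayama's lemma for the quotient of the polynomial ring by `R`
  let I : Ideal R := Ideal.span (Set.range fun j => ⟨G j, Algebra.subset_adjoin ⟨j, rfl⟩⟩)
  obtain ⟨r, hr1, hr⟩ := exists_smul_le_range (A := S) I fun f => by
    refine ⟨algebraMap ℂ R (coeff 0 f), ?_⟩
    have h1 : f - C (coeff 0 f) ∈ Ideal.span (Set.range G) := hGm (mem_span_X_iff.2 (by simp))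
    refine Ideal.span_le.2 ?_ h1
    rintro _ ⟨j, rfl⟩
    exact Ideal.mem_map_of_mem (algebraMap R S)
      (Ideal.subset_span ⟨j, rfl⟩ : (⟨G j, Algebra.subset_adjoin ⟨j, rfl⟩⟩ : R) ∈ I)
  have hr0 : (r : S) ≠ 0 := by
    intro h0
    have h1 : ∀ a ∈ I, coeff 0 (a : S) = 0 := by
      intro a ha
      rw [← mem_span_X_iff]
      have : I ≤ 𝔪.comap (algebraMap R S) := by
        refine Ideal.span_le.2 ?_
        rintro _ ⟨j, rfl⟩
        change G j ∈ 𝔪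
        rw [hG']
        exact Ideal.sub_mem _ (Ideal.pow_le_self two_ne_zero (hP2 j)) (Ideal.subset_span ⟨j, rfl⟩)
      exact this ha
    have h2 := h1 _ hr1
    simp [h0] at h2
  obtain ⟨p, hp⟩ := hr (X 0)
  have h1 : (p : S) = (r : S) * X 0 := hp
  have htop : ∀ j, IsTop d (G j) (P j) := fun j => ⟨hPd j, by
    rw [hG', sub_sub_cancel_left]
    exact Submodule.neg_mem _ (lowDeg_mono hd (mem_lowDeg_of_mem_deg (isHomogeneous_X ℂ j)))⟩
  have h2 := dvd_totalDegree (by omega) hind htop p.2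
  have h3 := dvd_totalDegree (by omega) hind htop r.2
  rw [h1, totalDegree_mul_of_isDomain hr0 (X_ne_zero 0), totalDegree_X] at h2
  have h4 := (Nat.dvd_add_right h3).1 h2
  have := Nat.le_of_dvd one_pos h4
  omega

end

/-! ### Values of rational functions at points -/

/-- The homogeneous prime ideal of a point of `ℙ³`. -/
abbrev pt (x : P3) : Ideal S := x.asHomogeneousIdeal.toIdeal

/-- The rational function `s` is regular at the prime `p`. -/
def RegAt (p : Ideal S) (s : K) : Prop :=
  ∃ f g : S, g ∉ p ∧ s * algebraMap S K g = algebraMap S K f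

/-- The rational function `s` is regular at the prime `p` and vanishes there. -/
def VanAt (p : Ideal S) (s : K) : Prop :=
  ∃ f ∈ p, ∃ g ∉ p, s * algebraMap S K g = algebraMap S K f

section

variable {p : Ideal S} [hp : p.IsPrime] {s t : K}

lemma VanAt.add (hs : VanAt p s) (ht : VanAt p t) : VanAt p (s + t) := by
  obtain ⟨f, hf, g, hg, h⟩ := hs
  obtain ⟨f', hf', g', hg', h'⟩ := ht
  refine ⟨f * g' + f' * g, Ideal.add_mem _ (Ideal.mul_mem_right _ _ hf)
    (Ideal.mul_mem_right _ _ hf'), g * g', fun hgg => (hp.mem_or_mem hgg).elim hg hg', ?_⟩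
  simp only [map_add, map_mul, ← h, ← h']
  ring

lemma VanAt.mul (hs : VanAt p s) (ht : RegAt p t) : VanAt p (s * t) := by
  obtain ⟨f, hf, g, hg, h⟩ := hs
  obtain ⟨f', g', hg', h'⟩ := ht
  refine ⟨f * f', Ideal.mul_mem_right _ _ hf, g * g',
    fun hgg => (hp.mem_or_mem hgg).elim hg hg', ?_⟩
  simp only [map_mul, ← h, ← h']
  ring

lemma vanAt_algebraMap {f : S} (hf : f ∈ p) : VanAt p (algebraMap S K f) :=
  ⟨f, hf, 1, (Ideal.ne_top_iff_one p).1 hp.ne_top, by simp⟩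

lemma regAt_const (c : ℂ) : RegAt p (algebraMap ℂ K c) :=
  ⟨C c, 1, (Ideal.ne_top_iff_one p).1 hp.ne_top, by
    rw [map_one, mul_one, IsScalarTower.algebraMap_apply ℂ S K]; rfl⟩

lemma VanAt.zero : VanAt p 0 := by simpa using vanAt_algebraMap (p := p) p.zero_mem

lemma VanAt.neg (hs : VanAt p s) : VanAt p (-s) := by
  have h := hs.mul (regAt_const (-1))
  rwa [map_neg, map_one, mul_neg_one] at h

lemma VanAt.sub (hs : VanAt p s) (ht : VanAt p t) : VanAt p (s - t) := by
  rw [sub_eq_add_neg]; exact hs.add ht.neg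

lemma VanAt.sum {ι : Type*} (u : Finset ι) {s : ι → K} (h : ∀ i ∈ u, VanAt p (s i)) :
    VanAt p (∑ i ∈ u, s i) := by
  classical
  induction u using Finset.induction_on with
  | empty => exact VanAt.zero
  | insert i u hi ih =>
    rw [Finset.sum_insert hi]
    exact (h i (Finset.mem_insert_self i u)).add
      (ih fun j hj => h j (Finset.mem_insert_of_mem hj))

lemma VanAt.mem {b c : S} (h : VanAt p s) (hs : s * algebraMap S K c = algebraMap S K b) :
    b ∈ p := by
  obtain ⟨f, hf, g, hg, h⟩ := h
  have h1 : b * g = f * c := algebraMap_S_injective (by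
    rw [map_mul, map_mul, ← h, ← hs]; ring)
  have h2 : b * g ∈ p := by rw [h1]; exact Ideal.mul_mem_right _ _ hf
  exact (hp.mem_or_mem h2).resolve_right hg

lemma VanAt.const_eq_zero {c : ℂ} (h : VanAt p (algebraMap ℂ K c)) : c = 0 := by
  by_contra hc
  have h1 : (C c : S) ∈ p := h.mem (c := 1) (by
    rw [map_one, mul_one, IsScalarTower.algebraMap_apply ℂ S K]; rfl)
  exact hp.ne_top (p.eq_top_of_isUnit_mem h1 ((Ne.isUnit hc).map C))

omit hp in
lemma vanAt_of_mem {b c : S} (hc : c ∉ p) (hs : s * algebraMap S K c = algebraMap S K b)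
    (hb : b ∈ p) : VanAt p s := ⟨b, hb, c, hc, hs⟩

lemma VanAt.mono {q : Ideal S} {n : ℤ} {σ : Finset (Fin 4)} (hσ : σ.Nonempty) (hpq : p ≤ q)
    (hq : ∀ i ∈ σ, (X i : S) ∉ q) [hq' : q.IsPrime] (hs : s ∈ twistSpace n σ) (h : VanAt p s) :
    VanAt q s := by
  obtain ⟨m, j, a, -, -, ha⟩ := exists_of_mem_twistSpace hσ hs
  refine vanAt_of_mem (fun hm => ?_) ha (hpq (h.mem ha))
  obtain ⟨i, hi, hXi⟩ := (hq'.prod_mem_iff).1 (hq'.mem_of_pow_mem m hm)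
  exact hq i hi hXi

end

lemma regAt_of_mem_twistSpace {n : ℤ} {σ : Finset (Fin 4)} {s : K} (hs : s ∈ twistSpace n σ)
    {x : P3} (hx : x ∈ stdOpen σ) : RegAt (pt x) s := by
  obtain ⟨i, j, a, b, -, -, -, hb, rfl⟩ := hs.2 x hx
  refine ⟨a, b, hb, div_mul_cancel₀ _ ?_⟩
  rw [Ne, map_eq_zero_iff _ algebraMap_S_injective]
  rintro rfl
  exact hb (Ideal.zero_mem _)

lemma vanishesAt_iff {i : Fin 4} {s : K} (hs : s ∈ twistSpace 0 {i}) {x : P3} (hx : x ∈ chart i) :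
    VanishesAt s x ↔ VanAt (pt x) s := by
  constructor
  · rintro ⟨-, f, g, -, -, hf, hg, rfl⟩
    refine ⟨f, hf, g, hg, div_mul_cancel₀ _ ?_⟩
    rw [Ne, map_eq_zero_iff _ algebraMap_S_injective]
    rintro rfl
    exact hg (Ideal.zero_mem _)
  · intro h
    obtain ⟨m, j, a, ha, hj, hsa⟩ := exists_of_mem_twistSpace (Finset.singleton_nonempty i) hs
    rw [Finset.prod_singleton] at hsa
    have hj' : j = m := by simpa using hj
    subst hj'
    refine ⟨j, a, X i ^ j, ha, isHomogeneous_X_pow i j, h.mem hsa,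
      fun hm => mem_chart.1 hx (x.isPrime.mem_of_pow_mem _ hm), ?_⟩
    rw [eq_div_iff, hsa]
    rw [Ne, map_eq_zero_iff _ algebraMap_S_injective]
    exact pow_ne_zero _ (X_ne_zero i)

lemma exists_mem_chart (x : P3) : ∃ i, x ∈ chart i := by
  by_contra hcon
  push Not at hcon
  refine x.not_irrelevant_le fun f hf => ?_
  have h1 : Ideal.span (Set.range (X : Fin 4 → S)) ≤ pt x := by
    refine Ideal.span_le.2 ?_
    rintro _ ⟨i, rfl⟩
    have := hcon i
    rw [mem_chart, not_not] at this
    exact this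
  refine h1 (mem_span_X_iff.2 ?_)
  rw [HomogeneousIdeal.mem_irrelevant_iff] at hf
  have h2 : homogeneousComponent 0 f = 0 := by
    rw [← MvPolynomial.decomposition.decompose'_apply]
    exact hf
  rwa [homogeneousComponent_zero, C_eq_zero] at h2

lemma X_mem_irrelevant (i : Fin 4) :
    (X i : S) ∈ (HomogeneousIdeal.irrelevant deg).toIdeal := by
  change X i ∈ HomogeneousIdeal.irrelevant deg
  rw [HomogeneousIdeal.mem_irrelevant_iff]
  exact DirectSum.decompose_of_mem_ne deg (i := 1) (isHomogeneous_X ℂ i) one_ne_zero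

/-- The projective Nullstellensatz for the points of the scheme `ℙ³`. -/
lemma mem_radical_of_forall_pt {I : Ideal S} (hI : I.IsHomogeneous deg) {f : S}
    (hf : f ∈ (HomogeneousIdeal.irrelevant deg).toIdeal) (h : ∀ x : P3, I ≤ pt x → f ∈ pt x) :
    f ∈ I.radical := by
  rw [hI.radical_eq, Submodule.mem_sInf]
  rintro P ⟨hPh, hIP, hP⟩
  by_cases hirr : (HomogeneousIdeal.irrelevant deg).toIdeal ≤ P
  · exact hirr hf
  · exact h ⟨⟨P, hPh⟩, hP, hirr⟩ hIP

/-! ### The ideal of the singular scheme -/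

/-- The ideal generated by the `2 × 2` minors of the matrix with rows `x` and `P`. -/
def minorIdeal (P : Fin 4 → S) : Ideal S :=
  Ideal.span (Set.range fun p : Fin 4 × Fin 4 => X p.1 * P p.2 - X p.2 * P p.1)

lemma minor_mem (P : Fin 4 → S) (a b : Fin 4) : X a * P b - X b * P a ∈ minorIdeal P :=
  Ideal.subset_span ⟨(a, b), rfl⟩

/-- The functions `∑ Pⱼ gⱼ` with `∑ xⱼ gⱼ = 0` and `gⱼ` in `𝒪(-d)`: the sections over `stdOpen σ`
of the ideal sheaf of the singular scheme. -/
def singSpace (P : Fin 4 → S) (d : ℕ) (σ : Finset (Fin 4)) : Submodule ℂ K :=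
  (eulerSpace (-d) σ).map ((formOf P).restrictScalars ℂ)

lemma mem_singSpace {P : Fin 4 → S} {d : ℕ} {σ : Finset (Fin 4)} {s : K} :
    s ∈ singSpace P d σ ↔ ∃ g ∈ eulerSpace (-d) σ, formOf P g = s := Iff.rfl

lemma algebraMap_mem_twistSpace_of_mem_deg {m : ℕ} {f : S} (hf : f ∈ deg m) (σ : Finset (Fin 4)) :
    algebraMap S K f ∈ twistSpace m σ := by
  refine ⟨⟨m, 0, f, 1, hf, isHomogeneous_one _ _, by simp, Submonoid.one_mem _, by simp⟩,
    fun x _ => ⟨m, 0, f, 1, hf, isHomogeneous_one _ _, by simp, Submonoid.one_mem _, by simp⟩⟩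

section

variable {d : ℕ} {P : Fin 4 → S} (hPd : ∀ j, P j ∈ deg d)
include hPd

lemma minor_mem_deg (a b : Fin 4) : X a * P b - X b * P a ∈ deg (d + 1) := by
  rw [add_comm]
  exact Submodule.sub_mem _ (SetLike.mul_mem_graded (isHomogeneous_X ℂ a) (hPd b))
    (SetLike.mul_mem_graded (isHomogeneous_X ℂ b) (hPd a))

lemma minorIdeal_isHomogeneous : (minorIdeal P).IsHomogeneous deg := by
  refine Ideal.homogeneous_span deg _ ?_
  rintro _ ⟨p, rfl⟩
  exact ⟨d + 1, minor_mem_deg hPd p.1 p.2⟩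

/-- A homogeneous element of the ideal of minors, divided by a power of the coordinates which makes
its degree zero, is a section of the ideal sheaf of the singular scheme. -/
lemma mul_mem_singSpace {m : ℕ} {b : S} (hb : b ∈ minorIdeal P) (hbm : b ∈ deg m)
    {σ : Finset (Fin 4)} {s : K} (hs : s ∈ twistSpace (-m) σ) :
    algebraMap S K b * s ∈ singSpace P d σ := by
  obtain ⟨c, hc⟩ := Ideal.mem_span_range_iff_exists_fun.1 hb
  have h2 : b = ∑ p : Fin 4 × Fin 4, if d + 1 ≤ m then
      homogeneousComponent (m - (d + 1)) (c p) * (X p.1 * P p.2 - X p.2 * P p.1) else 0 := by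
    conv_lhs => rw [← homogeneousComponent_eq_self hbm, ← hc, map_sum]
    exact Finset.sum_congr rfl fun p _ =>
      homogeneousComponent_mul_of_mem (minor_mem_deg hPd p.1 p.2) m (c p)
  rw [h2, map_sum, Finset.sum_mul]
  refine Submodule.sum_mem _ fun p _ => ?_
  split_ifs with hm
  · set e := homogeneousComponent (m - (d + 1)) (c p) with he
    have h3 : algebraMap S K e * s ∈ twistSpace (-d - 1) σ := by
      have h := mul_mem_twistSpace
        (algebraMap_mem_twistSpace_of_mem_deg (homogeneousComponent_mem (m - (d + 1)) (c p)) σ) hs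
      have h4 : ((m - (d + 1) : ℕ) : ℤ) + -m = -d - 1 := by push_cast [hm]; ring
      rwa [h4] at h
    refine ⟨(algebraMap S K e * s) • (coord p.1 • Pi.single p.2 1 - coord p.2 • Pi.single p.1 1),
      ⟨fun j => ?_, ?_⟩, ?_⟩
    · have h5 : ∀ k l : Fin 4, (algebraMap S K e * s) *
          (coord k • Pi.single l (1 : K) : Fin 4 → K) j ∈ twistSpace (-d) σ := by
        intro k l
        have h := mul_mem_twistSpace h3 (coord_mem k σ)
        rw [sub_add_cancel] at h
        rcases eq_or_ne j l with rfl | hjl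
        · simpa using h
        · simp [Pi.single_eq_of_ne hjl]
      rw [Pi.smul_apply, Pi.sub_apply, smul_eq_mul, mul_sub]
      exact Submodule.sub_mem _ (h5 _ _) (h5 _ _)
    · simp only [Pi.smul_apply, Pi.sub_apply, smul_eq_mul, mul_sub, Finset.sum_sub_distrib,
        Pi.single_apply, mul_ite, mul_one, mul_zero, Finset.sum_ite_eq', Finset.mem_univ, if_true]
      ring
    · rw [LinearMap.restrictScalars_apply, map_smul, formOf_apply]
      simp only [Pi.smul_apply, Pi.sub_apply, smul_eq_mul, mul_sub, Finset.sum_sub_distrib,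
        Pi.single_apply, mul_ite, mul_one, mul_zero, Finset.sum_ite_eq', Finset.mem_univ, if_true,
        map_mul, map_sub]
      simp only [coord]
      ring
  · rw [map_zero, zero_mul]
    exact Submodule.zero_mem _

omit hPd in
lemma vanAt_of_mem_singSpace {σ : Finset (Fin 4)} (hσ : σ.Nonempty) {s : K}
    (hs : s ∈ singSpace P d σ) {x : P3} (hxσ : x ∈ stdOpen σ) (hx : minorIdeal P ≤ pt x) :
    VanAt (pt x) s := by
  obtain ⟨i, hi⟩ := hσ
  obtain ⟨g, hg, rfl⟩ := hs
  have h1 : formOf P g * coord i = ∑ j, algebraMap S K (X i * P j - X j * P i) * g j := by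
    have h2 := hg.2
    rw [formOf_apply, Finset.sum_mul]
    have h3 : ∀ j, algebraMap S K (X i * P j - X j * P i) * g j =
        algebraMap S K (P j) * g j * coord i - algebraMap S K (P i) * (coord j * g j) := by
      intro j
      simp only [map_sub, map_mul, coord]
      ring
    simp only [h3, Finset.sum_sub_distrib, ← Finset.mul_sum, h2, mul_zero, sub_zero]
  have h4 : VanAt (pt x) (formOf P g * coord i) := by
    rw [h1]
    exact VanAt.sum _ fun j _ => (vanAt_algebraMap (hx (minor_mem P i j))).mul
      (regAt_of_mem_twistSpace (hg.1 j) hxσ)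
  have h5 : RegAt (pt x) (coord i)⁻¹ := by
    refine ⟨1, X i, mem_stdOpen.1 hxσ i hi, ?_⟩
    rw [map_one]
    exact inv_mul_cancel₀ (coord_ne_zero i)
  have h6 := h4.mul h5
  rwa [mul_assoc, mul_inv_cancel₀ (coord_ne_zero i), mul_one] at h6

end

/-! ### The points of the singular scheme -/

lemma coord_pow_inv_mem {i : Fin 4} {σ : Finset (Fin 4)} (hi : i ∈ σ) (m : ℕ) :
    (coord i ^ m)⁻¹ ∈ twistSpace (-m) σ := by
  have h := coord_zpow_mem hi (-m)
  rwa [zpow_neg, zpow_natCast] at h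

/-- The functions on a standard chart are the quotients of forms by powers of the coordinate. -/
lemma exists_of_mem_twistSpace_zero {i : Fin 4} {s : K} (hs : s ∈ twistSpace 0 {i}) :
    ∃ (m : ℕ) (b : S), b ∈ deg m ∧ s * algebraMap S K (X i ^ m) = algebraMap S K b := by
  obtain ⟨m, j, b, hb, hj, hsb⟩ := exists_of_mem_twistSpace (Finset.singleton_nonempty i) hs
  rw [Finset.prod_singleton] at hsb
  have hj' : j = m := by simpa using hj
  exact ⟨m, b, hj' ▸ hb, hsb⟩

section

variable {d : ℕ} {P : Fin 4 → S} (hPd : ∀ j, P j ∈ deg d)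

include hPd

/-- The points of `sing₁` are the common zeros of the `2 × 2` minors. -/
theorem TwistedField.singCurve_eq {φ : TwistedField ((d : ℤ) - 1)} (hφ : φ.ConormalLocallyFree)
    (hP : ∀ σ : Finset (Fin 4), σ.Nonempty → ∀ ω : Ω[Reg (stdOpen σ)⁄ℂ],
      twistVal _ _ (φ.dual (stdOpen σ) ω) = formOf P (grad (stdOpen σ) ω)) :
    φ.singCurve = {x | minorIdeal P ≤ pt x} := by
  ext x
  constructor
  · rintro ⟨i, hx, h⟩
    refine Ideal.span_le.2 ?_
    rintro _ ⟨⟨k, l⟩, rfl⟩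
    have h1 := mul_mem_singSpace hPd (minor_mem P k l) (minor_mem_deg hPd k l)
      (coord_pow_inv_mem (Finset.mem_singleton_self i) (d + 1))
    have h2 : algebraMap S K (X k * P l - X l * P k) * (coord i ^ (d + 1))⁻¹ ∈
        twistSpace 0 {i} := by
      have h := mul_mem_twistSpace (algebraMap_mem_twistSpace_of_mem_deg
        (minor_mem_deg hPd k l) {i}) (coord_pow_inv_mem (Finset.mem_singleton_self i) (d + 1))
      rwa [add_neg_cancel] at h
    obtain ⟨g, hg, hga⟩ := h1
    have h3 := h (toReg _ h2) (by
      rw [φ.curveIdeal_eq_singIdeal hφ]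
      exact (mem_singIdeal hP).2 ⟨g, hg, hga.symm⟩)
    refine ((vanishesAt_iff h2 hx).1 h3).mem (c := X i ^ (d + 1)) ?_
    rw [map_pow]
    exact inv_mul_cancel_right₀ (pow_ne_zero _ (coord_ne_zero i)) _
  · intro hx
    obtain ⟨i, hi⟩ := exists_mem_chart x
    refine ⟨i, hi, fun a ha => (vanishesAt_iff (algebraMap_mem_twistSpace a) hi).2 ?_⟩
    rw [φ.curveIdeal_eq_singIdeal hφ] at ha
    obtain ⟨g, hg, hga⟩ := (mem_singIdeal hP).1 ha
    rw [hga]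
    exact vanAt_of_mem_singSpace (Finset.singleton_nonempty i) ⟨g, hg, rfl⟩ hi hx

lemma exists_minorIdeal_le (hd : 2 ≤ d) : ∃ x : P3, minorIdeal P ≤ pt x := by
  by_contra hcon
  push Not at hcon
  exact not_forall_mem_radical_minors hd hPd fun i =>
    mem_radical_of_forall_pt (minorIdeal_isHomogeneous hPd) (X_mem_irrelevant i)
      fun x hx => absurd hx (hcon x)

/-- Every point of the singular scheme is a specialization of the generic point of one of its
finitely many irreducible components. -/
lemma exists_finite_generic : ∃ E : Set P3, E.Finite ∧ (∀ x ∈ E, minorIdeal P ≤ pt x) ∧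
    ∀ x, minorIdeal P ≤ pt x → ∃ y ∈ E, pt y ≤ pt x := by
  refine ⟨{x | pt x ∈ (minorIdeal P).minimalPrimes}, ?_, fun x hx => hx.1.2, fun x hx => ?_⟩
  · refine ((minorIdeal P).finite_minimalPrimes_of_isNoetherianRing S).preimage ?_
    rintro x - y - hxy
    exact ProjectiveSpectrum.ext (HomogeneousIdeal.ext hxy)
  · obtain ⟨q, hq, hqx⟩ := Ideal.exists_minimalPrimes_le hx
    have hqp : q.IsPrime := hq.1.1
    have hc : (q.homogeneousCore deg).toIdeal = q := by
      refine le_antisymm (Ideal.toIdeal_homogeneousCore_le _ _)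
        (hq.2 ⟨hqp.homogeneousCore, ?_⟩ (Ideal.toIdeal_homogeneousCore_le _ _))
      rw [← (minorIdeal_isHomogeneous hPd).toIdeal_homogeneousCore_eq_self]
      exact Ideal.homogeneousCore_mono deg hq.1.2
    refine ⟨⟨q.homogeneousCore deg, hqp.homogeneousCore, fun h => x.not_irrelevant_le ?_⟩, ?_, ?_⟩
    · exact (show (HomogeneousIdeal.irrelevant deg).toIdeal ≤
        (q.homogeneousCore deg).toIdeal from h).trans (hc.le.trans hqx)
    · change (q.homogeneousCore deg).toIdeal ∈ (minorIdeal P).minimalPrimes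
      rwa [hc]
    · change (q.homogeneousCore deg).toIdeal ≤ _
      rwa [hc]

end

/-! ### Global functions on the singular scheme -/

/-- The global functions on the singular scheme, given by functions on the standard charts which
agree, on the overlaps, modulo the ideal of the singular scheme. -/
def globalFunctions (P : Fin 4 → S) (d : ℕ) : Submodule ℂ (Fin 4 → K) where
  carrier := {a | (∀ i, a i ∈ twistSpace 0 {i}) ∧ ∀ i j, a j - a i ∈ singSpace P d {i, j}}
  add_mem' ha hb := ⟨fun i => Submodule.add_mem _ (ha.1 i) (hb.1 i), fun i j => by
    rw [Pi.add_apply, Pi.add_apply, add_sub_add_comm]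
    exact Submodule.add_mem _ (ha.2 i j) (hb.2 i j)⟩
  zero_mem' := ⟨fun i => Submodule.zero_mem _, fun i j => by
    rw [Pi.zero_apply, Pi.zero_apply, sub_zero]; exact Submodule.zero_mem _⟩
  smul_mem' c a ha := ⟨fun i => Submodule.smul_mem _ c (ha.1 i), fun i j => by
    rw [Pi.smul_apply, Pi.smul_apply, ← smul_sub]
    exact Submodule.smul_mem _ c (ha.2 i j)⟩

/-- A field element which maps a nonzero finite-dimensional space into itself is a constant. -/
lemma exists_const_of_mul_mem {L : Type*} [Field L] [Algebra ℂ L] (V : Submodule ℂ L)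
    [FiniteDimensional ℂ V] (hV : V ≠ ⊥) (f : L) (hf : ∀ v ∈ V, f * v ∈ V) :
    ∃ c : ℂ, f = algebraMap ℂ L c := by
  have : Nontrivial V := Submodule.nontrivial_iff_ne_bot.2 hV
  obtain ⟨c, hc⟩ := Module.End.exists_eigenvalue ((LinearMap.mulLeft ℂ f).restrict hf)
  obtain ⟨v, hv⟩ := hc.exists_hasEigenvector
  refine ⟨c, ?_⟩
  have h1 : f * (v : L) = c • (v : L) := congrArg Subtype.val hv.apply_eq_smul
  have h2 : (v : L) ≠ 0 := fun h => hv.2 (Subtype.ext h)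
  rw [Algebra.smul_def] at h1
  exact mul_right_cancel₀ h2 h1

/-- A rational function `f` on an integral projective scheme such that every `xᵢ^M f` is a form of
degree `M` is constant: multiplication with `f` preserves the forms of degree `4 M`. -/
lemma exists_const_of_forall_pow_mul {L : Type*} [Field L] [Algebra ℂ L] (π : S →ₐ[ℂ] L) (M : ℕ)
    (f : L) (hf : ∀ i, ∃ b ∈ deg M, π (X i) ^ M * f = π b) (h0 : ∃ i, π (X i) ≠ 0) :
    ∃ c : ℂ, f = algebraMap ℂ L c := by
  obtain ⟨k, hk⟩ := h0
  have hfin : FiniteDimensional ℂ (deg (4 * M)) :=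
    Module.Finite.iff_fg.2 (homogeneousSubmodule_fg (σ := Fin 4) (R := ℂ) (4 * M))
  refine exists_const_of_mul_mem ((deg (4 * M)).map π.toLinearMap) (fun hbot => ?_) f ?_
  · have h : π (X k ^ (4 * M)) ∈ (deg (4 * M)).map π.toLinearMap :=
      ⟨_, isHomogeneous_X_pow k _, rfl⟩
    rw [hbot, Submodule.mem_bot, map_pow] at h
    exact pow_ne_zero _ hk h
  · rintro _ ⟨p, hp, rfl⟩
    rw [← support_sum_monomial_coeff p]
    simp only [AlgHom.toLinearMap_apply, map_sum, Finset.mul_sum]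
    refine Submodule.sum_mem _ fun e he => ?_
    have hdeg : e.degree = 4 * M := by
      by_contra hne
      exact mem_support_iff.1 he (hp.coeff_eq_zero hne)
    -- one of the four exponents is at least `M`
    obtain ⟨i, hi⟩ : ∃ i, M ≤ e i := by
      by_contra hcon
      push Not at hcon
      have h1 : e.degree = e 0 + e 1 + e 2 + e 3 := by
        rw [Finsupp.degree_eq_sum, Fin.sum_univ_four]
      have := hcon 0
      have := hcon 1
      have := hcon 2
      have := hcon 3
      omega
    obtain ⟨b, hb, hfb⟩ := hf i
    have hle : Finsupp.single i M ≤ e := Finsupp.single_le_iff.2 hi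
    have h2 : monomial e (coeff e p) = monomial (e - Finsupp.single i M) (coeff e p) * X i ^ M := by
      rw [X_pow_eq_monomial, monomial_mul, mul_one, tsub_add_cancel_of_le hle]
    refine ⟨monomial (e - Finsupp.single i M) (coeff e p) * b, ?_, ?_⟩
    · have h3 : (e - Finsupp.single i M).degree + M = 4 * M := by
        have h4 := congrArg Finsupp.degree (tsub_add_cancel_of_le hle)
        rwa [map_add, Finsupp.degree_single, hdeg] at h4
      rw [← h3]
      exact SetLike.mul_mem_graded (isHomogeneous_monomial _ rfl) hb
    · rw [AlgHom.toLinearMap_apply, h2, map_mul, map_mul, map_pow, ← hfb]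
      ring

section

variable {d : ℕ} {P : Fin 4 → S}

lemma vanAt_sub_of_mem_globalFunctions {a : Fin 4 → K} (ha : a ∈ globalFunctions P d) {x : P3}
    (hx : minorIdeal P ≤ pt x) {i j : Fin 4} (hi : x ∈ chart i) (hj : x ∈ chart j) :
    VanAt (pt x) (a j - a i) := by
  refine vanAt_of_mem_singSpace ⟨i, by simp⟩ (ha.2 i j) (mem_stdOpen.2 ?_) hx
  intro k hk
  rw [Finset.mem_insert, Finset.mem_singleton] at hk
  rcases hk with rfl | rfl
  · exact mem_chart.1 hi
  · exact mem_chart.1 hj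

/-- The value of a global function at a point, possibly not closed, of the singular scheme is a
constant. -/
theorem exists_value {a : Fin 4 → K} (ha : a ∈ globalFunctions P d) {x : P3}
    (hx : minorIdeal P ≤ pt x) :
    ∃ c : ℂ, ∀ i, x ∈ chart i → VanAt (pt x) (a i - algebraMap ℂ K c) := by
  choose m b hb hab using fun i => exists_of_mem_twistSpace_zero (ha.1 i)
  let L := FractionRing (S ⧸ pt x)
  let π : S →ₐ[ℂ] L := (IsScalarTower.toAlgHom ℂ (S ⧸ pt x) L).comp (Ideal.Quotient.mkₐ ℂ (pt x))
  have hπ : ∀ s, π s = 0 ↔ s ∈ pt x := by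
    intro s
    change algebraMap (S ⧸ pt x) L (Ideal.Quotient.mk _ s) = 0 ↔ _
    rw [map_eq_zero_iff _ (IsFractionRing.injective (S ⧸ pt x) L), Ideal.Quotient.eq_zero_iff_mem]
  obtain ⟨k, hk⟩ := exists_mem_chart x
  have hX : ∀ i, x ∈ chart i ↔ π (X i) ≠ 0 := fun i => by
    rw [mem_chart, Ne, hπ]; rfl
  let f : L := π (b k) / π (X k) ^ m k
  -- on every chart which contains the point, the value is `f`
  have hf : ∀ i, x ∈ chart i → f * π (X i) ^ m i = π (b i) := by
    intro i hi
    have h1 := (vanAt_sub_of_mem_globalFunctions ha hx hk hi).mem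
      (b := b i * X k ^ m k - b k * X i ^ m i) (c := X i ^ m i * X k ^ m k) (by
        rw [map_sub, map_mul, map_mul (algebraMap S K) (b i), ← hab i,
          map_mul (algebraMap S K) (b k), ← hab k]; ring)
    rw [← hπ, map_sub, map_mul, map_mul, map_pow, map_pow, sub_eq_zero] at h1
    have h2 := pow_ne_zero (m k) ((hX k).1 hk)
    rw [div_mul_eq_mul_div, ← h1, mul_div_assoc, div_self h2, mul_one]
  obtain ⟨c, hc⟩ := exists_const_of_forall_pow_mul π (∑ i, m i + 1) f (fun i => by
    by_cases hi : x ∈ chart i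
    · have hle : m i ≤ ∑ i, m i + 1 :=
        (Finset.single_le_sum (fun _ _ => Nat.zero_le _) (Finset.mem_univ i)).trans (Nat.le_succ _)
      refine ⟨X i ^ (∑ i, m i + 1 - m i) * b i, ?_, ?_⟩
      · have h := SetLike.mul_mem_graded (isHomogeneous_X_pow (R := ℂ) i (∑ i, m i + 1 - m i))
          (hb i)
        rwa [Nat.sub_add_cancel hle] at h
      · rw [map_mul, ← hf i hi, map_pow, mul_left_comm, ← pow_add, Nat.sub_add_cancel hle, mul_comm]
    · refine ⟨0, Submodule.zero_mem _, ?_⟩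
      rw [hX, not_not] at hi
      rw [hi, zero_pow (Nat.succ_ne_zero _), zero_mul, map_zero]) ⟨k, (hX k).1 hk⟩
  refine ⟨c, fun i hi => vanAt_of_mem (b := b i - C c * X i ^ m i) (c := X i ^ m i) ?_ ?_ ?_⟩
  · exact fun h => mem_chart.1 hi (x.isPrime.mem_of_pow_mem _ h)
  · rw [sub_mul, hab, map_sub, map_mul, IsScalarTower.algebraMap_apply ℂ S K]
    rfl
  · rw [← hπ, map_sub, map_mul, ← hf i hi, map_pow, hc]
    change _ - π (algebraMap ℂ S c) * _ = 0
    rw [AlgHom.commutes, sub_self]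

end

/-! ### Functions with prescribed values on disjoint closed subsets -/

lemma isHomogeneous_pow {I : Ideal S} (hI : I.IsHomogeneous deg) (n : ℕ) :
    (I ^ n).IsHomogeneous deg := by
  induction n with
  | zero => rw [pow_zero, Ideal.one_eq_top]; exact Ideal.IsHomogeneous.top deg
  | succ n ih => rw [pow_succ]; exact ih.mul hI

lemma homogeneousComponent_mem_of_isHomogeneous {I : Ideal S} (hI : I.IsHomogeneous deg) {f : S}
    (hf : f ∈ I) (n : ℕ) : homogeneousComponent n f ∈ I := by
  rw [← MvPolynomial.decomposition.decompose'_apply]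
  exact hI n hf

lemma mem_of_inf_irrelevant_le {T : Set P3} (hT : IsClosed T) {x : P3}
    (h : (ProjectiveSpectrum.vanishingIdeal T).toIdeal ⊓
      (HomogeneousIdeal.irrelevant deg).toIdeal ≤ pt x) : x ∈ T := by
  have h1 := (x.isPrime.inf_le.1 h).resolve_right x.not_irrelevant_le
  rw [← hT.closure_eq, ← ProjectiveSpectrum.zeroLocus_vanishingIdeal_eq_closure]
  exact h1

section

variable {d : ℕ} {P : Fin 4 → S}

/-- If the singular scheme is the disjoint union of two closed subsets, then it has a global
function with value `0` on the first and `1` on the second one. With forms `uᵢ` and `vᵢ` in high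
powers of the ideals of the two subsets such that `xᵢ^M = uᵢ + vᵢ`, it is `uᵢ / xᵢ^M`. -/
theorem exists_separating (hPd : ∀ j, P j ∈ deg d) {T₁ T₂ : Set P3} (h₁ : IsClosed T₁)
    (h₂ : IsClosed T₂) (hT : Disjoint T₁ T₂) (hZ : ∀ x, minorIdeal P ≤ pt x → x ∈ T₁ ∨ x ∈ T₂) :
    ∃ a ∈ globalFunctions P d, (∀ x ∈ T₁, ∀ i, x ∈ chart i → VanAt (pt x) (a i)) ∧
      ∀ x ∈ T₂, ∀ i, x ∈ chart i → VanAt (pt x) (a i - 1) := by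
  set I₁ := (ProjectiveSpectrum.vanishingIdeal T₁).toIdeal ⊓
    (HomogeneousIdeal.irrelevant deg).toIdeal with hI₁
  set I₂ := (ProjectiveSpectrum.vanishingIdeal T₂).toIdeal ⊓
    (HomogeneousIdeal.irrelevant deg).toIdeal with hI₂
  have hh₁ : I₁.IsHomogeneous deg := (HomogeneousIdeal.isHomogeneous _).inf
    (HomogeneousIdeal.isHomogeneous _)
  have hh₂ : I₂.IsHomogeneous deg := (HomogeneousIdeal.isHomogeneous _).inf
    (HomogeneousIdeal.isHomogeneous _)
  have hv₁ : ∀ x ∈ T₁, I₁ ≤ pt x := fun x hx f hf =>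
    (ProjectiveSpectrum.mem_vanishingIdeal T₁ f).1 hf.1 x hx
  have hv₂ : ∀ x ∈ T₂, I₂ ≤ pt x := fun x hx f hf =>
    (ProjectiveSpectrum.mem_vanishingIdeal T₂ f).1 hf.1 x hx
  obtain ⟨N, hN0, hN⟩ : ∃ N ≠ 0, (I₁ * I₂) ^ N ≤ minorIdeal P := by
    have h : I₁ * I₂ ≤ (minorIdeal P).radical := by
      refine Ideal.mul_le.2 fun f hf g hg => mem_radical_of_forall_pt
        (minorIdeal_isHomogeneous hPd) (Ideal.mul_mem_right _ _ hf.2) fun x hx => ?_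
      rcases hZ x hx with h | h
      · exact Ideal.mul_mem_right _ _ (hv₁ x h hf)
      · exact Ideal.mul_mem_left _ _ (hv₂ x h hg)
    obtain ⟨N, hN⟩ := Ideal.exists_pow_le_of_le_radical_of_fg h
      (isNoetherian_def.1 inferInstance _)
    exact ⟨N + 1, N.succ_ne_zero, (Ideal.pow_le_pow_right N.le_succ).trans hN⟩
  have hrad : ∀ i, (X i : S) ∈ (I₁ ^ N ⊔ I₂ ^ N).radical := fun i => by
    refine mem_radical_of_forall_pt ((isHomogeneous_pow hh₁ N).sup (isHomogeneous_pow hh₂ N))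
      (X_mem_irrelevant i) fun x hx => ?_
    exact absurd (mem_of_inf_irrelevant_le h₂
      (Ideal.IsPrime.le_of_pow_le (le_sup_right.trans hx)))
      (Set.disjoint_left.1 hT (mem_of_inf_irrelevant_le h₁
        (Ideal.IsPrime.le_of_pow_le (le_sup_left.trans hx))))
  choose m hm using hrad
  set M := ∑ i, m i with hM
  have hsum : ∀ i, ∃ u ∈ I₁ ^ N, ∃ v ∈ I₂ ^ N, u ∈ deg M ∧ v ∈ deg M ∧ u + v = X i ^ M := by
    intro i
    have h1 : (X i : S) ^ M ∈ I₁ ^ N ⊔ I₂ ^ N := Ideal.pow_mem_of_pow_mem _ (hm i)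
      (Finset.single_le_sum (fun _ _ => Nat.zero_le _) (Finset.mem_univ i))
    obtain ⟨u, hu, v, hv, huv⟩ := Submodule.mem_sup.1 h1
    refine ⟨_, homogeneousComponent_mem_of_isHomogeneous (isHomogeneous_pow hh₁ N) hu M, _,
      homogeneousComponent_mem_of_isHomogeneous (isHomogeneous_pow hh₂ N) hv M,
      homogeneousComponent_mem M u, homogeneousComponent_mem M v, ?_⟩
    rw [← map_add, huv]
    exact homogeneousComponent_eq_self (isHomogeneous_X_pow i M)
  choose u hu v hv hud hvd huv using hsum
  have hc : ∀ i, coord i ^ M ≠ 0 := fun i => pow_ne_zero _ (coord_ne_zero i)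
  have huv' : ∀ i, algebraMap S K (u i) + algebraMap S K (v i) = coord i ^ M := fun i => by
    rw [← map_add, huv, map_pow]; rfl
  have hXM : ∀ x : P3, ∀ i, x ∈ chart i → (X i : S) ^ M ∉ pt x := fun x i hi h =>
    mem_chart.1 hi (x.isPrime.mem_of_pow_mem _ h)
  refine ⟨fun i => algebraMap S K (u i) * (coord i ^ M)⁻¹, ⟨fun i => ?_, fun i j => ?_⟩,
    fun x hx i hi => ?_, fun x hx i hi => ?_⟩
  · have h := mul_mem_twistSpace (algebraMap_mem_twistSpace_of_mem_deg (hud i) {i})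
      (coord_pow_inv_mem (Finset.mem_singleton_self i) M)
    rwa [add_neg_cancel] at h
  · have h1 : ∀ k l, u k * v l ∈ minorIdeal P := fun k l => by
      refine hN ?_
      rw [mul_pow]
      exact Ideal.mul_mem_mul (hu k) (hv l)
    have h2 : u j * v i - u i * v j ∈ minorIdeal P := Ideal.sub_mem _ (h1 j i) (h1 i j)
    have h3 : u j * v i - u i * v j ∈ deg (M + M) := Submodule.sub_mem _
      (SetLike.mul_mem_graded (hud j) (hvd i)) (SetLike.mul_mem_graded (hud i) (hvd j))
    have h4 : (coord i ^ M)⁻¹ * (coord j ^ M)⁻¹ ∈ twistSpace (-(M + M : ℕ)) {i, j} := by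
      have h := mul_mem_twistSpace
        (coord_pow_inv_mem (σ := {i, j}) (Finset.mem_insert_self i _) M)
        (coord_pow_inv_mem (σ := {i, j}) (i := j) (by simp) M)
      rwa [← neg_add, ← Nat.cast_add] at h
    have h5 := mul_mem_singSpace hPd h2 h3 h4
    convert h5 using 1
    rw [map_sub, map_mul, map_mul]
    have hi := hc i
    have hj := hc j
    field_simp
    rw [← huv' i, ← huv' j]
    ring
  · refine vanAt_of_mem (hXM x i hi) (b := u i) ?_ (hv₁ x hx (Ideal.pow_le_self hN0 (hu i)))
    rw [map_pow]
    exact inv_mul_cancel_right₀ (hc i) _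
  · refine vanAt_of_mem (hXM x i hi) (b := -v i) ?_
      (Ideal.neg_mem_iff _ |>.2 (hv₂ x hx (Ideal.pow_le_self hN0 (hv i))))
    rw [map_pow, map_neg, sub_mul, one_mul]
    change algebraMap S K (u i) * (coord i ^ M)⁻¹ * coord i ^ M - coord i ^ M = _
    rw [inv_mul_cancel_right₀ (hc i), ← huv' i]
    ring

/-- If `sing₁` is reduced, then its ideal consists of the functions that vanish at its points. -/
theorem TwistedField.mem_singSpace_of_vanAt {φ : TwistedField ((d : ℤ) - 1)}
    (hPd : ∀ j, P j ∈ deg d) (hφ : φ.ConormalLocallyFree)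
    (hP : ∀ σ : Finset (Fin 4), σ.Nonempty → ∀ ω : Ω[Reg (stdOpen σ)⁄ℂ],
      twistVal _ _ (φ.dual (stdOpen σ) ω) = formOf P (grad (stdOpen σ) ω))
    (hred : φ.SingCurveReduced) {i : Fin 4} {s : K} (hs : s ∈ twistSpace 0 {i})
    (hv : ∀ x, minorIdeal P ≤ pt x → x ∈ chart i → VanAt (pt x) s) : s ∈ singSpace P d {i} := by
  obtain ⟨m, b, hb, hsb⟩ := exists_of_mem_twistSpace_zero hs
  have hrad : b * X i ∈ (minorIdeal P).radical := by
    refine mem_radical_of_forall_pt (minorIdeal_isHomogeneous hPd)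
      (Ideal.mul_mem_left _ _ (X_mem_irrelevant i)) fun x hx => ?_
    by_cases hi : x ∈ chart i
    · exact Ideal.mul_mem_right _ _ ((hv x hx hi).mem hsb)
    · rw [mem_chart, not_not] at hi
      exact Ideal.mul_mem_left _ _ hi
  obtain ⟨N, hN⟩ := hrad
  have hdeg : (b * X i) ^ N ∈ deg ((m + 1) * N) := by
    have h := SetLike.pow_mem_graded N (SetLike.mul_mem_graded hb (isHomogeneous_X ℂ i))
    rwa [smul_eq_mul, mul_comm N] at h
  have h1 := mul_mem_singSpace hPd hN hdeg
    (coord_pow_inv_mem (Finset.mem_singleton_self i) ((m + 1) * N))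
  have h2 : algebraMap S K ((b * X i) ^ N) * (coord i ^ ((m + 1) * N))⁻¹ = s ^ N := by
    have hc := pow_ne_zero ((m + 1) * N) (coord_ne_zero i)
    rw [mul_inv_eq_iff_eq_mul₀ hc, map_pow, map_mul, ← hsb, pow_mul, ← mul_pow, map_pow, mul_assoc,
      pow_succ]
    rfl
  rw [h2] at h1
  obtain ⟨g, hg, hgs⟩ := mem_singSpace.1 h1
  have hradical : (φ.singIdeal (chart i)).IsRadical := by
    rw [← φ.curveIdeal_eq_singIdeal hφ]
    exact Ideal.isRadical_iff_quotient_reduced _ |>.2 (hred i)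
  obtain ⟨g', hg', hgs'⟩ := (mem_singIdeal hP).1 (hradical (show toReg s hs ∈ _ from
    ⟨N, (mem_singIdeal hP).2 ⟨g, hg, by rw [hgs, map_pow]; rfl⟩⟩))
  exact ⟨g', hg', hgs'.symm⟩

end

/-! ### Connected components of spaces with finitely many generic points -/

section

variable {Z : Type*} [TopologicalSpace Z] {E : Set Z}

/-- On a space with finitely many generic points, the functions that are constant along
specializations are locally constant. -/
lemma isLocallyConstant_of_specializes (hE : E.Finite) (h : ∀ x, ∃ y ∈ E, y ⤳ x) {α : Type*}
    {f : Z → α} (hf : ∀ x y, x ⤳ y → f x = f y) : IsLocallyConstant f := by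
  have hclosed : ∀ s : Set α, IsClosed (f ⁻¹' s) := fun s => by
    have h1 : f ⁻¹' s = ⋃ y ∈ E ∩ f ⁻¹' s, closure {y} := by
      ext x
      simp only [Set.mem_iUnion, exists_prop, ← specializes_iff_mem_closure]
      constructor
      · intro hx
        obtain ⟨y, hy, hyx⟩ := h x
        exact ⟨y, ⟨hy, show f y ∈ s from (hf y x hyx).symm ▸ hx⟩, hyx⟩
      · rintro ⟨y, ⟨-, hy⟩, hyx⟩
        exact show f x ∈ s from hf y x hyx ▸ hy
    rw [h1]
    exact (hE.inter_of_left _).isClosed_biUnion fun _ _ => isClosed_closure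
  intro s
  rw [← isClosed_compl_iff, ← Set.preimage_compl]
  exact hclosed _

lemma mk_eq_mk_of_specializes {x y : Z} (h : x ⤳ y) :
    (ConnectedComponents.mk x : ConnectedComponents Z) = ConnectedComponents.mk y :=
  (ConnectedComponents.coe_eq_coe'.2
    ((isPreconnected_singleton (x := x)).closure.subset_connectedComponent
      (subset_closure rfl) (specializes_iff_mem_closure.1 h))).symm

lemma finite_connectedComponents (hE : E.Finite) (h : ∀ x, ∃ y ∈ E, y ⤳ x) :
    Finite (ConnectedComponents Z) := by
  have := (hE.image (ConnectedComponents.mk : Z → ConnectedComponents Z))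
  refine Set.finite_univ_iff.1 (this.subset fun c _ => ?_)
  obtain ⟨x, rfl⟩ := ConnectedComponents.surjective_coe c
  obtain ⟨y, hy, hyx⟩ := h x
  exact ⟨y, hy, mk_eq_mk_of_specializes hyx⟩

end

/-! ### The second cohomology of the conormal sheaf -/

section

variable {F : Finset (Fin 4) → Type} [∀ σ, AddCommGroup (F σ)] [∀ σ, Module ℂ (F σ)]
  {res : ∀ {σ τ : Finset (Fin 4)}, σ ⊆ τ → F σ →ₗ[ℂ] F τ}
  {M : Type*} [AddCommGroup M] [Module ℂ M]

/-- The family of values of a Čech cochain, for compatible maps `v σ : F σ → M`; it is zero in the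
other degrees. -/
def cochainVal (v : ∀ σ, F σ →ₗ[ℂ] M) {q : ℕ} (y : Cochain F q) (σ : Finset (Fin 4)) : M :=
  if h : σ.card = q + 1 then v σ (y ⟨σ, h⟩) else 0

lemma cochainVal_of_card (v : ∀ σ, F σ →ₗ[ℂ] M) {q : ℕ} (y : Cochain F q)
    (σ : {σ : Finset (Fin 4) // σ.card = q + 1}) : cochainVal v y σ = v σ (y σ) :=
  dif_pos σ.2

lemma val_cechDiff (v : ∀ σ, F σ →ₗ[ℂ] M)
    (hv : ∀ {σ τ : Finset (Fin 4)} (h : σ ⊆ τ) (x : F σ), v τ (res h x) = v σ x) {q : ℕ}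
    (y : Cochain F q) (τ : {τ : Finset (Fin 4) // τ.card = q + 1 + 1}) :
    v τ (cechDiff F res q y τ) = cechD (cochainVal v y) τ := by
  rw [cechD_apply, ← Finset.sum_coe_sort]
  simp only [cechDiff, LinearMap.pi_apply, LinearMap.sum_apply, map_sum, LinearMap.smul_apply,
    map_smul, LinearMap.comp_apply, hv, LinearMap.proj_apply]
  refine Finset.sum_congr rfl fun i _ => ?_
  have hc : (τ.1.erase i.1).card = q + 1 := by
    rw [Finset.card_erase_of_mem i.2, τ.2, Nat.add_sub_cancel]
  exact congrArg _ (cochainVal_of_card v y ⟨_, hc⟩).symm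

end

/-- The linear form `g ↦ ∑ xⱼ gⱼ` of the Euler sequence. -/
def eulerForm : (Fin 4 → K) →ₗ[ℂ] K := (formOf X).restrictScalars ℂ

lemma eulerForm_apply (g : Fin 4 → K) : eulerForm g = ∑ j, coord j * g j := formOf_apply X g

lemma mem_eulerSpace {n : ℤ} {σ : Finset (Fin 4)} {g : Fin 4 → K} : g ∈ eulerSpace n σ ↔
    g ∈ Submodule.pi Set.univ (fun _ => twistSpace n σ) ∧ eulerForm g = 0 := by
  rw [eulerForm_apply]
  simp only [Submodule.mem_pi, Set.mem_univ, true_imp_iff]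
  rfl

lemma eulerForm_mem {n : ℤ} {σ : Finset (Fin 4)} {g : Fin 4 → K}
    (hg : g ∈ Submodule.pi Set.univ (fun _ => twistSpace n σ)) :
    eulerForm g ∈ twistSpace (n + 1) σ := by
  rw [eulerForm_apply]
  refine Submodule.sum_mem _ fun j _ => ?_
  rw [mul_comm]
  exact mul_mem_twistSpace (hg j trivial) (coord_mem j σ)

lemma eq_of_cechD_eq_zero {f : Finset (Fin 4) → K}
    (h : ∀ σ : Finset (Fin 4), σ.card = 2 → cechD f σ = 0) (i j : Fin 4) : f {i} = f {j} := by
  rcases lt_trichotomy i j with hij | rfl | hij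
  · have := h {i, j} (Finset.card_pair hij.ne)
    rw [cechD_pair _ hij, sub_eq_zero] at this
    exact this.symm
  · rfl
  · have := h {j, i} (Finset.card_pair hij.ne)
    rwa [cechD_pair _ hij, sub_eq_zero] at this

/-- `H¹(Ω¹(n + 1)) = 0` for `n < -1`. -/
lemma cechExact_eulerSpace_one {n : ℤ} (hn : n < -1) : CechExact (eulerSpace n) 1 := by
  intro f hf hcl
  obtain ⟨g, hg, hgf⟩ := (cechExact_twistSpace n one_ne_zero one_le_two).pi (Fin 4) f
    (fun σ hσ => (mem_eulerSpace.1 (hf σ hσ)).1) hcl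
  refine ⟨g, fun σ hσ => mem_eulerSpace.2 ⟨hg σ hσ, ?_⟩, hgf⟩
  have h1 := eq_of_cechD_eq_zero (f := fun σ => eulerForm (g σ)) fun σ hσ => by
    rw [cechD_comp, hgf σ hσ]
    exact (mem_eulerSpace.1 (hf σ hσ)).2
  obtain ⟨i, rfl⟩ := Finset.card_eq_one.1 hσ
  refine eq_zero_of_mem_twistSpace (n := n + 1) (by omega) fun j => ?_
  rw [h1 i j]
  exact eulerForm_mem (hg {j} (Finset.card_singleton j))

/-- `H²(Ω¹(n + 1)) = 0`. -/
lemma cechExact_eulerSpace_two (n : ℤ) : CechExact (eulerSpace n) 2 := by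
  intro f hf hcl
  obtain ⟨g, hg, hgf⟩ := (cechExact_twistSpace n two_ne_zero le_rfl).pi (Fin 4) f
    (fun σ hσ => (mem_eulerSpace.1 (hf σ hσ)).1) hcl
  obtain ⟨h, hh, hhg⟩ := cechExact_twistSpace (n + 1) one_ne_zero one_le_two
    (fun σ => eulerForm (g σ)) (fun σ hσ => eulerForm_mem (hg σ hσ)) fun τ hτ => by
      rw [cechD_comp, hgf τ hτ]
      exact (mem_eulerSpace.1 (hf τ hτ)).2
  -- on each chart, `h` lifts along the Euler form
  let h' : Finset (Fin 4) → Fin 4 → K := fun σ =>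
    if hσ : σ.Nonempty then Pi.single (σ.min' hσ) (h σ * (coord (σ.min' hσ))⁻¹) else 0
  have hE : ∀ σ : Finset (Fin 4), σ.card = 1 → eulerForm (h' σ) = h σ := fun σ hσ => by
    have hσ' : σ.Nonempty := Finset.card_pos.1 (by omega)
    simp only [h', dif_pos hσ', eulerForm_apply]
    rw [Finset.sum_eq_single (σ.min' hσ') (fun j _ hj => by rw [Pi.single_eq_of_ne hj, mul_zero])
      (fun hne => absurd (Finset.mem_univ _) hne), Pi.single_eq_same, mul_comm,
      inv_mul_cancel_right₀ (coord_ne_zero _)]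
  have hmem : IsCochain (fun σ => Submodule.pi Set.univ fun _ : Fin 4 => twistSpace n σ) 1 h' := by
    intro σ hσ j _
    have hσ' : σ.Nonempty := Finset.card_pos.1 (by omega)
    simp only [h', dif_pos hσ']
    rcases eq_or_ne j (σ.min' hσ') with rfl | hj
    · rw [Pi.single_eq_same]
      have h1 := mul_mem_twistSpace (hh σ hσ) (coord_zpow_mem (σ.min'_mem hσ') (-1))
      rwa [add_neg_cancel_right, zpow_neg_one] at h1
    · rw [Pi.single_eq_of_ne hj]
      exact Submodule.zero_mem _
  have hmono : ∀ σ τ : Finset (Fin 4), σ.Nonempty → σ ⊆ τ →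
      Submodule.pi Set.univ (fun _ : Fin 4 => twistSpace n σ) ≤
        Submodule.pi Set.univ fun _ : Fin 4 => twistSpace n τ :=
    fun σ τ _ hστ => Submodule.pi_mono fun _ _ => twistSpace_mono hστ
  have hmem' := hmem.cechD hmono one_ne_zero
  refine ⟨g - cechD h', fun σ hσ => mem_eulerSpace.2 ⟨Submodule.sub_mem _ (hg σ hσ)
    (hmem' σ hσ), ?_⟩, fun σ hσ => ?_⟩
  · rw [Pi.sub_apply, map_sub, ← cechD_comp, cechD_congr hE hσ, hhg σ hσ, sub_self]
  · rw [map_sub, cechD_cechD, sub_zero, hgf σ hσ]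

section

variable {d : ℕ} {P : Fin 4 → S}

lemma formOf_mem (hPd : ∀ j, P j ∈ deg d) {σ : Finset (Fin 4)} {g : Fin 4 → K}
    (hg : g ∈ eulerSpace (-d) σ) : formOf P g ∈ twistSpace 0 σ := by
  rw [formOf_apply]
  refine Submodule.sum_mem _ fun j _ => ?_
  have h := mul_mem_twistSpace (algebraMap_mem_twistSpace_of_mem_deg (hPd j) σ) (hg.1 j)
  rwa [add_neg_cancel] at h

/-- The families of functions on the charts which, up to a constant, belong to the ideal of the
singular scheme. -/
def constFunctions (P : Fin 4 → S) (d : ℕ) : Submodule ℂ (Fin 4 → K) where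
  carrier := {a | ∃ c : ℂ, ∀ i, a i - algebraMap ℂ K c ∈ singSpace P d {i}}
  add_mem' := by
    rintro a b ⟨c, hc⟩ ⟨c', hc'⟩
    refine ⟨c + c', fun i => ?_⟩
    rw [Pi.add_apply, map_add, add_sub_add_comm]
    exact Submodule.add_mem _ (hc i) (hc' i)
  zero_mem' := ⟨0, fun i => by
    rw [Pi.zero_apply, map_zero, sub_zero]; exact Submodule.zero_mem _⟩
  smul_mem' := by
    rintro c a ⟨c', hc⟩
    refine ⟨c * c', fun i => ?_⟩
    rw [Pi.smul_apply, map_mul, ← Algebra.smul_def, ← smul_sub]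
    exact Submodule.smul_mem _ c (hc i)

/-- The family on all index sets which on the singletons is the given one. -/
def ofCharts : (Fin 4 → K) →ₗ[ℂ] (Finset (Fin 4) → K) where
  toFun a σ := ∑ i ∈ σ, a i
  map_add' a b := by funext σ; simp [Finset.sum_add_distrib]
  map_smul' c a := by funext σ; simp [Finset.smul_sum]

@[simp] lemma ofCharts_singleton (a : Fin 4 → K) (i : Fin 4) : ofCharts a {i} = a i :=
  Finset.sum_singleton _ _

lemma cechD_ofCharts (a : Fin 4 → K) {i j : Fin 4} (h : i < j) :
    cechD (ofCharts a) {i, j} = a j - a i := by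
  rw [cechD_pair _ h, ofCharts_singleton, ofCharts_singleton]

variable {F : Finset (Fin 4) → Type} [∀ σ, AddCommGroup (F σ)] [∀ σ, Module ℂ (F σ)]
  {res : ∀ {σ τ : Finset (Fin 4)}, σ ⊆ τ → F σ →ₗ[ℂ] F τ}
  (v : ∀ σ, F σ →ₗ[ℂ] (Fin 4 → K))

/-- The graph of the connecting map from the global functions on the singular scheme to the second
cohomology of the conormal sheaf: the triples `(a, b, z)` where the cochain `b` lifts the coboundary
of `a` to the cotangent sheaf, and `z` is the coboundary of `b`. -/
def connecting (P : Fin 4 → S) (d : ℕ) :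
    Submodule ℂ (globalFunctions P d × (Finset (Fin 4) → Fin 4 → K) × Cochain F 2) where
  carrier := {t | IsCochain (eulerSpace (-d)) 2 t.2.1 ∧
    (∀ σ : Finset (Fin 4), σ.card = 2 → formOf P (t.2.1 σ) = cechD (ofCharts t.1.1) σ) ∧
    ∀ τ : {τ : Finset (Fin 4) // τ.card = 3}, v τ (t.2.2 τ) = cechD t.2.1 τ}
  add_mem' := by
    rintro t t' ⟨h1, h2, h3⟩ ⟨h1', h2', h3'⟩
    refine ⟨fun σ hσ => Submodule.add_mem _ (h1 σ hσ) (h1' σ hσ), fun σ hσ => ?_, fun τ => ?_⟩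
    · change formOf P (t.2.1 σ + t'.2.1 σ) = cechD (ofCharts (t.1.1 + t'.1.1)) σ
      rw [map_add, map_add, map_add, h2 σ hσ, h2' σ hσ, Pi.add_apply]
    · change v τ (t.2.2 τ + t'.2.2 τ) = cechD (t.2.1 + t'.2.1) τ
      rw [map_add, map_add, h3, h3', Pi.add_apply]
  zero_mem' := by
    refine ⟨fun σ hσ => Submodule.zero_mem _, fun σ hσ => ?_, fun τ => ?_⟩
    · change formOf P 0 = cechD (ofCharts 0) σ
      rw [map_zero, map_zero, map_zero, Pi.zero_apply]
    · change v τ 0 = cechD 0 τ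
      rw [map_zero, map_zero, Pi.zero_apply]
  smul_mem' := by
    rintro c t ⟨h1, h2, h3⟩
    refine ⟨fun σ hσ => Submodule.smul_mem _ c (h1 σ hσ), fun σ hσ => ?_, fun τ => ?_⟩
    · change formOf P (c • t.2.1 σ) = cechD (ofCharts (c • t.1.1)) σ
      rw [ofCharts.map_smul, cechD.map_smul, Pi.smul_apply, ← h2 σ hσ]
      exact ((formOf P).restrictScalars ℂ).map_smul c _
    · change v τ (c • t.2.2 τ) = cechD (c • t.2.1) τ
      rw [map_smul, map_smul, h3, Pi.smul_apply]

variable {v}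

lemma cechD_formOf (P : Fin 4 → S) (f : Finset (Fin 4) → Fin 4 → K) (τ : Finset (Fin 4)) :
    cechD (fun σ => formOf P (f σ)) τ = formOf P (cechD f τ) :=
  cechD_comp ((formOf P).restrictScalars ℂ) f τ

/-- The families `(v σ)` identify the `F σ` with the sections of the conormal sheaf. -/
structure IsConormalVal (P : Fin 4 → S) (d : ℕ)
    (res : ∀ {σ τ : Finset (Fin 4)}, σ ⊆ τ → F σ →ₗ[ℂ] F τ)
    (v : ∀ σ, F σ →ₗ[ℂ] (Fin 4 → K)) : Prop where
  compat : ∀ {σ τ : Finset (Fin 4)} (h : σ ⊆ τ) (x : F σ), v τ (res h x) = v σ x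
  injective : ∀ σ : Finset (Fin 4), σ.Nonempty → Function.Injective (v σ)
  mem_iff : ∀ σ : Finset (Fin 4), σ.Nonempty → ∀ g,
    g ∈ conormalSpace P (-d) σ ↔ ∃ x, v σ x = g

variable (hv : IsConormalVal P d res v)
include hv

lemma exists_mem_connecting (a : globalFunctions P d) :
    ∃ b z, (a, b, z) ∈ connecting v P d := by
  have h1 : ∀ σ : Finset (Fin 4), ∃ g : Fin 4 → K, σ.card = 2 →
      g ∈ eulerSpace (-d) σ ∧ formOf P g = cechD (ofCharts a.1) σ := by
    intro σ
    by_cases hσ : σ.card = 2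
    · obtain ⟨i, j, hij, rfl⟩ := exists_lt_of_card_eq_two σ hσ
      obtain ⟨g, hg, hga⟩ := mem_singSpace.1 (a.2.2 i j)
      exact ⟨g, fun _ => ⟨hg, by rw [hga, cechD_ofCharts _ hij]⟩⟩
    · exact ⟨0, fun h => absurd h hσ⟩
  choose b hb using h1
  have hb1 : IsCochain (eulerSpace (-d)) 2 b := fun σ hσ => (hb σ hσ).1
  have h2 : ∀ τ : {τ : Finset (Fin 4) // τ.card = 2 + 1}, ∃ x, v τ x = cechD b τ := by
    rintro ⟨τ, hτ⟩
    refine (hv.mem_iff τ (Finset.card_pos.1 (by omega)) _).1 (mem_conormalSpace.2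
      ⟨hb1.cechD (fun _ _ _ => eulerSpace_mono) two_ne_zero τ hτ, ?_⟩)
    rw [← cechD_formOf, cechD_congr (fun σ hσ => (hb σ hσ).2) hτ, cechD_cechD, Pi.zero_apply]
  choose z hz using h2
  exact ⟨b, z, hb1, fun σ hσ => (hb σ hσ).2, hz⟩

lemma cechDiff_of_mem_connecting
    {t : globalFunctions P d × (Finset (Fin 4) → Fin 4 → K) × Cochain F 2}
    (ht : t ∈ connecting v P d) : cechDiff F res 2 t.2.2 = 0 := by
  funext τ
  refine hv.injective τ.1 (Finset.card_pos.1 (by rw [τ.2]; omega)) ?_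
  rw [val_cechDiff v hv.compat, cechD_congr (n := 3) (g := cechD t.2.1) (fun σ hσ => ?_) τ.2,
    cechD_cechD]
  · exact (map_zero _).symm
  · exact (cochainVal_of_card v t.2.2 ⟨σ, hσ⟩).trans (ht.2.2 ⟨σ, hσ⟩)

lemma exists_mem_connecting_of_cocycle (hPd : ∀ j, P j ∈ deg d) (z : Cochain F 2)
    (hz : cechDiff F res 2 z = 0) : ∃ a b, (a, b, z) ∈ connecting v P d := by
  have hmem : ∀ σ : Finset (Fin 4), σ.card = 3 → cochainVal v z σ ∈ conormalSpace P (-d) σ := by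
    intro σ hσ
    exact (hv.mem_iff σ (Finset.card_pos.1 (by omega)) _).2
      ⟨z ⟨σ, hσ⟩, (cochainVal_of_card v z ⟨σ, hσ⟩).symm⟩
  obtain ⟨b, hb, hbz⟩ := cechExact_eulerSpace_two (-d) (cochainVal v z)
    (fun σ hσ => (hmem σ hσ).1) fun τ hτ => by
      rw [← val_cechDiff v hv.compat z ⟨τ, hτ⟩, hz]
      exact map_zero _
  obtain ⟨α, hα, hαb⟩ := cechExact_twistSpace 0 one_ne_zero one_le_two
    (fun σ => formOf P (b σ)) (fun σ hσ => formOf_mem hPd (hb σ hσ)) fun τ hτ => by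
      rw [cechD_formOf, hbz τ hτ]
      exact (mem_conormalSpace.1 (hmem τ hτ)).2
  have hlt : ∀ i j, i < j → α {j} - α {i} ∈ singSpace P d {i, j} := fun i j hij => by
    rw [← cechD_pair α hij, hαb _ (Finset.card_pair hij.ne)]
    exact ⟨_, hb _ (Finset.card_pair hij.ne), rfl⟩
  refine ⟨⟨fun i => α {i}, fun i => hα {i} (Finset.card_singleton i), fun i j => ?_⟩, b, hb,
    fun σ hσ => ?_, fun τ => ?_⟩
  · rcases lt_trichotomy i j with hij | rfl | hij
    · exact hlt i j hij
    · rw [sub_self]; exact Submodule.zero_mem _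
    · rw [← neg_sub, Finset.pair_comm]
      exact Submodule.neg_mem _ (hlt j i hij)
  · obtain ⟨i, j, hij, rfl⟩ := exists_lt_of_card_eq_two σ hσ
    rw [cechD_ofCharts _ hij, ← hαb _ hσ, cechD_pair _ hij]
  · rw [hbz τ τ.2, cochainVal_of_card]

lemma exists_cechDiff_eq_iff (hPd : ∀ j, P j ∈ deg d) (hd : 2 ≤ d)
    {t : globalFunctions P d × (Finset (Fin 4) → Fin 4 → K) × Cochain F 2}
    (ht : t ∈ connecting v P d) :
    (∃ y, cechDiff F res 1 y = t.2.2) ↔ t.1.1 ∈ constFunctions P d := by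
  obtain ⟨hb, hbt, hz⟩ := ht
  constructor
  · rintro ⟨y, hy⟩
    have hmem : ∀ σ : Finset (Fin 4), σ.card = 2 →
        cochainVal v y σ ∈ conormalSpace P (-d) σ := by
      intro σ hσ
      exact (hv.mem_iff σ (Finset.card_pos.1 (by omega)) _).2
        ⟨y ⟨σ, hσ⟩, (cochainVal_of_card v y ⟨σ, hσ⟩).symm⟩
    obtain ⟨w, hw, hwb⟩ := cechExact_eulerSpace_one (n := -d) (by omega) (t.2.1 - cochainVal v y)
      (fun σ hσ => Submodule.sub_mem _ (hb σ hσ) (hmem σ hσ).1) fun τ hτ => by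
        rw [map_sub, Pi.sub_apply, ← hz ⟨τ, hτ⟩, ← hy, val_cechDiff v hv.compat, sub_self]
    -- `a` and the function defined by `w` have the same coboundary
    have h1 := eq_of_cechD_eq_zero (f := ofCharts t.1.1 - fun σ => formOf P (w σ)) fun σ hσ => by
      rw [map_sub, Pi.sub_apply, cechD_formOf, hwb σ hσ, Pi.sub_apply, map_sub, hbt σ hσ,
        (mem_conormalSpace.1 (hmem σ hσ)).2, sub_zero, sub_self]
    have hw1 : ∀ i, w {i} ∈ eulerSpace (-d) {i} := fun i => hw _ (Finset.card_singleton i)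
    obtain ⟨c, hc⟩ := exists_const_of_mem_twistSpace
      (s := (ofCharts t.1.1 - fun σ => formOf P (w σ)) {0}) fun i => by
        rw [h1 0 i, Pi.sub_apply, ofCharts_singleton]
        exact Submodule.sub_mem _ (t.1.2.1 i) (formOf_mem hPd (hw1 i))
    refine ⟨c, fun i => ⟨w {i}, hw1 i, ?_⟩⟩
    rw [← hc, h1 0 i, Pi.sub_apply, ofCharts_singleton, sub_sub_cancel]
    rfl
  · rintro ⟨c, hc⟩
    choose w hw hwc using fun i => mem_singSpace.1 (hc i)
    let ω : Finset (Fin 4) → Fin 4 → K := fun σ => ∑ i ∈ σ, w i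
    have hω1 : ∀ i, ω {i} = w i := fun i => Finset.sum_singleton _ _
    have hω : IsCochain (eulerSpace (-d)) 1 ω := fun σ hσ => by
      obtain ⟨i, rfl⟩ := Finset.card_eq_one.1 hσ
      rw [hω1]
      exact hw i
    have hω2 := hω.cechD (fun _ _ _ => eulerSpace_mono) one_ne_zero
    have h2 : ∀ σ : {σ : Finset (Fin 4) // σ.card = 1 + 1},
        ∃ x, v σ x = t.2.1 σ - cechD ω σ := by
      rintro ⟨σ, hσ⟩
      refine (hv.mem_iff σ (Finset.card_pos.1 (by omega)) _).1 (mem_conormalSpace.2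
        ⟨Submodule.sub_mem _ (hb σ hσ) (hω2 σ hσ), ?_⟩)
      rw [map_sub, hbt σ hσ]
      obtain ⟨i, j, hij, rfl⟩ := exists_lt_of_card_eq_two σ hσ
      rw [cechD_ofCharts _ hij, cechD_pair _ hij, hω1, hω1, map_sub, hwc, hwc]
      ring
    choose y hy using h2
    refine ⟨y, funext fun τ => hv.injective τ.1 (Finset.card_pos.1 (by rw [τ.2]; omega)) ?_⟩
    rw [val_cechDiff v hv.compat, hz, cechD_congr (n := 2) (g := t.2.1 - cechD ω)
      (fun σ hσ => (cochainVal_of_card v y ⟨σ, hσ⟩).trans (hy ⟨σ, hσ⟩)) τ.2, map_sub, cechD_cechD,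
      sub_zero]

omit hv in
lemma nonempty_equiv_of_ker_eq {A B C : Type*} [AddCommGroup A] [AddCommGroup B] [AddCommGroup C]
    [Module ℂ A] [Module ℂ B] [Module ℂ C] (f : A →ₗ[ℂ] B) (g : A →ₗ[ℂ] C)
    (hf : Function.Surjective f) (hg : Function.Surjective g)
    (h : LinearMap.ker f = LinearMap.ker g) : Nonempty (B ≃ₗ[ℂ] C) :=
  ⟨(f.quotKerEquivOfSurjective hf).symm.trans
    ((Submodule.quotEquivOfEq _ _ h).trans (g.quotKerEquivOfSurjective hg))⟩

/-- The second cohomology of the conormal sheaf is the space of global functions on the singular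
scheme modulo the constants. -/
theorem nonempty_cechH2_equiv (hPd : ∀ j, P j ∈ deg d) (hd : 2 ≤ d) :
    Nonempty (CechH2 F res ≃ₗ[ℂ]
      (globalFunctions P d ⧸ (constFunctions P d).submoduleOf (globalFunctions P d))) := by
  let T := connecting v P d
  let p₁ : T →ₗ[ℂ] globalFunctions P d ⧸ (constFunctions P d).submoduleOf (globalFunctions P d) :=
    (Submodule.mkQ _).comp ((LinearMap.fst ℂ _ _).comp T.subtype)
  let c : T →ₗ[ℂ] LinearMap.ker (cechDiff F res 2) :=
    LinearMap.codRestrict _ ((LinearMap.snd ℂ _ _).comp ((LinearMap.snd ℂ _ _).comp T.subtype))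
      fun t => LinearMap.mem_ker.2 (cechDiff_of_mem_connecting hv t.2)
  let p₂ : T →ₗ[ℂ] CechH2 F res := (Submodule.mkQ _).comp c
  have h₁ : Function.Surjective p₁ := by
    refine (Submodule.mkQ_surjective _).comp fun a => ?_
    obtain ⟨b, z, h⟩ := exists_mem_connecting hv a
    exact ⟨⟨_, h⟩, rfl⟩
  have h₂ : Function.Surjective p₂ := by
    refine (Submodule.mkQ_surjective _).comp fun z => ?_
    obtain ⟨a, b, h⟩ := exists_mem_connecting_of_cocycle hv hPd z.1 (LinearMap.mem_ker.1 z.2)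
    exact ⟨⟨_, h⟩, rfl⟩
  have hker : LinearMap.ker p₂ = LinearMap.ker p₁ := by
    ext t
    rw [LinearMap.mem_ker, LinearMap.mem_ker]
    change Submodule.Quotient.mk (c t) = 0 ↔ Submodule.Quotient.mk t.1.1 = 0
    rw [Submodule.Quotient.mk_eq_zero, Submodule.Quotient.mk_eq_zero]
    exact exists_cechDiff_eq_iff hv hPd hd t.2
  exact nonempty_equiv_of_ker_eq (A := connecting v P d) p₂ p₁ h₂ h₁ hker

omit hv in
/-- The gradients of differential forms identify the sections of the twisted conormal sheaf with
vectors of rational functions. -/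
lemma TwistedField.isConormalVal {φ : TwistedField ((d : ℤ) - 1)}
    (hP : ∀ σ : Finset (Fin 4), σ.Nonempty → ∀ ω : Ω[Reg (stdOpen σ)⁄ℂ],
      twistVal _ _ (φ.dual (stdOpen σ) ω) = formOf P (grad (stdOpen σ) ω)) :
    IsConormalVal P d (F := fun σ => φ.ConormalTwist (1 - d) (stdOpen σ))
      (fun h => φ.resConormalTwist (1 - d) (stdOpen_anti h))
      fun σ => (φ.conormalVal (1 - d) (stdOpen σ)).restrictScalars ℂ where
  compat h x := φ.conormalVal_res _ (stdOpen_anti h) x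
  injective σ hσ := φ.conormalVal_injective _ hσ
  mem_iff σ hσ g := by
    have h1 : (1 - d - 1 : ℤ) = -d := by ring
    constructor
    · intro hg
      rw [← h1] at hg
      exact φ.exists_conormalVal_eq _ hP hσ hg
    · rintro ⟨x, rfl⟩
      rw [← h1]
      exact φ.conormalVal_mem _ hP hσ x

end

/-! ### Global functions and connected components -/

section

variable {d : ℕ} {P : Fin 4 → S}

lemma eq_of_vanAt {p : Ideal S} [p.IsPrime] {s : K} {c c' : ℂ}
    (h : VanAt p (s - algebraMap ℂ K c)) (h' : VanAt p (s - algebraMap ℂ K c')) : c = c' := by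
  have h1 := h'.sub h
  rw [sub_sub_sub_cancel_left, ← map_sub] at h1
  exact sub_eq_zero.1 h1.const_eq_zero

open Classical in
/-- The value of a global function at a point of the singular scheme. -/
def value (a : Fin 4 → K) (x : P3) : ℂ :=
  if h : ∃ c : ℂ, ∀ i, x ∈ chart i → VanAt (pt x) (a i - algebraMap ℂ K c) then h.choose else 0

lemma vanAt_sub_value {a : Fin 4 → K} (ha : a ∈ globalFunctions P d) {x : P3}
    (hx : minorIdeal P ≤ pt x) {i : Fin 4} (hi : x ∈ chart i) :
    VanAt (pt x) (a i - algebraMap ℂ K (value a x)) := by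
  have h := exists_value ha hx
  rw [value, dif_pos h]
  exact h.choose_spec i hi

lemma value_eq {a : Fin 4 → K} (ha : a ∈ globalFunctions P d) {x : P3}
    (hx : minorIdeal P ≤ pt x) {i : Fin 4} (hi : x ∈ chart i) {c : ℂ}
    (h : VanAt (pt x) (a i - algebraMap ℂ K c)) : value a x = c :=
  eq_of_vanAt (vanAt_sub_value ha hx hi) h

lemma value_eq_of_le {a : Fin 4 → K} (ha : a ∈ globalFunctions P d) {x y : P3}
    (hx : minorIdeal P ≤ pt x) (hxy : pt x ≤ pt y) : value a x = value a y := by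
  obtain ⟨i, hi⟩ := exists_mem_chart y
  have hix : x ∈ chart i := mem_chart.2 fun h => mem_chart.1 hi (hxy h)
  refine (value_eq ha (hx.trans hxy) hi ((vanAt_sub_value ha hx hix).mono (n := 0)
    (Finset.singleton_nonempty i) hxy (fun j hj => ?_) ?_)).symm
  · rw [Finset.mem_singleton.1 hj]
    exact mem_chart.1 hi
  · exact Submodule.sub_mem _ (ha.1 i) ((regularSubalgebra (chart i)).algebraMap_mem _)

/-- The set of points of the singular scheme. -/
def zeroSet (P : Fin 4 → S) : Set P3 := {x | minorIdeal P ≤ pt x}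

lemma isClosed_zeroSet (P : Fin 4 → S) : IsClosed (zeroSet P) :=
  ProjectiveSpectrum.isClosed_zeroLocus deg (minorIdeal P : Set S)

lemma pt_le_of_specializes {x y : zeroSet P} (h : x ⤳ y) : pt x.1 ≤ pt y.1 :=
  (ProjectiveSpectrum.le_iff_mem_closure deg x.1 y.1).2
    (specializes_iff_mem_closure.1 (h.map continuous_subtype_val))

lemma exists_finite_specializes (hPd : ∀ j, P j ∈ deg d) :
    ∃ E : Set (zeroSet P), E.Finite ∧ ∀ x, ∃ y ∈ E, y ⤳ x := by
  obtain ⟨E, hE, hEZ, hEx⟩ := exists_finite_generic hPd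
  refine ⟨Subtype.val ⁻¹' E, hE.preimage Subtype.val_injective.injOn, fun x => ?_⟩
  obtain ⟨y, hy, hyx⟩ := hEx x.1 x.2
  refine ⟨⟨y, hEZ y hy⟩, hy, (subtype_specializes_iff _ _).2 ?_⟩
  exact specializes_iff_mem_closure.2 ((ProjectiveSpectrum.le_iff_mem_closure deg y x.1).1 hyx)

lemma value_eq_of_mk_eq (hPd : ∀ j, P j ∈ deg d) {a : Fin 4 → K} (ha : a ∈ globalFunctions P d)
    {x y : zeroSet P}
    (h : (ConnectedComponents.mk x : ConnectedComponents (zeroSet P)) = ConnectedComponents.mk y) :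
    value a x.1 = value a y.1 := by
  obtain ⟨E, hE, hEx⟩ := exists_finite_specializes hPd
  have h1 : IsLocallyConstant fun z : zeroSet P => value a z.1 :=
    isLocallyConstant_of_specializes hE hEx fun x y hxy =>
      value_eq_of_le ha x.2 (pt_le_of_specializes hxy)
  exact h1.apply_eq_of_isPreconnected isPreconnected_connectedComponent
    (ConnectedComponents.coe_eq_coe'.1 h) mem_connectedComponent

/-- The values of a global function on the connected components. -/
def componentValues (P : Fin 4 → S) (d : ℕ) :
    globalFunctions P d →ₗ[ℂ] (ConnectedComponents (zeroSet P) → ℂ) where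
  toFun a c := value a.1 (Function.surjInv ConnectedComponents.surjective_coe c).1
  map_add' a b := by
    funext c
    rw [Pi.add_apply]
    generalize Function.surjInv ConnectedComponents.surjective_coe c = x
    obtain ⟨i, hi⟩ := exists_mem_chart x.1
    refine value_eq (a + b).2 x.2 hi ?_
    have h := (vanAt_sub_value a.2 x.2 hi).add (vanAt_sub_value b.2 x.2 hi)
    rw [sub_add_sub_comm, ← map_add] at h
    exact h
  map_smul' t a := by
    funext c
    rw [Pi.smul_apply]
    generalize Function.surjInv ConnectedComponents.surjective_coe c = x
    obtain ⟨i, hi⟩ := exists_mem_chart x.1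
    refine value_eq (t • a).2 x.2 hi ?_
    have h := (vanAt_sub_value a.2 x.2 hi).mul (regAt_const t)
    rw [sub_mul, ← map_mul, mul_comm (a.1 i), ← Algebra.smul_def, mul_comm _ t] at h
    exact h

lemma componentValues_mk (hPd : ∀ j, P j ∈ deg d) (a : globalFunctions P d) (x : zeroSet P) :
    componentValues P d a (ConnectedComponents.mk x) = value a.1 x.1 :=
  value_eq_of_mk_eq hPd a.2 (Function.surjInv_eq _ _)

lemma componentValues_surjective (hPd : ∀ j, P j ∈ deg d) :
    Function.Surjective (componentValues P d) := by
  classical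
  obtain ⟨E, hE, hEx⟩ := exists_finite_specializes hPd
  have hfin : Finite (ConnectedComponents (zeroSet P)) := finite_connectedComponents hE hEx
  have := Fintype.ofFinite (ConnectedComponents (zeroSet P))
  have hloc : IsLocallyConstant (ConnectedComponents.mk : zeroSet P → _) :=
    isLocallyConstant_of_specializes hE hEx fun _ _ => mk_eq_mk_of_specializes
  -- it suffices to find the characteristic functions of the connected components
  have hsingle : ∀ c, Pi.single c 1 ∈ LinearMap.range (componentValues P d) := by
    intro c
    let W : Set (zeroSet P) := ConnectedComponents.mk ⁻¹' {c}
    have hW : IsClopen W := ⟨hloc.isClosed_fiber c, hloc.isOpen_fiber c⟩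
    obtain ⟨a, ha, h0, h1⟩ := exists_separating hPd (T₁ := Subtype.val '' Wᶜ)
      (T₂ := Subtype.val '' W)
      ((isClosed_zeroSet P).isClosedEmbedding_subtypeVal.isClosedMap _ hW.compl.1)
      ((isClosed_zeroSet P).isClosedEmbedding_subtypeVal.isClosedMap _ hW.1)
      ((Set.disjoint_image_iff Subtype.val_injective).2 disjoint_compl_left) fun x hx => by
        by_cases hxW : (⟨x, hx⟩ : zeroSet P) ∈ W
        · exact Or.inr ⟨_, hxW, rfl⟩
        · exact Or.inl ⟨_, hxW, rfl⟩
    refine ⟨⟨a, ha⟩, funext fun e => ?_⟩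
    obtain ⟨x, rfl⟩ := ConnectedComponents.surjective_coe e
    obtain ⟨i, hi⟩ := exists_mem_chart x.1
    rw [componentValues_mk hPd]
    by_cases hxW : x ∈ W
    · rw [show ConnectedComponents.mk x = c from hxW, Pi.single_eq_same]
      exact value_eq ha x.2 hi (by rw [map_one]; exact h1 x.1 ⟨x, hxW, rfl⟩ i hi)
    · rw [Pi.single_eq_of_ne (show ConnectedComponents.mk x ≠ c from hxW)]
      exact value_eq ha x.2 hi (by rw [map_zero, sub_zero]; exact h0 x.1 ⟨x, hxW, rfl⟩ i hi)
  intro f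
  rw [← LinearMap.mem_range, pi_eq_sum_univ f]
  refine Submodule.sum_mem _ fun c _ => Submodule.smul_mem _ _ ?_
  convert hsingle c using 1
  funext e
  rw [Pi.single_apply]
  simp only [eq_comm]

end

section

variable {d : ℕ} {P : Fin 4 → S} {φ : TwistedField ((d : ℤ) - 1)} (hPd : ∀ j, P j ∈ deg d)
  (hd : 2 ≤ d)
include hPd hd

/-- If all the global functions on the singular scheme are constant, then it is connected. -/
lemma isConnected_zeroSet (h : globalFunctions P d ≤ constFunctions P d) :
    IsConnected (zeroSet P) := by
  obtain ⟨x₀, hx₀⟩ := exists_minorIdeal_le hPd hd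
  refine ⟨⟨x₀, hx₀⟩, isPreconnected_closed_iff.2 fun t t' ht ht' hZ ⟨x, hxZ, hx⟩ ⟨y, hyZ, hy⟩ => ?_⟩
  by_contra hcon
  obtain ⟨a, ha, h0, h1⟩ := exists_separating hPd ((isClosed_zeroSet P).inter ht)
    ((isClosed_zeroSet P).inter ht') (Set.disjoint_left.2 fun z hz hz' =>
      hcon ⟨z, hz.1, hz.2, hz'.2⟩) fun z hz => (hZ hz).imp (⟨hz, ·⟩) (⟨hz, ·⟩)
  obtain ⟨c, hc⟩ := h ha
  have hval : ∀ z ∈ zeroSet P, value a z = c := fun z hz => by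
    obtain ⟨i, hi⟩ := exists_mem_chart z
    exact value_eq ha hz hi (vanAt_of_mem_singSpace (Finset.singleton_nonempty i) (hc i) hi hz)
  obtain ⟨i, hi⟩ := exists_mem_chart x
  obtain ⟨j, hj⟩ := exists_mem_chart y
  have hx0 : value a x = 0 := value_eq ha hxZ hi (by
    rw [map_zero, sub_zero]; exact h0 x ⟨hxZ, hx⟩ i hi)
  have hy1 : value a y = 1 := value_eq ha hyZ hj (by
    rw [map_one]; exact h1 y ⟨hyZ, hy⟩ j hj)
  rw [hval x hxZ] at hx0
  rw [hval y hyZ, hx0] at hy1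
  exact zero_ne_one hy1

/-- If `sing₁` is reduced, then the space of global functions modulo the constants has one dimension
less than the number of connected components. -/
lemma rank_globalFunctions_quotient (hφ : φ.ConormalLocallyFree)
    (hP : ∀ σ : Finset (Fin 4), σ.Nonempty → ∀ ω : Ω[Reg (stdOpen σ)⁄ℂ],
      twistVal _ _ (φ.dual (stdOpen σ) ω) = formOf P (grad (stdOpen σ) ω))
    (hred : φ.SingCurveReduced) :
    Module.rank ℂ (globalFunctions P d ⧸ (constFunctions P d).submoduleOf (globalFunctions P d)) <
        Cardinal.aleph0 ∧
      Cardinal.mk (ConnectedComponents (zeroSet P)) = Module.rank ℂ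
        (globalFunctions P d ⧸ (constFunctions P d).submoduleOf (globalFunctions P d)) + 1 := by
  obtain ⟨E, hE, hEx⟩ := exists_finite_specializes hPd
  have hfin : Finite (ConnectedComponents (zeroSet P)) := finite_connectedComponents hE hEx
  have := Fintype.ofFinite (ConnectedComponents (zeroSet P))
  let C := ConnectedComponents (zeroSet P)
  obtain ⟨x₀, hx₀⟩ := exists_minorIdeal_le hPd hd
  have : Nonempty C := ⟨ConnectedComponents.mk ⟨x₀, hx₀⟩⟩
  let V : Submodule ℂ (C → ℂ) := Submodule.span ℂ {1}
  have hker : LinearMap.ker (V.mkQ.comp (componentValues P d)) =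
      LinearMap.ker ((constFunctions P d).submoduleOf (globalFunctions P d)).mkQ := by
    ext a
    rw [Submodule.ker_mkQ, LinearMap.mem_ker, LinearMap.comp_apply, Submodule.mkQ_apply,
      Submodule.Quotient.mk_eq_zero, Submodule.mem_span_singleton]
    constructor
    · rintro ⟨c, hc⟩
      refine ⟨c, fun i => φ.mem_singSpace_of_vanAt hPd hφ hP hred (Submodule.sub_mem _ (a.2.1 i)
        ((regularSubalgebra (chart i)).algebraMap_mem _)) fun x hx hi => ?_⟩
      have h1 := congrFun hc (ConnectedComponents.mk ⟨x, hx⟩)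
      rw [componentValues_mk hPd, Pi.smul_apply, Pi.one_apply, smul_eq_mul, mul_one] at h1
      rw [h1]
      exact vanAt_sub_value a.2 hx hi
    · rintro ⟨c, hc⟩
      refine ⟨c, funext fun e => ?_⟩
      obtain ⟨x, rfl⟩ := ConnectedComponents.surjective_coe e
      obtain ⟨i, hi⟩ := exists_mem_chart x.1
      rw [componentValues_mk hPd, Pi.smul_apply, Pi.one_apply, smul_eq_mul, mul_one]
      exact (value_eq a.2 x.2 hi
        (vanAt_of_mem_singSpace (Finset.singleton_nonempty i) (hc i) hi x.2)).symm
  obtain ⟨e⟩ := nonempty_equiv_of_ker_eq (A := globalFunctions P d)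
    (V.mkQ.comp (componentValues P d))
    ((constFunctions P d).submoduleOf (globalFunctions P d)).mkQ
    (V.mkQ_surjective.comp (componentValues_surjective hPd)) (Submodule.mkQ_surjective _) hker
  rw [← e.rank_eq, ← Module.finrank_eq_rank, Cardinal.mk_fintype]
  have h2 := V.finrank_quotient_add_finrank
  rw [finrank_span_singleton one_ne_zero, Module.finrank_fintype_fun_eq_card] at h2
  exact ⟨Cardinal.natCast_lt_aleph0, by rw [← h2, Nat.cast_add, Nat.cast_one]⟩

end

end FoliationP3

end

theorem mainTheorem6 (d : ℕ) (hd : 2 ≤ d) (F : FoliationP3.Foliation d)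
    (hF : F.ConormalLocallyFree) :
    (F.h2Conormal (1 - d) = 0 → IsConnected F.singCurve) ∧
    (F.SingCurveReduced →
      F.h2Conormal (1 - d) < Cardinal.aleph0 ∧
      Cardinal.mk (ConnectedComponents F.singCurve) = F.h2Conormal (1 - d) + 1) := by
  obtain ⟨P, hPd, hP⟩ := FoliationP3.TwistedField.exists_formOf F.toTwistedField
  obtain ⟨e⟩ := FoliationP3.nonempty_cechH2_equiv
    (FoliationP3.TwistedField.isConormalVal (φ := F.toTwistedField) hP) hPd hd
  have hrank : F.h2Conormal (1 - d) = Module.rank ℂ (FoliationP3.globalFunctions P d ⧸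
      (FoliationP3.constFunctions P d).submoduleOf (FoliationP3.globalFunctions P d)) := e.rank_eq
  have hZ : F.singCurve = FoliationP3.zeroSet P :=
    FoliationP3.TwistedField.singCurve_eq hPd hF hP
  rw [hrank, hZ]
  refine ⟨fun h => FoliationP3.isConnected_zeroSet hPd hd ?_, fun hred =>
    FoliationP3.rank_globalFunctions_quotient hPd hd hF hP hred⟩
  rw [rank_zero_iff] at h
  intro a ha
  have h0 := h.elim (Submodule.Quotient.mk ⟨a, ha⟩) 0
  rwa [Submodule.Quotient.mk_eq_zero] at h0
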